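/- Let $n\ge 2$. For a set $E\subset\mathbb R^n$ with sufficiently regular boundary (of class $C^{1,1}$, up to finitely many points) let $\gamma(E)=(2\pi)^{-n/2}\int_E e^{-|x|^2/2}\,dx$ and $$\mathscr H(E)=\int_{\partial E}H_{\partial E}\,e^{-|x|^2/2}\,d\mathcal H^{n-1},\qquad H_{\partial E}=\operatorname{div}_\tau\nu_{\partial E},$$ where $\nu_{\partial E}$ is the exterior unit normal, so that $H_{\partial E}$ is the sum of the principal curvatures (defined $\mathcal H^{n-1}$-a.e. on $\partial E$). Let $B_r$ be the open ball of radius $r$ centered at $0$. Functions in $W^{2,\infty}(\mathbb S^{n-1})$ are identified with their continuous representatives, and $\|u\|_{W^{2,\infty}}=\|u\|_\infty+\|\nabla u\|_\infty+\|\nabla^2u\|_\infty$, $\|u\|_{W^{1,2}}^2=\|u\|_{L^2(\mathbb S^{n-1})}^2+\|\nabla u\|_{L^2(\mathbb S^{n-1})}^2$, with tangential derivatives. **Theorem.** For all $r>0$ there exist $\varepsilon_0,C>0$, depending only on $n$ and $r$, with the following property. Let $u\in W^{2,\infty}(\mathbb S^{n-1})$ with $\|u\|_{W^{2,\infty}}\le\varepsilon<\varepsilon_0$,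 and suppose that $E=\{t\,r\,x(1+u(x)):x\in\mathbb S^{n-1},\ t\in(0,1)\}$ satisfies $\gamma(E)=\gamma(B_r)$. Then the integral defining $\mathscr H(E)$ converges absolutely, and: 1. $\displaystyle \mathscr H(B_r)-\mathscr H(E)\ \ge\ r^{n-2}e^{-r^2/2}\,\bigl(r^2-n+2-C\varepsilon_0\bigr)\,\|u\|_{W^{1,2}(\mathbb S^{n-1})}^2 .$ 2. $\displaystyle \mathscr H(B_r)-\mathscr H(E)\ \ge\ r^{n-2}e^{-r^2/2}\,\bigl(r^2-n+2-C\varepsilon\bigr)\,\|\nabla u\|_{L^2(\mathbb S^{n-1})}^2 ;$ and if $r^2\le n(n-2)$, then this also holds with $\|u\|_{W^{1,2}(\mathbb S^{n-1})}^2$ in place of $\|\nabla u\|_{L^2(\mathbb S^{n-1})}^2$. 3. If $r^2>n-2$ and $u\not\equiv0$, then $\mathscr H(E)<\mathscr H(B_r)$; thus the ball is a strict local maximizer. 4. If in addition $E=-E$, then $$\mathscr H(B_r)-\mathscr H(E)\ \le\ r^{n-2}e^{-r^2/2}\Bigl(C\varepsilon+r^2-(n-2)\frac{n-1}{2n}\Bigr)\|u\|_{W^{1,2}(\mathbb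 S^{n-1})}^2 ;$$ in particular, if moreover $r^2<\frac{(n-2)(n-1)}{2n}$ and $u\not\equiv0$, then $\mathscr H(E)>\mathscr H(B_r)$, so that the ball is not a local maximizer among symmetric sets. -/

import Mathlib

open MeasureTheory Metric Set Filter Topology
open scoped Pointwise ContDiff

noncomputable section

namespace GaussCurv

/-- The Euclidean space `ℝⁿ`. -/
abbrev Eu (n : ℕ) : Type := EuclideanSpace ℝ (Fin n)

/-- The unit sphere `𝕊ⁿ⁻¹` of `ℝⁿ`. -/
abbrev Sph (n : ℕ) : Type := sphere (0 : Eu n) 1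

/-- The surface measure `ℋⁿ⁻¹` on the unit sphere (Hausdorff measure with the standard
normalization, for which it agrees with Lebesgue measure on `(n-1)`-dimensional planes). -/
def sphMeasure (n : ℕ) : Measure (Sph n) := Measure.euclideanHausdorffMeasure (n - 1)

/-- The orthogonal projection of `ℝⁿ` onto the hyperplane `ν^⊥`. -/
def tangentProj {n : ℕ} (ν : Eu n) : Eu n →L[ℝ] Eu n := (Submodule.span ℝ {ν})ᗮ.starProjection

/-- The tangential divergence at `x` of a field `X` along a hypersurface `M` with unit normal `ν`
at `x`: the sum `∑ᵢ ⟨∇_{τᵢ} X, τᵢ⟩` over an orthonormal basis `τᵢ` of `T_x M = ν^⊥`, written as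
the trace of `D X ∘ P` with `P` the orthogonal projection onto `ν^⊥`. Only derivatives of `X`
along `M` enter. -/
def tangentialDiv {n : ℕ} (M : Set (Eu n)) (ν : Eu n) (X : Eu n → Eu n) (x : Eu n) : ℝ :=
  LinearMap.trace ℝ (Eu n) ((fderivWithin ℝ X M x ∘L tangentProj ν : Eu n →L[ℝ] Eu n) :
    Eu n →ₗ[ℝ] Eu n)

/-! ### Sobolev functions on the sphere -/

/-- `g` is the weak tangential gradient of `f` on the unit sphere: `g` is a tangential field and
`∫ f div_τ X = - ∫ ⟨g, X⟩` for every smooth tangential field `X`. -/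
structure IsWeakGradient {n : ℕ} (f : Sph n → ℝ) (g : Sph n → Eu n) : Prop where
  integrable_fun : Integrable f (sphMeasure n)
  integrable_grad : Integrable g (sphMeasure n)
  tangent : ∀ᵐ x ∂(sphMeasure n), inner ℝ (g x) (x : Eu n) = 0
  integral_eq : ∀ X : Eu n → Eu n, ContDiff ℝ ∞ X →
    (∀ x : Sph n, inner ℝ (X x) (x : Eu n) = 0) →
    ∫ x, f x * tangentialDiv (sphere (0 : Eu n) 1) (x : Eu n) X x ∂(sphMeasure n) =
      - ∫ x, inner ℝ (g x) (X x) ∂(sphMeasure n)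

open Classical in
/-- The weak tangential gradient `∇u` (unique up to null sets; `0` if there is none). -/
def weakGradient {n : ℕ} (u : Sph n → ℝ) : Sph n → Eu n :=
  if h : ∃ g, IsWeakGradient u g then h.choose else 0

/-- `A x e` is, for every vector `e`, the weak tangential gradient at `x` of the component
`⟨g, e⟩` of the field `g`. -/
def IsWeakJacobian {n : ℕ} (g : Sph n → Eu n) (A : Sph n → Eu n →L[ℝ] Eu n) : Prop :=
  ∀ e : Eu n, IsWeakGradient (fun x => inner ℝ (g x) e) (fun x => A x e)

open Classical in
/-- The weak tangential derivative of the components of `∇u` (unique up to null sets; `0` if there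
is none). -/
def weakJacobian {n : ℕ} (u : Sph n → ℝ) : Sph n → Eu n →L[ℝ] Eu n :=
  if h : ∃ A, IsWeakJacobian (weakGradient u) A then h.choose else 0

/-- The weak (covariant) Hessian `∇²u` on the sphere. For tangent vectors `σ, τ` at `x` one has
`∇²u(σ, τ) = ⟨∇_τ ∇u, σ⟩ = ⟨∇⟨∇u, σ⟩, τ⟩`; it is extended by `0` to the normal direction. -/
def weakHessian {n : ℕ} (u : Sph n → ℝ) (x : Sph n) : Eu n →L[ℝ] Eu n :=
  weakJacobian u x ∘L tangentProj (x : Eu n)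

/-- `u ∈ W^{2,∞}(𝕊ⁿ⁻¹)`, where `u` is the continuous representative of its class. -/
structure MemW2Inf {n : ℕ} (u : Sph n → ℝ) : Prop where
  continuous : Continuous u
  exists_gradient : ∃ g, IsWeakGradient u g
  exists_jacobian : ∃ A, IsWeakJacobian (weakGradient u) A
  gradient_bounded : MemLp (weakGradient u) ⊤ (sphMeasure n)
  hessian_bounded : MemLp (weakHessian u) ⊤ (sphMeasure n)

/-- The norm `‖u‖_{W^{2,∞}} = ‖u‖_∞ + ‖∇u‖_∞ + ‖∇²u‖_∞` (essential suprema). -/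
def w2InfNorm {n : ℕ} (u : Sph n → ℝ) : ℝ :=
  (eLpNorm u ⊤ (sphMeasure n)).toReal + (eLpNorm (weakGradient u) ⊤ (sphMeasure n)).toReal +
    (eLpNorm (weakHessian u) ⊤ (sphMeasure n)).toReal

/-- The squared norm `‖∇u‖²_{L²(𝕊ⁿ⁻¹)}`. -/
def gradNormSq {n : ℕ} (u : Sph n → ℝ) : ℝ := ∫ x, ‖weakGradient u x‖ ^ 2 ∂(sphMeasure n)

/-- The norm `‖u‖_{W^{1,2}(𝕊ⁿ⁻¹)} = (‖u‖²_{L²} + ‖∇u‖²_{L²})^{1/2}`. -/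
def w12Norm {n : ℕ} (u : Sph n → ℝ) : ℝ :=
  Real.sqrt ((∫ x, u x ^ 2 ∂(sphMeasure n)) + gradNormSq u)

/-! ### Normal, mean curvature, and the two Gaussian functionals -/

/-- `ν` is the exterior unit normal to `E` at `x`: near `x`, up to a set contained in arbitrarily
thin double cones around the hyperplane `x + ν^⊥`, the set `E` is the half-space
`{y | ⟨y - x, ν⟩ < 0}`. Such a `ν` is unique. -/
def IsExteriorNormal {n : ℕ} (E : Set (Eu n)) (x ν : Eu n) : Prop :=
  ‖ν‖ = 1 ∧ ∀ δ : ℝ, 0 < δ → ∀ᶠ y in 𝓝 x,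
    (inner ℝ (y - x) ν < -(δ * ‖y - x‖) → y ∈ E) ∧ (δ * ‖y - x‖ < inner ℝ (y - x) ν → y ∉ E)

open Classical in
/-- The exterior unit normal field `ν_{∂E}` (`0` at points without a normal). -/
def exteriorNormal {n : ℕ} (E : Set (Eu n)) (x : Eu n) : Eu n :=
  if h : ∃ ν, IsExteriorNormal E x ν then h.choose else 0

/-- The mean curvature `H_{∂E} = div_τ ν_{∂E}` (sum of the principal curvatures). For a set of
class `C^{1,1}` it is defined at almost every point of `∂E`. -/
def meanCurvature {n : ℕ} (E : Set (Eu n)) (x : Eu n) : ℝ :=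
  tangentialDiv (frontier E) (exteriorNormal E x) (exteriorNormal E) x

/-- The Gaussian weighted mean curvature `H_{∂E}(x) e^{-|x|²/2}`. -/
def weightedCurvature {n : ℕ} (E : Set (Eu n)) (x : Eu n) : ℝ :=
  meanCurvature E x * Real.exp (-‖x‖ ^ 2 / 2)

/-- The functional `𝓗(E) = ∫_{∂E} H_{∂E} e^{-|x|²/2} dℋⁿ⁻¹`. -/
def curvatureIntegral {n : ℕ} (E : Set (Eu n)) : ℝ :=
  ∫ x in frontier E, weightedCurvature E x ∂(Measure.euclideanHausdorffMeasure (n - 1))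

/-- The Gaussian measure `γ(E) = (2π)^{-n/2} ∫_E e^{-|x|²/2} dx`. -/
def gaussianVolume {n : ℕ} (E : Set (Eu n)) : ℝ :=
  1 / (2 * Real.pi) ^ ((n : ℝ) / 2) * ∫ x in E, Real.exp (-‖x‖ ^ 2 / 2)

/-- The radial perturbation `{t r x (1 + u(x)) : x ∈ 𝕊ⁿ⁻¹, t ∈ (0,1)}` of the ball `B_r`. -/
def radialSet {n : ℕ} (r : ℝ) (u : Sph n → ℝ) : Set (Eu n) :=
  {y | ∃ x : Sph n, ∃ t ∈ Ioo (0 : ℝ) 1, y = (t * r * (1 + u x)) • (x : Eu n)}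

end GaussCurv

end

/-! Write `p = ∇u / (1 + u)`, `ρ = r (1 + u)`, `J = √(1 + |p|²)` and `w(s) = s^(n-2) exp(-s²/2)`.
The boundary of `E` is, up to the origin, the radial graph of `ρ`. Its area element is `ρ^(n-1) J`,
and its mean curvature is `ρ⁻¹ (J⁻¹ (n - 1 - div p) + J⁻³ ⟨p, Dp p⟩)`. In the product one power of
`ρ` and the factor `J` cancel, so the functional is the integral over the sphere of `w(ρ) (n - 1 -
div p + ⟨p, Dp p⟩ / (1 + |p|²))`. Since `∇(w(ρ)) = w'(ρ) ρ p` and `s w'(s) = (n - 2 - s²) w(s)`,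
integration by parts replaces the divergence term by `∫ (n - 2 - ρ²) w(ρ) |p|²`
(`curvatureIntegral_eq`). Second derivatives survive only in the last term, which is `O(ε) ‖∇u‖²`.

The volume constraint says `∫ (F(ρ) - F(r)) = 0` with `F'(s) = s w(s)`. Subtracting from `w(ρ) -
w(r)` the multiple `(n - 2 - r²) / r²` of the vanishing integrand removes the linear term, and the
terms in `r²` cancel exactly: what is left is `-(n - 2) w(r) u²` plus `(n - 2) O(|u|³)`
(`exists_gaussWeight_expansion`). Hence (`exists_curvatureIntegral_expansion`) the deficit of `E`
with respect to the ball is `w(r) ((n-1)(n-2) ‖u‖² + (r² - n + 2) ‖∇u‖²)` with error `O(ε) ((n-2)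
‖u‖² + ‖∇u‖²)`. The error in `‖u‖²` carries the same factor `n - 2` as the positive main term and is
absorbed by it, also when `n = 2`. The lower bounds and strict maximality are then algebra
(`deficit_bounds`); if `∇u = 0`, then `u` is constant, and the constraint makes it zero.

For symmetric `E` the function `u` is even and its mean is `O(‖u‖²)`. The Poincaré inequality for
even functions, whose first nonzero eigenvalue is `2 n` (`even_poincare`), bounds `‖u‖²` by `‖∇u‖²`,
and the quadratic form becomes an upper bound. The eigenfunctions come from even powers of linear
functions and are dense among even functions by Stone–Weierstrass.

The analytic base has three ingredients. Testing weak derivatives along rotations turns the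
`W^{2,∞}` bound into a Lipschitz gradient and a second order Taylor bound (`MemW2Inf.exists_isC11`).
Rademacher's theorem and the divergence theorem for Lipschitz fields on the sphere follow through
`0`-homogeneous extension and rotation invariance (`integral_trace_fderiv_homExt`). The area formula
comes from comparing each small piece of the graph with its linearization
(`hausdorffMeasure_restrict_range_eq_map`). -/

noncomputable section

namespace GaussCurv

/-! ### Surface measure on the sphere: finiteness, invariance, uniqueness. -/

section

open scoped NNReal ENNReal

variable {n : ℕ}

/-! ### Hausdorff measure and Lipschitz comparison -/

/-- The bound forces `f` to factor on `A` through `g`, and the factor is `K`-Lipschitz on `g '' A`.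
Using two maps on a common domain allows comparing a set with its tangent projection, or a graph
with its linearization, without naming an inverse map. -/
theorem euclideanHausdorffMeasure_image_le_of_dist_le {X Y Z : Type*} [MetricSpace Y]
    [MeasurableSpace Y] [BorelSpace Y] [MetricSpace Z] [MeasurableSpace Z] [BorelSpace Z]
    (d : ℕ) (A : Set X) (f : X → Y) (g : X → Z) (K : ℝ≥0)
    (h : ∀ x ∈ A, ∀ y ∈ A, dist (f x) (f y) ≤ K * dist (g x) (g y)) :
    μHE[d] (f '' A) ≤ (K : ℝ≥0∞) ^ d * μHE[d] (g '' A) := by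
  classical
  rcases A.eq_empty_or_nonempty with rfl | ⟨a, ha⟩
  · simp
  have : Nonempty X := ⟨a⟩
  set φ : Z → Y := f ∘ Function.invFunOn g A with hφ
  have key : ∀ x ∈ A, φ (g x) = f x := by
    intro x hx
    have h1 : g x ∈ g '' A := ⟨x, hx, rfl⟩
    have h2 := h _ (Function.invFunOn_mem h1) x hx
    rw [Function.invFunOn_eq h1, dist_self, mul_zero] at h2
    exact dist_le_zero.1 h2
  have hL : LipschitzOnWith K φ (g '' A) := by
    apply LipschitzOnWith.of_dist_le_mul
    rintro _ ⟨x, hx, rfl⟩ _ ⟨y, hy, rfl⟩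
    rw [key x hx, key y hy]
    exact h x hx y hy
  have himg : f '' A = φ '' (g '' A) := by
    rw [Set.image_image]
    exact (Set.image_congr key).symm
  rw [himg, Measure.euclideanHausdorffMeasure_def, Measure.euclideanHausdorffMeasure_def,
    Measure.smul_apply, Measure.smul_apply]
  have := hL.hausdorffMeasure_image_le (d := (d : ℝ)) (by positivity)
  rw [ENNReal.rpow_natCast] at this
  rw [Measure.nnreal_smul_coe_apply, Measure.nnreal_smul_coe_apply, mul_left_comm]
  gcongr

/-! ### The orthogonal complement of a unit vector -/

theorem norm_coe_sph (x : Sph n) : ‖(x : Eu n)‖ = 1 := by simp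

theorem coe_sph_ne_zero (x : Sph n) : (x : Eu n) ≠ 0 := by
  intro h
  have := norm_coe_sph x
  simp [h] at this

theorem inner_self_sph (x : Sph n) : inner ℝ (x : Eu n) (x : Eu n) = 1 := by
  rw [real_inner_self_eq_norm_sq, norm_coe_sph]; norm_num

/-- The tangent space of the sphere at `x`. -/
abbrev tangentSubmodule (x : Sph n) : Submodule ℝ (Eu n) := (Submodule.span ℝ {(x : Eu n)})ᗮ

theorem finrank_tangentSubmodule (x : Sph n) :
    Module.finrank ℝ (tangentSubmodule x) = n - 1 := by
  have h := Submodule.finrank_add_finrank_orthogonal (Submodule.span ℝ {(x : Eu n)})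
  rw [finrank_span_singleton (coe_sph_ne_zero x), finrank_euclideanSpace_fin] at h
  change 1 + Module.finrank ℝ (tangentSubmodule x) = n at h
  omega

theorem tangent_euclideanHausdorffMeasure_eq_volume (x : Sph n) :
    (μHE[n - 1] : Measure (tangentSubmodule x)) = volume := by
  rw [← finrank_tangentSubmodule x]
  exact InnerProductSpace.euclideanHausdorffMeasure_eq_volume

theorem tangentProj_apply (x : Sph n) (z : Eu n) :
    tangentProj (x : Eu n) z = z - (inner ℝ (x : Eu n) z) • (x : Eu n) := by
  rw [tangentProj, Submodule.starProjection_orthogonal_val,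
    Submodule.starProjection_unit_singleton ℝ (norm_coe_sph x)]

theorem coe_orthogonalProjection_tangent (x : Sph n) (z : Eu n) :
    ((tangentSubmodule x).orthogonalProjectionOnto z : Eu n) =
      z - (inner ℝ (x : Eu n) z) • (x : Eu n) := by
  rw [← tangentProj_apply]; rfl

theorem mem_tangentSubmodule {x : Sph n} {z : Eu n} :
    z ∈ tangentSubmodule x ↔ inner ℝ (x : Eu n) z = 0 :=
  Submodule.mem_orthogonal_singleton_iff_inner_right

/-- Secants of the sphere near `a` are almost orthogonal to `a`. -/
theorem abs_inner_secant_le (a x y : Sph n) :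
    |inner ℝ (a : Eu n) ((x : Eu n) - y)| ≤
      max (dist x a) (dist y a) * ‖(x : Eu n) - y‖ := by
  have h0 : inner ℝ ((x : Eu n) + y) ((x : Eu n) - y) = 0 := by
    rw [real_inner_add_sub_eq_zero_iff, norm_coe_sph, norm_coe_sph]
  have h1 : inner ℝ (a : Eu n) ((x : Eu n) - y) =
      inner ℝ ((2 : ℝ)⁻¹ • (((a : Eu n) - x) + ((a : Eu n) - y))) ((x : Eu n) - y) := by
    have : (2 : ℝ)⁻¹ • (((a : Eu n) - x) + ((a : Eu n) - y)) =
        (a : Eu n) - (2 : ℝ)⁻¹ • ((x : Eu n) + y) := by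
      module
    rw [this, inner_sub_left, real_inner_smul_left, h0]; ring
  rw [h1]
  refine (abs_real_inner_le_norm _ _).trans ?_
  gcongr
  rw [norm_smul]
  have e1 : ‖(a : Eu n) - x‖ = dist x a := by rw [Subtype.dist_eq, dist_eq_norm, norm_sub_rev]
  have e2 : ‖(a : Eu n) - y‖ = dist y a := by rw [Subtype.dist_eq, dist_eq_norm, norm_sub_rev]
  have := norm_add_le ((a : Eu n) - x) ((a : Eu n) - y)
  rw [e1, e2] at this
  have h3 := le_max_left (dist x a) (dist y a)
  have h4 := le_max_right (dist x a) (dist y a)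
  rw [Real.norm_of_nonneg (by norm_num)]
  linarith

theorem norm_secant_sub_proj_le (a x y : Sph n) :
    ‖((x : Eu n) - y) - ((tangentSubmodule a).orthogonalProjectionOnto ((x : Eu n) - y) : Eu n)‖ ≤
      max (dist x a) (dist y a) * ‖(x : Eu n) - y‖ := by
  rw [coe_orthogonalProjection_tangent, sub_sub_cancel, norm_smul, norm_coe_sph, mul_one]
  exact abs_inner_secant_le a x y

/-- Together with the contraction property of the projection, this makes the tangent projection at
`a` nearly isometric on small neighbourhoods of `a`. -/
theorem norm_secant_le_norm_proj (a x y : Sph n) {η : ℝ} (hx : dist x a ≤ η)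
    (hy : dist y a ≤ η) :
    (1 - η) * ‖(x : Eu n) - y‖ ≤
      ‖(tangentSubmodule a).orthogonalProjectionOnto ((x : Eu n) - y)‖ := by
  have h := norm_secant_sub_proj_le a x y
  have h2 := norm_sub_norm_le ((x : Eu n) - y)
    ((tangentSubmodule a).orthogonalProjectionOnto ((x : Eu n) - y) : Eu n)
  have h3 : max (dist x a) (dist y a) * ‖(x : Eu n) - y‖ ≤ η * ‖(x : Eu n) - y‖ := by
    gcongr; exact max_le hx hy
  rw [Submodule.coe_norm] 
  linarith

/-! ### The surface measure -/

/-- On a ball of radius `1/2` the inverse of the tangent projection is `2`-Lipschitz, and the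
projected set lies in the unit ball of a space of dimension `n - 1`. -/
instance isLocallyFiniteMeasure_sphMeasure : IsLocallyFiniteMeasure (sphMeasure n) := by
  refine ⟨fun a => ⟨ball a (1 / 2), ball_mem_nhds _ (by norm_num), ?_⟩⟩
  have h := euclideanHausdorffMeasure_image_le_of_dist_le (n - 1) (ball a (1 / 2))
    (fun x : Sph n => x) (fun x : Sph n => (tangentSubmodule a).orthogonalProjectionOnto (x : Eu n)) 2
    (by
      intro x hx y hy
      have := norm_secant_le_norm_proj a x y (mem_ball.1 hx).le (mem_ball.1 hy).le
      rw [Subtype.dist_eq x y, dist_eq_norm, dist_eq_norm, ← map_sub]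
      push_cast
      linarith)
  rw [Set.image_id', tangent_euclideanHausdorffMeasure_eq_volume] at h
  refine h.trans_lt (ENNReal.mul_lt_top (by simp) ?_)
  refine (measure_mono (t := closedBall 0 1) ?_).trans_lt measure_closedBall_lt_top
  rintro _ ⟨x, -, rfl⟩
  rw [mem_closedBall, dist_zero_right]
  refine (Submodule.norm_orthogonalProjectionOnto_apply_le _ _).trans (norm_coe_sph x).le

instance isFiniteMeasure_sphMeasure : IsFiniteMeasure (sphMeasure n) :=
  inferInstance

/-- The tangent projection does not increase measure, and its image contains the open unit ball: a
tangent vector `v` lifts to `v + √(1 - |v|²) a`. -/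
theorem sphMeasure_univ_ne_zero (a : Sph n) : sphMeasure n univ ≠ 0 := by
  intro h0
  have h := euclideanHausdorffMeasure_image_le_of_dist_le (n - 1) univ
    (fun x : Sph n => (tangentSubmodule a).orthogonalProjectionOnto (x : Eu n)) (fun x : Sph n => x) 1
    (by
      intro x _ y _
      rw [Subtype.dist_eq x y, dist_eq_norm, dist_eq_norm, ← map_sub]
      push_cast
      rw [one_mul]
      exact Submodule.norm_orthogonalProjectionOnto_apply_le _ _)
  rw [Set.image_id', tangent_euclideanHausdorffMeasure_eq_volume] at h
  change _ ≤ _ * sphMeasure n univ at h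
  rw [h0, mul_zero] at h
  have hball : (ball (0 : tangentSubmodule a) 1) ⊆
      (fun x : Sph n => (tangentSubmodule a).orthogonalProjectionOnto (x : Eu n)) '' univ := by
    intro v hv
    rw [mem_ball, dist_zero_right] at hv
    have hv0 : inner ℝ (a : Eu n) (v : Eu n) = 0 := mem_tangentSubmodule.1 v.2
    have hn : 0 ≤ 1 - ‖v‖ ^ 2 := by nlinarith [norm_nonneg v]
    refine ⟨⟨(v : Eu n) + Real.sqrt (1 - ‖v‖ ^ 2) • (a : Eu n), ?_⟩, mem_univ _, ?_⟩
    · rw [mem_sphere, dist_zero_right]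
      have : ‖(v : Eu n) + Real.sqrt (1 - ‖v‖ ^ 2) • (a : Eu n)‖ ^ 2 = 1 := by
        rw [norm_add_sq_real, real_inner_smul_right, real_inner_comm, hv0, norm_smul,
          norm_coe_sph, Real.norm_of_nonneg (Real.sqrt_nonneg _), mul_one, Real.sq_sqrt hn]
        simp
      nlinarith [norm_nonneg ((v : Eu n) + Real.sqrt (1 - ‖v‖ ^ 2) • (a : Eu n))]
    · apply Subtype.ext
      change ((tangentSubmodule a).orthogonalProjectionOnto
        ((v : Eu n) + Real.sqrt (1 - ‖v‖ ^ 2) • (a : Eu n)) : Eu n) = v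
      rw [coe_orthogonalProjection_tangent, inner_add_right, real_inner_smul_right, hv0,
        inner_self_sph]
      simp
  have h2 := (measure_mono hball).trans h
  exact (measure_ball_pos volume (0 : tangentSubmodule a) one_pos).ne' (le_antisymm h2 bot_le)

/-- The action of a linear isometry on the unit sphere. -/
def sphMap (R : Eu n ≃ₗᵢ[ℝ] Eu n) : Sph n ≃ᵢ Sph n where
  toFun x := ⟨R x, by simp⟩
  invFun x := ⟨R.symm x, by simp⟩
  left_inv x := by ext1; simp
  right_inv x := by ext1; simp
  isometry_toFun := by
    intro x y
    simp only [Subtype.edist_eq]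
    exact R.isometry x y

theorem measurePreserving_sphMap (R : Eu n ≃ₗᵢ[ℝ] Eu n) :
    MeasurePreserving (sphMap R) (sphMeasure n) (sphMeasure n) :=
  (sphMap R).measurePreserving_euclideanHausdorffMeasure (n - 1)

theorem exists_sphMap_eq (x y : Sph n) : ∃ R : Eu n ≃ₗᵢ[ℝ] Eu n, sphMap R x = y := by
  refine ⟨Submodule.reflection (Submodule.span ℝ {(x : Eu n) - y})ᗮ, Subtype.ext ?_⟩
  exact Submodule.reflection_sub (by rw [norm_coe_sph, norm_coe_sph])

/-- Isometries act transitively, so one nonempty open null set would make every point have a null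
neighbourhood and the whole sphere null. -/
instance isOpenPosMeasure_sphMeasure : (sphMeasure n).IsOpenPosMeasure := by
  refine ⟨fun U hU hne h0 => ?_⟩
  obtain ⟨a, ha⟩ := hne
  refine sphMeasure_univ_ne_zero a (measure_null_of_locally_null _ fun x _ => ?_)
  obtain ⟨R, hR⟩ := exists_sphMap_eq x a
  refine ⟨sphMap R ⁻¹' U, mem_nhdsWithin_of_mem_nhds
    ((hU.preimage (sphMap R).continuous).mem_nhds (by rw [mem_preimage, hR]; exact ha)), ?_⟩
  rw [(measurePreserving_sphMap R).measure_preimage hU.measurableSet.nullMeasurableSet, h0]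

theorem measure_ball_eq_of_invariant {μ : Measure (Sph n)}
    (h : ∀ R : Eu n ≃ₗᵢ[ℝ] Eu n, MeasurePreserving (sphMap R) μ μ) (x y : Sph n) (δ : ℝ) :
    μ (ball x δ) = μ (ball y δ) := by
  obtain ⟨R, hR⟩ := exists_sphMap_eq x y
  rw [← hR, ← (h R).measure_preimage
    (measurableSet_ball (x := sphMap R x) (ε := δ)).nullMeasurableSet,
    (sphMap R).isometry.preimage_ball]

/-! ### Uniqueness of uniformly distributed measures -/

/-- Fubini on `{dist x y < δ}` writes `ν(ball) ∫ F dμ` as the `ν`-integral of `∫ F dμ` over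
`δ`-balls. For continuous `F` and small `δ` these inner integrals are close to `μ(ball) F(y)`, and
`F = 1` identifies the ratio of the ball masses with the ratio of the total masses. This is
Christensen's uniqueness argument for uniformly distributed measures. -/
theorem lintegral_le_of_measure_ball_eq {X : Type*} [MetricSpace X] [CompactSpace X]
    [MeasurableSpace X] [BorelSpace X] (μ ν : Measure X) [IsFiniteMeasure μ] [IsFiniteMeasure ν]
    [μ.IsOpenPosMeasure]
    (hμ : ∀ x y δ, μ (ball x δ) = μ (ball y δ)) (hν : ∀ x y δ, ν (ball x δ) = ν (ball y δ))
    (f : X → ℝ≥0) (hf : Continuous f) :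
    ν univ * ∫⁻ x, f x ∂μ ≤ μ univ * ∫⁻ x, f x ∂ν := by
  rcases isEmpty_or_nonempty X with hX | ⟨⟨a⟩⟩
  · simp [Measure.eq_zero_of_isEmpty μ]
  have main : ∀ w : ℝ≥0, 0 < w →
      ν univ * ∫⁻ x, f x ∂μ ≤ μ univ * (∫⁻ x, f x ∂ν + w * ν univ) := by
    intro w hw
    obtain ⟨δ, hδ, hfδ⟩ := Metric.uniformContinuous_iff.1
      (CompactSpace.uniformContinuous_of_continuous hf) w hw
    set m := μ (ball a δ)
    set k := ν (ball a δ)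
    have hm0 : m ≠ 0 := (measure_ball_pos μ a hδ).ne'
    have hmt : m ≠ ⊤ := measure_ne_top _ _
    have swap : ∀ F : X → ℝ≥0∞, Measurable F →
        k * ∫⁻ x, F x ∂μ = ∫⁻ y, ∫⁻ x in ball y δ, F x ∂μ ∂ν := by
      intro F hF
      have hS : MeasurableSet {q : X × X | dist q.1 q.2 < δ} :=
        (isOpen_lt (by fun_prop) continuous_const).measurableSet
      calc k * ∫⁻ x, F x ∂μ = ∫⁻ x, ν (ball x δ) * F x ∂μ := by
            rw [← lintegral_const_mul _ hF]
            exact lintegral_congr fun x => by rw [hν x a]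
        _ = ∫⁻ x, ∫⁻ y, (ball x δ).indicator (fun _ => F x) y ∂ν ∂μ := by
            refine lintegral_congr fun x => ?_
            rw [lintegral_indicator measurableSet_ball, setLIntegral_const, mul_comm]
        _ = ∫⁻ x, ∫⁻ y, {q : X × X | dist q.1 q.2 < δ}.indicator (fun q => F q.1) (x, y) ∂ν ∂μ := by
            refine lintegral_congr fun x => lintegral_congr fun y => ?_
            by_cases h : (x, y) ∈ {q : X × X | dist q.1 q.2 < δ}
            · rw [indicator_of_mem h, indicator_of_mem (mem_ball'.2 h)]
            · rw [indicator_of_notMem h, indicator_of_notMem (fun h' => h (mem_ball'.1 h'))]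
        _ = ∫⁻ y, ∫⁻ x, {q : X × X | dist q.1 q.2 < δ}.indicator (fun q => F q.1) (x, y) ∂μ ∂ν :=
            lintegral_lintegral_swap
              (((hF.comp measurable_fst).indicator hS).aemeasurable)
        _ = _ := by
            refine lintegral_congr fun y => ?_
            rw [← lintegral_indicator measurableSet_ball]
            refine lintegral_congr fun x => ?_
            by_cases h : (x, y) ∈ {q : X × X | dist q.1 q.2 < δ}
            · rw [indicator_of_mem h, indicator_of_mem (mem_ball.2 h)]
            · rw [indicator_of_notMem h, indicator_of_notMem (fun h' => h (mem_ball.1 h'))]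
    have hfm : Measurable fun x => (f x : ℝ≥0∞) := hf.measurable.coe_nnreal_ennreal
    -- The constant function trades the unknown ratio `m / k` for that of the total masses.
    have h1 : k * μ univ = m * ν univ := by
      have := swap (fun _ => 1) measurable_const
      simp only [lintegral_const, one_mul, MeasurableSet.univ, Measure.restrict_apply,
        univ_inter] at this
      rw [this]
      simp only [hμ _ a δ]
      simp [m]
    have h2 : k * ∫⁻ x, f x ∂μ ≤ m * (∫⁻ x, f x ∂ν + w * ν univ) := by
      rw [swap _ hfm]
      calc ∫⁻ y, ∫⁻ x in ball y δ, f x ∂μ ∂ν ≤ ∫⁻ y, m * (f y + w) ∂ν := by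
            refine lintegral_mono fun y => ?_
            calc ∫⁻ x in ball y δ, f x ∂μ ≤ ∫⁻ x in ball y δ, ((f y : ℝ≥0∞) + w) ∂μ := by
                  refine setLIntegral_mono' measurableSet_ball fun x hx => ?_
                  have h4 := hfδ (mem_ball.1 hx)
                  rw [NNReal.dist_eq] at h4
                  have h5 : (f x : ℝ) ≤ f y + w := by linarith [(abs_lt.1 h4).2]
                  exact_mod_cast h5
              _ = m * (f y + w) := by rw [setLIntegral_const, hμ y a, mul_comm]
        _ = _ := by
            rw [lintegral_const_mul _ (hfm.add_const _), lintegral_add_right _ measurable_const,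
              lintegral_const]
    have h3 : m * (ν univ * ∫⁻ x, f x ∂μ) ≤ m * (μ univ * (∫⁻ x, f x ∂ν + w * ν univ)) := by
      rw [← mul_assoc, ← h1, mul_left_comm m, mul_comm k, mul_assoc]
      gcongr
    exact (ENNReal.mul_le_mul_iff_right hm0 hmt).1 h3
  have ht : Tendsto (fun w : ℝ≥0 => μ univ * (∫⁻ x, f x ∂ν + w * ν univ)) (𝓝[>] 0)
      (𝓝 (μ univ * (∫⁻ x, f x ∂ν + (0 : ℝ≥0) * ν univ))) := by
    apply Tendsto.mono_left _ nhdsWithin_le_nhds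
    refine ENNReal.Tendsto.const_mul ?_ (Or.inr (measure_ne_top _ _))
    refine Tendsto.add tendsto_const_nhds ?_
    exact ENNReal.Tendsto.mul_const (ENNReal.tendsto_coe.2 tendsto_id)
      (Or.inr (measure_ne_top _ _))
  simp only [ENNReal.coe_zero, zero_mul, add_zero] at ht
  exact ge_of_tendsto ht (by filter_upwards [self_mem_nhdsWithin] with w hw using main w hw)

theorem smul_eq_smul_of_measure_ball_eq {X : Type*} [MetricSpace X] [CompactSpace X]
    [MeasurableSpace X] [BorelSpace X] (μ ν : Measure X) [IsFiniteMeasure μ] [IsFiniteMeasure ν]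
    [μ.IsOpenPosMeasure] [ν.IsOpenPosMeasure]
    (hμ : ∀ x y δ, μ (ball x δ) = μ (ball y δ)) (hν : ∀ x y δ, ν (ball x δ) = ν (ball y δ)) :
    ν univ • μ = μ univ • ν := by
  have : IsFiniteMeasure (ν univ • μ) := Measure.smul_finite _ (measure_ne_top _ _)
  refine ext_of_forall_lintegral_eq_of_IsFiniteMeasure fun f => ?_
  rw [lintegral_smul_measure, lintegral_smul_measure, smul_eq_mul, smul_eq_mul]
  exact le_antisymm (lintegral_le_of_measure_ball_eq μ ν hμ hν f f.continuous)
    (lintegral_le_of_measure_ball_eq ν μ hν hμ f f.continuous)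

theorem measurePreserving_sphMap_toSphere (R : Eu n ≃ₗᵢ[ℝ] Eu n) :
    MeasurePreserving (sphMap R) (volume : Measure (Eu n)).toSphere
      (volume : Measure (Eu n)).toSphere := by
  refine ⟨(sphMap R).continuous.measurable, Measure.ext fun s hs => ?_⟩
  rw [Measure.map_apply (sphMap R).continuous.measurable hs, Measure.toSphere_apply' _ hs,
    Measure.toSphere_apply' _ ((sphMap R).continuous.measurable hs)]
  congr 1
  rw [← R.measurePreserving.measure_preimage_equiv (f := R.toMeasurableEquiv)
    (Ioo (0 : ℝ) 1 • (Subtype.val '' s))]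
  congr 1
  ext z
  constructor
  · rintro ⟨t, ht, _, ⟨x, hx, rfl⟩, rfl⟩
    exact ⟨t, ht, _, ⟨sphMap R x, hx, rfl⟩, (map_smul R t (x : Eu n)).symm⟩
  · rintro ⟨t, ht, _, ⟨x, hx, rfl⟩, hz⟩
    change t • (x : Eu n) = R z at hz
    have hRx : sphMap R ((sphMap R).symm x) = x := (sphMap R).apply_symm_apply x
    refine ⟨t, ht, _, ⟨(sphMap R).symm x, ?_, rfl⟩, ?_⟩
    · rwa [mem_preimage, hRx]
    · apply R.injective
      change R (t • ((sphMap R).symm x : Eu n)) = R z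
      rw [← hz, map_smul]
      congr 1
      exact congrArg Subtype.val hRx

/-- The cone measure and the Hausdorff measure are both rotation invariant, hence proportional. The
value of the factor is never needed: it serves to transfer null sets, and in the volume constraint
it cancels. -/
theorem exists_toSphere_eq_smul (hn : 1 ≤ n) :
    ∃ c : ℝ≥0∞, c ≠ 0 ∧ c ≠ ⊤ ∧ (volume : Measure (Eu n)).toSphere = c • sphMeasure n := by
  have hne : Nonempty (Sph n) := by
    refine ⟨⟨EuclideanSpace.single ⟨0, hn⟩ 1, by simp⟩⟩
  obtain ⟨a⟩ := hne
  have h := smul_eq_smul_of_measure_ball_eq (sphMeasure n) (volume : Measure (Eu n)).toSphere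
    (fun x y δ => measure_ball_eq_of_invariant measurePreserving_sphMap x y δ)
    (fun x y δ => measure_ball_eq_of_invariant measurePreserving_sphMap_toSphere x y δ)
  have h1 := sphMeasure_univ_ne_zero a
  have h2 : sphMeasure n univ ≠ ⊤ := measure_ne_top _ _
  have h3 : (volume : Measure (Eu n)).toSphere univ ≠ 0 :=
    isOpen_univ.measure_ne_zero _ ⟨a, mem_univ a⟩
  refine ⟨(sphMeasure n univ)⁻¹ * (volume : Measure (Eu n)).toSphere univ,
    mul_ne_zero (ENNReal.inv_ne_zero.2 h2) h3,
    ENNReal.mul_ne_top (ENNReal.inv_ne_top.2 h1) (measure_ne_top _ _), ?_⟩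
  rw [mul_smul, h, smul_smul, ENNReal.inv_mul_cancel h1 h2, one_smul]

end

/-! ### Rotations as test flows, and tangential derivatives. -/

section

open scoped NNReal ENNReal

variable {n : ℕ}

/-! ### Rotations in a plane -/

/-- An orthonormal pair, spanning an oriented plane. -/
structure Plane (n : ℕ) where
  /-- the first vector -/
  a : Eu n
  /-- the second vector -/
  b : Eu n
  norm_a : ‖a‖ = 1
  norm_b : ‖b‖ = 1
  inner_ab : inner ℝ a b = 0

namespace Plane

variable (P : Plane n)

theorem inner_aa : inner ℝ P.a P.a = 1 := by rw [real_inner_self_eq_norm_sq, P.norm_a]; norm_num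

theorem inner_bb : inner ℝ P.b P.b = 1 := by rw [real_inner_self_eq_norm_sq, P.norm_b]; norm_num

theorem inner_ba : inner ℝ P.b P.a = 0 := by rw [real_inner_comm, P.inner_ab]

/-- The generator `z ↦ ⟨a, z⟩ b - ⟨b, z⟩ a` of the rotations in the plane. -/
def gen : Eu n →L[ℝ] Eu n :=
  (innerSL ℝ P.a).smulRight P.b - (innerSL ℝ P.b).smulRight P.a

theorem gen_apply (z : Eu n) : P.gen z = inner ℝ P.a z • P.b - inner ℝ P.b z • P.a := rfl

theorem inner_gen_self (z : Eu n) : inner ℝ z (P.gen z) = 0 := by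
  rw [gen_apply, inner_sub_right, real_inner_smul_right, real_inner_smul_right,
    real_inner_comm z P.a, real_inner_comm z P.b]
  ring

theorem inner_a_gen (z : Eu n) : inner ℝ P.a (P.gen z) = - inner ℝ P.b z := by
  rw [gen_apply, inner_sub_right, real_inner_smul_right, real_inner_smul_right, P.inner_ab,
    P.inner_aa]
  ring

theorem inner_b_gen (z : Eu n) : inner ℝ P.b (P.gen z) = inner ℝ P.a z := by
  rw [gen_apply, inner_sub_right, real_inner_smul_right, real_inner_smul_right, P.inner_ba,
    P.inner_bb]
  ring

/-- The linear map underlying the rotation by the angle `t`. -/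
def rotLin (t : ℝ) : Eu n →ₗ[ℝ] Eu n :=
  LinearMap.id + (Real.sin t) • (P.gen : Eu n →ₗ[ℝ] Eu n) +
    (1 - Real.cos t) • ((P.gen ∘L P.gen : Eu n →L[ℝ] Eu n) : Eu n →ₗ[ℝ] Eu n)

theorem rotLin_apply (t : ℝ) (z : Eu n) :
    P.rotLin t z = z + Real.sin t • P.gen z + (1 - Real.cos t) • P.gen (P.gen z) := rfl

theorem gen_gen (z : Eu n) :
    P.gen (P.gen z) = -(inner ℝ P.a z • P.a + inner ℝ P.b z • P.b) := by
  rw [gen_apply, inner_a_gen, inner_b_gen]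
  module

/-- This identity makes `rotLin`, Rodrigues' formula, the exponential of `t • gen`: the group law
and the derivative in `t` reduce to the addition formulas for sine and cosine. -/
theorem gen_gen_gen (z : Eu n) : P.gen (P.gen (P.gen z)) = - P.gen z := by
  rw [P.gen_gen (P.gen z), inner_a_gen, inner_b_gen, gen_apply]
  module

theorem gen_rotLin (t : ℝ) (z : Eu n) :
    P.gen (P.rotLin t z) = Real.cos t • P.gen z + Real.sin t • P.gen (P.gen z) := by
  rw [rotLin_apply, map_add, map_add, map_smul, map_smul, gen_gen_gen]
  module

theorem rotLin_add (s t : ℝ) (z : Eu n) : P.rotLin (s + t) z = P.rotLin s (P.rotLin t z) := by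
  rw [P.rotLin_apply s (P.rotLin t z), gen_rotLin, map_add, map_smul, map_smul, gen_gen_gen,
    rotLin_apply, rotLin_apply, Real.sin_add, Real.cos_add]
  module

theorem rotLin_zero (z : Eu n) : P.rotLin 0 z = z := by simp [rotLin_apply]

theorem norm_rotLin (t : ℝ) (z : Eu n) : ‖P.rotLin t z‖ = ‖z‖ := by
  have h1 : inner ℝ z (P.gen z) = 0 := P.inner_gen_self z
  have h2 : inner ℝ (P.gen z) (P.gen (P.gen z)) = 0 := P.inner_gen_self _
  have h3 : inner ℝ z (P.gen (P.gen z)) = -(inner ℝ P.a z ^ 2 + inner ℝ P.b z ^ 2) := by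
    rw [gen_gen, inner_neg_right, inner_add_right, real_inner_smul_right, real_inner_smul_right,
      real_inner_comm P.a z, real_inner_comm P.b z]
    ring
  have h4 : ‖P.gen z‖ ^ 2 = inner ℝ P.a z ^ 2 + inner ℝ P.b z ^ 2 := by
    rw [← real_inner_self_eq_norm_sq]
    nth_rewrite 1 [gen_apply]
    rw [inner_sub_left, real_inner_smul_left, real_inner_smul_left, inner_b_gen, inner_a_gen]
    ring
  have h5 : ‖P.gen (P.gen z)‖ ^ 2 = inner ℝ P.a z ^ 2 + inner ℝ P.b z ^ 2 := by
    rw [← real_inner_self_eq_norm_sq]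
    nth_rewrite 1 [gen_apply]
    rw [inner_sub_left, real_inner_smul_left, real_inner_smul_left, inner_b_gen, inner_a_gen,
      inner_a_gen, inner_b_gen]
    ring
  have h : ‖P.rotLin t z‖ ^ 2 = ‖z‖ ^ 2 := by
    rw [rotLin_apply, norm_add_sq_real, norm_add_sq_real, inner_add_left, real_inner_smul_right,
      real_inner_smul_right, real_inner_smul_right, real_inner_smul_left, h1, h2, h3, norm_smul,
      norm_smul, mul_pow, mul_pow, h4, h5, Real.norm_eq_abs, Real.norm_eq_abs, sq_abs, sq_abs]
    linear_combination (inner ℝ P.a z ^ 2 + inner ℝ P.b z ^ 2) * (Real.sin_sq_add_cos_sq t)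
  exact (sq_eq_sq₀ (norm_nonneg _) (norm_nonneg _)).1 h

/-- The rotation by the angle `t` in the plane. -/
def rot (t : ℝ) : Eu n ≃ₗᵢ[ℝ] Eu n where
  toLinearEquiv := LinearEquiv.ofLinearMap (P.rotLin t) (P.rotLin (-t))
    (by ext1 z; simp [← rotLin_add, rotLin_zero]) (by ext1 z; simp [← rotLin_add, rotLin_zero])
  norm_map' := P.norm_rotLin t

theorem rot_apply (t : ℝ) (z : Eu n) :
    P.rot t z = z + Real.sin t • P.gen z + (1 - Real.cos t) • P.gen (P.gen z) := rfl

theorem rot_add (s t : ℝ) (z : Eu n) : P.rot (s + t) z = P.rot s (P.rot t z) :=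
  P.rotLin_add s t z

theorem rot_zero (z : Eu n) : P.rot 0 z = z := P.rotLin_zero z

theorem gen_rot (t : ℝ) (z : Eu n) : P.gen (P.rot t z) = P.rot t (P.gen z) := by
  refine (P.gen_rotLin t z).trans ?_
  rw [rot_apply, gen_gen_gen]
  module

theorem hasDerivAt_rot (t : ℝ) (z : Eu n) :
    HasDerivAt (fun s => P.rot s z) (P.gen (P.rot t z)) t := by
  have h : P.gen (P.rot t z) = Real.cos t • P.gen z + Real.sin t • P.gen (P.gen z) :=
    P.gen_rotLin t z
  rw [h]
  have := (((Real.hasDerivAt_sin t).smul_const (P.gen z)).const_add z).add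
    (((Real.hasDerivAt_cos t).const_sub 1).smul_const (P.gen (P.gen z)))
  simp only [neg_neg] at this
  exact this

/-- The quarter turn of `-gen z` is `-gen (gen z)`, the orthogonal projection of `z` onto the plane.
The bound is Pythagoras for this decomposition. -/
theorem norm_gen_le (z : Eu n) : ‖P.gen z‖ ≤ ‖z‖ := by
  have h : ‖P.rot (Real.pi / 2) (P.gen z)‖ = ‖P.gen z‖ := (P.rot _).norm_map _
  have h1 : z = P.rot (Real.pi / 2) (-P.gen z) + (z + P.gen (P.gen z)) := by
    rw [rot_apply, map_neg, map_neg, gen_gen_gen]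
    simp
  have h3 : inner ℝ (P.rot (Real.pi / 2) (-P.gen z)) (z + P.gen (P.gen z)) = 0 := by
    have e : P.rot (Real.pi / 2) (-P.gen z) = - P.gen (P.gen z) := by
      rw [rot_apply, map_neg, map_neg, gen_gen_gen]
      simp
    rw [e, gen_gen, neg_neg, inner_add_right, inner_neg_right, inner_add_left, inner_add_left,
      inner_add_right, inner_add_right]
    simp only [real_inner_smul_left, real_inner_smul_right, P.inner_aa, P.inner_ab, P.inner_bb,
      P.inner_ba]
    ring
  have h4 := norm_add_sq_eq_norm_sq_add_norm_sq_real h3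
  rw [← h1, LinearIsometryEquiv.norm_map, norm_neg] at h4
  nlinarith [norm_nonneg z, norm_nonneg (P.gen z),
    mul_self_nonneg ‖z + P.gen (P.gen z)‖]

theorem norm_rot_sub_le (t : ℝ) (z : Eu n) : ‖P.rot t z - z‖ ≤ |t| * ‖z‖ := by
  have := Convex.norm_image_sub_le_of_norm_hasDerivWithin_le (f := fun s => P.rot s z)
    (f' := fun s => P.gen (P.rot s z)) (s := univ) (C := ‖z‖) (x := 0) (y := t)
    (fun s _ => (P.hasDerivAt_rot s z).hasDerivWithinAt)
    (fun s _ => (P.norm_gen_le _).trans ((P.rot s).norm_map z).le) convex_univ (mem_univ _)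
    (mem_univ _)
  simpa [rot_zero, mul_comm] using this

/-- The rotation by the angle `t`, acting on the sphere. -/
def sph (t : ℝ) : Sph n ≃ᵢ Sph n := sphMap (P.rot t)

@[simp] theorem coe_sph (t : ℝ) (x : Sph n) : (P.sph t x : Eu n) = P.rot t x := rfl

theorem measurePreserving_sph (t : ℝ) :
    MeasurePreserving (P.sph t) (sphMeasure n) (sphMeasure n) := measurePreserving_sphMap _

theorem integral_comp_sph {F : Type*} [NormedAddCommGroup F] [NormedSpace ℝ F] (t : ℝ)
    (f : Sph n → F) : ∫ x, f (P.sph t x) ∂(sphMeasure n) = ∫ x, f x ∂(sphMeasure n) :=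
  (P.measurePreserving_sph t).integral_comp (P.sph t).toHomeomorph.measurableEmbedding f

theorem integrable_comp_sph {F : Type*} [NormedAddCommGroup F] (t : ℝ)
    {f : Sph n → F} (hf : Integrable f (sphMeasure n)) :
    Integrable (fun x => f (P.sph t x)) (sphMeasure n) :=
  (P.measurePreserving_sph t).integrable_comp_of_integrable hf

theorem ae_comp_sph (t : ℝ) {p : Sph n → Prop} (hp : ∀ᵐ x ∂(sphMeasure n), p x) :
    ∀ᵐ x ∂(sphMeasure n), p (P.sph t x) :=
  (P.measurePreserving_sph t).quasiMeasurePreserving.ae hp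

theorem sph_neg_sph (t : ℝ) (x : Sph n) : P.sph (-t) (P.sph t x) = x := by
  ext1; rw [coe_sph, coe_sph, ← rot_add]; simp [rot_zero]

theorem sph_zero (x : Sph n) : P.sph 0 x = x := by
  ext1; rw [coe_sph, rot_zero]

end Plane

/-! ### Tangential derivatives -/

/-- On a hypersurface the derivative within the set is not unique, and `fderivWithin` is an
arbitrary choice. Along velocities of curves in the set all choices agree, and the tangential
divergence only sees such directions. -/
theorem fderivWithin_apply_eq_of_curve {E F : Type*} [NormedAddCommGroup E] [NormedSpace ℝ E]
    [NormedAddCommGroup F] [NormedSpace ℝ F] {X : E → F} {L : E →L[ℝ] F} {M : Set E} {x v : E}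
    {c : ℝ → E} (hX : HasFDerivWithinAt X L M x) (hc0 : c 0 = x) (hc : HasDerivAt c v 0)
    (hM : ∀ᶠ t in 𝓝 0, c t ∈ M) : fderivWithin ℝ X M x v = L v := by
  subst hc0
  have key : ∀ L' : E →L[ℝ] F, HasFDerivWithinAt X L' M (c 0) → HasDerivAt (X ∘ c) (L' v) 0 :=
    fun L' h => (h.comp_hasDerivWithinAt (s := {t | c t ∈ M}) 0 hc.hasDerivWithinAt
      (fun t ht => ht)).hasDerivAt hM
  exact (key _ hX.differentiableWithinAt.hasFDerivWithinAt).unique (key _ hX)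

/-- The great circle through `x` with velocity `v`. -/
def greatCircle (x v : Eu n) (t : ℝ) : Eu n :=
  Real.cos (‖v‖ * t) • x + (Real.sin (‖v‖ * t) / ‖v‖) • v

theorem greatCircle_zero (x v : Eu n) : greatCircle x v 0 = x := by simp [greatCircle]

theorem norm_greatCircle {x v : Eu n} (hx : ‖x‖ = 1) (hv : inner ℝ x v = 0) (t : ℝ) :
    ‖greatCircle x v t‖ = 1 := by
  have h : ‖greatCircle x v t‖ ^ 2 = 1 := by
    rw [greatCircle, norm_add_sq_real, real_inner_smul_left, real_inner_smul_right, hv, norm_smul,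
      norm_smul, hx, mul_pow, mul_pow, Real.norm_eq_abs, Real.norm_eq_abs, sq_abs, sq_abs]
    rcases eq_or_ne ‖v‖ 0 with h0 | h0
    · simp [h0]
    · field_simp
      linear_combination ‖v‖ * Real.sin_sq_add_cos_sq (‖v‖ * t)
  nlinarith [norm_nonneg (greatCircle x v t)]

theorem hasDerivAt_greatCircle (x v : Eu n) : HasDerivAt (greatCircle x v) v 0 := by
  have h0 : HasDerivAt (fun t : ℝ => ‖v‖ * t) ‖v‖ 0 := by
    simpa using (hasDerivAt_id (0 : ℝ)).const_mul ‖v‖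
  have h := (h0.cos.smul_const x).add ((h0.sin.div_const ‖v‖).smul_const v)
  have e : ((-Real.sin (‖v‖ * 0) * ‖v‖) • x + (Real.cos (‖v‖ * 0) * ‖v‖ / ‖v‖) • v) = v := by
    rcases eq_or_ne v 0 with rfl | h0
    · simp
    · simp [h0]
  rw [e] at h
  exact h

theorem trace_comp_tangentProj {ν : Eu n} (hν : ‖ν‖ = 1) (L : Eu n →L[ℝ] Eu n) :
    LinearMap.trace ℝ (Eu n) ((L ∘L tangentProj ν : Eu n →L[ℝ] Eu n) : Eu n →ₗ[ℝ] Eu n) =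
      LinearMap.trace ℝ (Eu n) (L : Eu n →ₗ[ℝ] Eu n) - inner ℝ ν (L ν) := by
  have h : ((L ∘L tangentProj ν : Eu n →L[ℝ] Eu n) : Eu n →ₗ[ℝ] Eu n) =
      (L : Eu n →ₗ[ℝ] Eu n) -
        ((innerSL ℝ ν : Eu n →L[ℝ] ℝ) : Eu n →ₗ[ℝ] ℝ).smulRight (L ν) := by
    ext1 z
    have : tangentProj ν z = z - (inner ℝ ν z) • ν := by
      rw [tangentProj, Submodule.starProjection_orthogonal_val,
        Submodule.starProjection_unit_singleton ℝ hν]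
    simp [this]
  rw [h, map_sub, LinearMap.trace_smulRight]
  rfl

theorem tangentialDiv_sphere {X : Eu n → Eu n} {L : Eu n →L[ℝ] Eu n} (x : Sph n)
    (hX : HasFDerivWithinAt X L (sphere (0 : Eu n) 1) x) :
    tangentialDiv (sphere (0 : Eu n) 1) (x : Eu n) X x =
      LinearMap.trace ℝ (Eu n) (L : Eu n →ₗ[ℝ] Eu n) - inner ℝ (x : Eu n) (L x) := by
  rw [← trace_comp_tangentProj (norm_coe_sph x), tangentialDiv]
  congr 2
  ext1 z
  have hz : inner ℝ (x : Eu n) (tangentProj (x : Eu n) z) = 0 := by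
    rw [tangentProj_apply, inner_sub_right, real_inner_smul_right, inner_self_sph]; ring
  exact fderivWithin_apply_eq_of_curve hX (greatCircle_zero _ _) (hasDerivAt_greatCircle _ _)
    (Eventually.of_forall fun t => by
      rw [mem_sphere, dist_zero_right]; exact norm_greatCircle (norm_coe_sph x) hz t)

theorem trace_gen (P : Plane n) :
    LinearMap.trace ℝ (Eu n) (P.gen : Eu n →ₗ[ℝ] Eu n) = 0 := by
  have : (P.gen : Eu n →ₗ[ℝ] Eu n) =
      ((innerSL ℝ P.a : Eu n →L[ℝ] ℝ) : Eu n →ₗ[ℝ] ℝ).smulRight P.b -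
      ((innerSL ℝ P.b : Eu n →L[ℝ] ℝ) : Eu n →ₗ[ℝ] ℝ).smulRight P.a := rfl
  rw [this, map_sub, LinearMap.trace_smulRight, LinearMap.trace_smulRight]
  simp [P.inner_ab, P.inner_ba]

/-- Rotation fields are tangential and divergence free, because their generator is skew; only the
derivative of the coefficient `φ` remains. -/
theorem tangentialDiv_smul_gen (P : Plane n) {φ : Eu n → ℝ} (hφ : Differentiable ℝ φ)
    (x : Sph n) :
    tangentialDiv (sphere (0 : Eu n) 1) (x : Eu n) (fun z => φ z • P.gen z) x =
      fderiv ℝ φ x (P.gen x) := by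
  have h : HasFDerivAt (fun z => φ z • P.gen z)
      (φ x • P.gen + (fderiv ℝ φ x).smulRight (P.gen x)) (x : Eu n) :=
    (hφ x).hasFDerivAt.smul P.gen.hasFDerivAt
  rw [tangentialDiv_sphere x h.hasFDerivWithinAt]
  have e : ((φ x • P.gen + (fderiv ℝ φ x).smulRight (P.gen x) : Eu n →L[ℝ] Eu n) :
      Eu n →ₗ[ℝ] Eu n) = φ x • (P.gen : Eu n →ₗ[ℝ] Eu n) +
      ((fderiv ℝ φ x : Eu n →L[ℝ] ℝ) : Eu n →ₗ[ℝ] ℝ).smulRight (P.gen x) := rfl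
  rw [e, map_add, map_smul, trace_gen, LinearMap.trace_smulRight]
  simp [inner_add_right, real_inner_smul_right, P.inner_gen_self]

/-- Reduces the vectorial definition of the weak gradient to scalar weak derivatives along
one-parameter groups of measure preserving maps, the form used in the regularity argument. -/
theorem IsWeakGradient.integral_gen {f : Sph n → ℝ} {g : Sph n → Eu n} (h : IsWeakGradient f g)
    (P : Plane n) {φ : Eu n → ℝ} (hφ : ContDiff ℝ ∞ φ) :
    ∫ x, f x * fderiv ℝ φ x (P.gen x) ∂(sphMeasure n) =
      - ∫ x, inner ℝ (g x) (P.gen x) * φ x ∂(sphMeasure n) := by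
  have := h.integral_eq (fun z => φ z • P.gen z) (hφ.smul P.gen.contDiff) (fun x => by
    rw [real_inner_smul_left, real_inner_comm, P.inner_gen_self, mul_zero])
  simp only [tangentialDiv_smul_gen P (hφ.differentiable (by simp)), real_inner_smul_right] at this
  rw [this]
  congr 1
  exact integral_congr_ae (Eventually.of_forall fun x => mul_comm _ _)

end

/-! ### From integral inequalities against test functions to pointwise bounds. -/

section

open scoped NNReal ENNReal

variable {n : ℕ}

/-! ### Testing against smooth functions -/

/-- The indicator of an open set is the limit of `smoothTransition (m f)`, where `f ≥ 0` is smooth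
and its support is that set; dominated convergence applies. -/
theorem setIntegral_isOpen_nonneg {w : Sph n → ℝ} (hw : Integrable w (sphMeasure n))
    (h : ∀ φ : Eu n → ℝ, ContDiff ℝ ∞ φ → (∀ z, 0 ≤ φ z) → 0 ≤ ∫ x, w x * φ x ∂(sphMeasure n))
    {U : Set (Sph n)} (hU : IsOpen U) : 0 ≤ ∫ x in U, w x ∂(sphMeasure n) := by
  obtain ⟨V, hV, rfl⟩ := isOpen_induced_iff.1 hU
  obtain ⟨f, hfs, hf, hfr⟩ := hV.exists_contDiff_support_eq (n := ⊤)
  have hf0 : ∀ z, 0 ≤ f z := fun z => (hfr ⟨z, rfl⟩).1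
  set φ : ℕ → Eu n → ℝ := fun m z => Real.smoothTransition (m * f z) with hφdef
  have hφ : ∀ m, ContDiff ℝ ∞ (φ m) := fun m =>
    Real.smoothTransition.contDiff.comp (contDiff_const.mul hf)
  have lim : Tendsto (fun m => ∫ x, w x * φ m x ∂(sphMeasure n)) atTop
      (𝓝 (∫ x, ((Subtype.val : Sph n → Eu n) ⁻¹' V).indicator w x ∂(sphMeasure n))) := by
    refine tendsto_integral_of_dominated_convergence (fun x => ‖w x‖) (fun m => ?_) hw.norm
      (fun m => Eventually.of_forall fun x => ?_) (Eventually.of_forall fun x => ?_)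
    · exact hw.aestronglyMeasurable.mul
        ((hφ m).continuous.comp continuous_subtype_val).aestronglyMeasurable
    · rw [norm_mul, Real.norm_of_nonneg (Real.smoothTransition.nonneg _)]
      exact mul_le_of_le_one_right (norm_nonneg _) (Real.smoothTransition.le_one _)
    · by_cases hx : (x : Eu n) ∈ V
      · rw [indicator_of_mem (by exact hx)]
        have hpos : 0 < f x := lt_of_le_of_ne (hf0 _) (by
          have : (x : Eu n) ∈ Function.support f := by rw [hfs]; exact hx
          exact (Function.mem_support.1 this).symm)
        refine tendsto_const_nhds.congr' ?_
        filter_upwards [eventually_ge_atTop ⌈(f x)⁻¹⌉₊] with m hm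
        have h1 : 1 ≤ (m : ℝ) * f x := by
          have h2 : (f x)⁻¹ ≤ m := (Nat.le_ceil _).trans (by exact_mod_cast hm)
          calc (1 : ℝ) = (f x)⁻¹ * f x := (inv_mul_cancel₀ hpos.ne').symm
            _ ≤ _ := by gcongr
        simp [φ, Real.smoothTransition.one_of_one_le h1]
      · rw [indicator_of_notMem (by exact hx)]
        have h0 : f x = 0 := by
          by_contra h0
          exact hx (by rw [← hfs]; exact h0)
        simp [φ, h0]
  rw [← integral_indicator hU.measurableSet]
  exact ge_of_tendsto' lim fun m => h _ (hφ m) fun z => Real.smoothTransition.nonneg _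

/-- A measurable set with negative integral can be enlarged to an open one at the cost of a set so
small that, by absolute continuity, the integral stays negative. -/
theorem ae_nonneg_of_integral_contDiff_nonneg {w : Sph n → ℝ} (hw : Integrable w (sphMeasure n))
    (h : ∀ φ : Eu n → ℝ, ContDiff ℝ ∞ φ → (∀ z, 0 ≤ φ z) →
      0 ≤ ∫ x, w x * φ x ∂(sphMeasure n)) : ∀ᵐ x ∂(sphMeasure n), 0 ≤ w x := by
  refine ae_nonneg_of_forall_setIntegral_nonneg hw fun s hs _ => ?_
  by_contra! hneg
  have hfin : ∫⁻ x, ‖w x‖ₑ ∂(sphMeasure n) ≠ ⊤ := hw.2.ne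
  obtain ⟨δ, hδ, hδs⟩ := exists_pos_setLIntegral_lt_of_measure_lt hfin
    (ε := ENNReal.ofReal (-∫ x in s, w x ∂(sphMeasure n)))
    (by rw [Ne, ENNReal.ofReal_eq_zero]; linarith)
  obtain ⟨U, hsU, hU, -, hUs⟩ := hs.exists_isOpen_sdiff_lt (measure_ne_top (sphMeasure n) s) hδ.ne'
  have h1 := setIntegral_isOpen_nonneg hw h hU
  have h2 : ∫ x in U, w x ∂(sphMeasure n) = ∫ x in s, w x ∂(sphMeasure n) +
      ∫ x in U \ s, w x ∂(sphMeasure n) := by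
    rw [← setIntegral_union disjoint_sdiff_right (hU.measurableSet.diff hs) hw.integrableOn
      hw.integrableOn, union_sdiff_cancel hsU]
  have h3 : ‖∫ x in U \ s, w x ∂(sphMeasure n)‖ₑ <
      ENNReal.ofReal (-∫ x in s, w x ∂(sphMeasure n)) :=
    (enorm_integral_le_lintegral_enorm _).trans_lt (hδs _ hUs)
  rw [← ofReal_norm, ENNReal.ofReal_lt_ofReal_iff (by linarith)] at h3
  have h4 := (abs_lt.1 h3).2
  linarith

theorem ae_le_of_integral_contDiff_le {v w : Sph n → ℝ} (hv : Integrable v (sphMeasure n))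
    (hw : Integrable w (sphMeasure n))
    (h : ∀ φ : Eu n → ℝ, ContDiff ℝ ∞ φ → (∀ z, 0 ≤ φ z) →
      ∫ x, v x * φ x ∂(sphMeasure n) ≤ ∫ x, w x * φ x ∂(sphMeasure n)) :
    ∀ᵐ x ∂(sphMeasure n), v x ≤ w x := by
  have := ae_nonneg_of_integral_contDiff_nonneg (hw.sub hv) (fun φ hφ hφ0 => by
    have hb : ∃ C, ∀ x : Sph n, ‖φ x‖ ≤ C := by
      obtain ⟨C, hC⟩ := (isCompact_univ (X := Sph n)).exists_bound_of_continuousOn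
        (hφ.continuous.comp continuous_subtype_val).continuousOn
      exact ⟨C, fun x => hC x (mem_univ x)⟩
    obtain ⟨C, hC⟩ := hb
    have hm : AEStronglyMeasurable (fun x : Sph n => φ x) (sphMeasure n) :=
      (hφ.continuous.comp continuous_subtype_val).aestronglyMeasurable
    have e : ∫ x, (w - v) x * φ x ∂(sphMeasure n) =
        ∫ x, w x * φ x ∂(sphMeasure n) - ∫ x, v x * φ x ∂(sphMeasure n) := by
      rw [← integral_sub (hw.mul_bdd hm (Eventually.of_forall hC))
        (hv.mul_bdd hm (Eventually.of_forall hC))]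
      exact integral_congr_ae (Eventually.of_forall fun x => by simp [sub_mul])
    rw [e]
    linarith [h φ hφ hφ0])
  filter_upwards [this] with x hx
  simpa using hx

theorem ae_eq_of_integral_contDiff_eq {v w : Sph n → ℝ} (hv : Integrable v (sphMeasure n))
    (hw : Integrable w (sphMeasure n))
    (h : ∀ φ : Eu n → ℝ, ContDiff ℝ ∞ φ →
      ∫ x, v x * φ x ∂(sphMeasure n) = ∫ x, w x * φ x ∂(sphMeasure n)) :
    ∀ᵐ x ∂(sphMeasure n), v x = w x := by
  filter_upwards [ae_le_of_integral_contDiff_le hv hw fun φ hφ _ => (h φ hφ).le,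
    ae_le_of_integral_contDiff_le hw hv fun φ hφ _ => (h φ hφ).ge] with x h1 h2
  exact le_antisymm h1 h2

theorem forall_of_ae_of_isClosed {p : Sph n → Prop} (hc : IsClosed {x | p x})
    (h : ∀ᵐ x ∂(sphMeasure n), p x) (x : Sph n) : p x := by
  have h0 : sphMeasure n {x | p x}ᶜ = 0 := h
  have := (hc.isOpen_compl.measure_eq_zero_iff (sphMeasure n)).1 h0
  by_contra hx
  have hmem : x ∈ {x | p x}ᶜ := hx
  rw [this] at hmem
  exact hmem

theorem integrable_mul_of_continuous {f : Sph n → ℝ} (hf : Integrable f (sphMeasure n))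
    {φ : Sph n → ℝ} (hφ : Continuous φ) : Integrable (fun x => f x * φ x) (sphMeasure n) := by
  obtain ⟨C, hC⟩ := (isCompact_univ (X := Sph n)).exists_bound_of_continuousOn hφ.continuousOn
  exact hf.mul_bdd hφ.aestronglyMeasurable (Eventually.of_forall fun x => hC x (mem_univ x))

theorem integrable_of_continuous {F : Type*} [NormedAddCommGroup F] [SecondCountableTopology F]
    {φ : Sph n → F} (hφ : Continuous φ) : Integrable φ (sphMeasure n) := by
  obtain ⟨C, hC⟩ := (isCompact_univ (X := Sph n)).exists_bound_of_continuousOn hφ.continuousOn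
  exact Integrable.of_bound hφ.aestronglyMeasurable C
    (Eventually.of_forall fun x => hC x (mem_univ x))

/-! ### Weak derivatives along rotations -/

namespace Plane

variable (P : Plane n)

/-- Invariance of the measure moves the rotation from `f` to the smooth `φ`, where differentiation
under the integral is legitimate. Since the generator commutes with its rotations, the weak
derivative hypothesis for the rotated test function moves the result back to `h`. -/
theorem hasDerivAt_integral_rot {f h : Sph n → ℝ} (hf : Integrable f (sphMeasure n))
    (hw : ∀ φ : Eu n → ℝ, ContDiff ℝ ∞ φ → ∫ x, f x * fderiv ℝ φ x (P.gen x) ∂(sphMeasure n) =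
      - ∫ x, h x * φ x ∂(sphMeasure n)) {φ : Eu n → ℝ} (hφ : ContDiff ℝ ∞ φ) (s : ℝ) :
    HasDerivAt (fun s => ∫ x, f (P.sph s x) * φ x ∂(sphMeasure n))
      (∫ x, h (P.sph s x) * φ x ∂(sphMeasure n)) s := by
  have shift : ∀ (k : Sph n → ℝ) (s : ℝ), ∫ x, k (P.sph s x) * φ x ∂(sphMeasure n) =
      ∫ x, k x * φ (P.rot (-s) x) ∂(sphMeasure n) := by
    intro k s
    rw [← P.integral_comp_sph s (fun x => k x * φ (P.rot (-s) x))]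
    refine integral_congr_ae (Eventually.of_forall fun x => ?_)
    have : P.rot (-s) (P.sph s x) = x := congrArg Subtype.val (P.sph_neg_sph s x)
    simp only [this]
  simp only [shift]
  have hφ' : ∀ s, ContDiff ℝ ∞ (fun z => φ (P.rot s z)) := fun s =>
    hφ.comp (P.rot s).toContinuousLinearEquiv.contDiff
  have hcont : Continuous (fderiv ℝ φ) := hφ.continuous_fderiv (by simp)
  obtain ⟨C, hC⟩ := (isCompact_sphere (0 : Eu n) 1).exists_bound_of_continuousOn hcont.continuousOn
  have hderiv : ∀ (x : Eu n) (s : ℝ), HasDerivAt (fun s => φ (P.rot (-s) x))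
      (-(fderiv ℝ φ (P.rot (-s) x) (P.gen (P.rot (-s) x)))) s := by
    intro x s
    have h1 : HasDerivAt (fun s => P.rot (-s) x) (-(P.gen (P.rot (-s) x))) s := by
      have := (P.hasDerivAt_rot (-s) x).scomp s (hasDerivAt_neg s)
      rw [neg_one_smul] at this
      exact this
    have h2 := (hφ.differentiable (by simp) (P.rot (-s) x)).hasFDerivAt.comp_hasDerivAt s h1
    rw [map_neg] at h2
    exact h2
  have main := (hasDerivAt_integral_of_dominated_loc_of_deriv_le (μ := sphMeasure n)
    (F := fun s x => f x * φ (P.rot (-s) x)) (x₀ := s) (s := univ) (bound := fun x => ‖f x‖ * C)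
    (F' := fun s x => f x * -(fderiv ℝ φ (P.rot (-s) x) (P.gen (P.rot (-s) x)))) univ_mem
    (Eventually.of_forall fun s => (integrable_mul_of_continuous hf
      ((hφ' (-s)).continuous.comp continuous_subtype_val)).aestronglyMeasurable)
    (integrable_mul_of_continuous hf ((hφ' (-s)).continuous.comp continuous_subtype_val))
    (integrable_mul_of_continuous hf (by
      have h1 : Continuous fun x : Sph n => P.rot (-s) (x : Eu n) :=
        (P.rot (-s)).continuous.comp continuous_subtype_val
      exact ((hcont.comp h1).clm_apply (P.gen.continuous.comp h1)).neg)).aestronglyMeasurable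
    (Eventually.of_forall fun x s _ => by
      rw [norm_mul, norm_neg]
      gcongr
      have hmem : P.rot (-s) (x : Eu n) ∈ sphere (0 : Eu n) 1 := by simp
      calc ‖fderiv ℝ φ (P.rot (-s) x) (P.gen (P.rot (-s) x))‖
          ≤ ‖fderiv ℝ φ (P.rot (-s) x)‖ * ‖P.gen (P.rot (-s) x)‖ := ContinuousLinearMap.le_opNorm _ _
        _ ≤ C * 1 := by
            gcongr
            · exact (norm_nonneg _).trans (hC _ hmem)
            · exact hC _ hmem
            · refine (P.norm_gen_le _).trans ?_
              simp
        _ = C := mul_one C)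
    (hf.norm.mul_const C)
    (Eventually.of_forall fun x s _ => (hderiv x s).const_mul (f x))).2
  refine main.congr_deriv ?_
  have e : ∀ x : Sph n, fderiv ℝ (fun z => φ (P.rot (-s) z)) x (P.gen x) =
      fderiv ℝ φ (P.rot (-s) x) (P.gen (P.rot (-s) x)) := by
    intro x
    have := ((hφ.differentiable (by simp) (P.rot (-s) x)).hasFDerivAt.comp (x : Eu n)
      (P.rot (-s)).toContinuousLinearEquiv.hasFDerivAt).fderiv
    have h2 : fderiv ℝ (fun z => φ (P.rot (-s) z)) x = _ := this
    rw [h2, P.gen_rot]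
    rfl
  have h1 := hw _ (hφ' (-s))
  simp only [e] at h1
  simp only [mul_neg, integral_neg, h1, neg_neg]

/-- A mean value inequality for weak derivatives: it holds for the scalar function of the angle
obtained by testing with `φ ≥ 0`, and then `φ` is removed. The comparison function `k` selects the
use: `k = 0` gives a Lipschitz bound, `k = h` a first order Taylor bound. -/
theorem ae_abs_sub_le_of_weak_deriv {f h k : Sph n → ℝ} (hf : Integrable f (sphMeasure n))
    (hh : Integrable h (sphMeasure n)) (hk : Integrable k (sphMeasure n))
    (hw : ∀ φ : Eu n → ℝ, ContDiff ℝ ∞ φ → ∫ x, f x * fderiv ℝ φ x (P.gen x) ∂(sphMeasure n) =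
      - ∫ x, h x * φ x ∂(sphMeasure n)) {M T : ℝ}
    (hM : ∀ s, |s| ≤ |T| → ∀ᵐ x ∂(sphMeasure n), |h (P.sph s x) - k x| ≤ M) :
    ∀ᵐ x ∂(sphMeasure n), |f (P.sph T x) - f x - T * k x| ≤ M * |T| := by
  have hI : Integrable (fun x => f (P.sph T x) - f x - T * k x) (sphMeasure n) :=
    ((P.integrable_comp_sph T hf).sub hf).sub (hk.const_mul T)
  have key : ∀ φ : Eu n → ℝ, ContDiff ℝ ∞ φ → (∀ z, 0 ≤ φ z) →
      |∫ x, (f (P.sph T x) - f x - T * k x) * φ x ∂(sphMeasure n)| ≤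
        ∫ x, (M * |T|) * φ x ∂(sphMeasure n) := by
    intro φ hφ hφ0
    have hφc : Continuous fun x : Sph n => φ x := hφ.continuous.comp continuous_subtype_val
    have hd : ∀ s, HasDerivAt (fun s => (∫ x, f (P.sph s x) * φ x ∂(sphMeasure n)) -
        s * ∫ x, k x * φ x ∂(sphMeasure n)) (∫ x, h (P.sph s x) * φ x ∂(sphMeasure n) -
          ∫ x, k x * φ x ∂(sphMeasure n)) s := by
      intro s
      have := (P.hasDerivAt_integral_rot hf hw hφ s).sub
        ((hasDerivAt_id s).mul_const (∫ x, k x * φ x ∂(sphMeasure n)))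
      rw [one_mul] at this
      exact this
    have hb : ∀ s ∈ Icc (-|T|) |T|, ‖∫ x, h (P.sph s x) * φ x ∂(sphMeasure n) -
          ∫ x, k x * φ x ∂(sphMeasure n)‖ ≤ M * ∫ x, φ x ∂(sphMeasure n) := by
      intro s hs
      rw [← integral_sub (integrable_mul_of_continuous (P.integrable_comp_sph s hh) hφc)
        (integrable_mul_of_continuous hk hφc), ← integral_const_mul]
      refine (norm_integral_le_integral_norm _).trans ?_
      refine integral_mono_ae
        ((integrable_mul_of_continuous (P.integrable_comp_sph s hh) hφc).sub
          (integrable_mul_of_continuous hk hφc)).norm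
        ((integrable_of_continuous hφc).const_mul M) ?_
      filter_upwards [hM s (abs_le.2 hs)] with x hx
      rw [← sub_mul, norm_mul, Real.norm_of_nonneg (hφ0 _)]
      exact mul_le_mul_of_nonneg_right hx (hφ0 _)
    have h1 := Convex.norm_image_sub_le_of_norm_hasDerivWithin_le
      (fun s _ => (hd s).hasDerivWithinAt) hb (convex_Icc _ _)
      (x := 0) (y := T) ⟨by simp, by simp⟩ ⟨neg_abs_le T, le_abs_self T⟩
    have e : ∫ x, (f (P.sph T x) - f x - T * k x) * φ x ∂(sphMeasure n) =
        ((∫ x, f (P.sph T x) * φ x ∂(sphMeasure n)) - T * ∫ x, k x * φ x ∂(sphMeasure n)) -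
        ((∫ x, f (P.sph 0 x) * φ x ∂(sphMeasure n)) - 0 * ∫ x, k x * φ x ∂(sphMeasure n)) := by
      simp only [P.sph_zero, zero_mul, sub_zero]
      have i1 := integrable_mul_of_continuous (P.integrable_comp_sph T hf) hφc
      have i2 := (integrable_mul_of_continuous hk hφc).const_mul T
      have i3 : Integrable (fun x => f (P.sph T x) * φ x - T * (k x * φ x)) (sphMeasure n) :=
        i1.sub i2
      rw [← integral_const_mul, ← integral_sub i1 i2,
        ← integral_sub i3 (integrable_mul_of_continuous hf hφc)]
      refine integral_congr_ae (Eventually.of_forall fun x => ?_)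
      simp only
      ring
    rw [e]
    refine h1.trans (le_of_eq ?_)
    rw [integral_const_mul, sub_zero, Real.norm_eq_abs]
    ring
  have hup := ae_le_of_integral_contDiff_le hI (integrable_const (M * |T|))
    fun φ hφ hφ0 => (abs_le.1 (key φ hφ hφ0)).2
  have hlo := ae_le_of_integral_contDiff_le (integrable_const (-(M * |T|))) hI
    fun φ hφ hφ0 => by
      have := (abs_le.1 (key φ hφ hφ0)).1
      rw [integral_const_mul] at this ⊢
      linarith
  filter_upwards [hup, hlo] with x h1 h2
  exact abs_le.2 ⟨h2, h1⟩

end Plane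

end

section

open scoped NNReal ENNReal

variable {n : ℕ}

/-! ### From weak second derivatives to `C^{1,1}` -/

/-- A `C^{1,1}` function on the sphere with gradient `g`: both are bounded by `M`, and `L` controls
the Lipschitz constant of `g` and the first order Taylor expansion. -/
structure IsC11 (u : Sph n → ℝ) (g : Sph n → Eu n) (M L : ℝ) : Prop where
  abs_le : ∀ x, |u x| ≤ M
  norm_le : ∀ x, ‖g x‖ ≤ M
  tangent : ∀ x : Sph n, inner ℝ (x : Eu n) (g x) = 0
  lipschitz : ∀ x y : Sph n, ‖g y - g x‖ ≤ L * ‖(y : Eu n) - x‖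
  taylor : ∀ x y : Sph n,
    |u y - u x - inner ℝ (g x) ((y : Eu n) - x)| ≤ L * ‖(y : Eu n) - x‖ ^ 2

theorem ae_norm_le_of_memLp_top {α F : Type*} [MeasurableSpace α] [NormedAddCommGroup F]
    {μ : Measure α} {f : α → F} (hf : MemLp f ⊤ μ) :
    ∀ᵐ x ∂μ, ‖f x‖ ≤ (eLpNorm f ⊤ μ).toReal := by
  rw [eLpNorm_exponent_top]
  have hfin : eLpNormEssSup f μ ≠ ⊤ := by
    rw [← eLpNorm_exponent_top]; exact hf.2.ne
  filter_upwards [enorm_ae_le_eLpNormEssSup f μ] with x hx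
  have := ENNReal.toReal_mono hfin hx
  rwa [toReal_enorm] at this

theorem MemW2Inf.isWeakGradient {u : Sph n → ℝ} (hu : MemW2Inf u) :
    IsWeakGradient u (weakGradient u) := by
  rw [weakGradient, dif_pos hu.exists_gradient]
  exact hu.exists_gradient.choose_spec

theorem MemW2Inf.isWeakJacobian {u : Sph n → ℝ} (hu : MemW2Inf u) :
    IsWeakJacobian (weakGradient u) (weakJacobian u) := by
  rw [weakJacobian, dif_pos hu.exists_jacobian]
  exact hu.exists_jacobian.choose_spec

theorem norm_le_sum_abs (v : Eu n) : ‖v‖ ≤ ∑ i, |v i| := by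
  have h := (EuclideanSpace.basisFun (Fin n) ℝ).sum_repr v
  calc ‖v‖ = ‖∑ i, v i • EuclideanSpace.basisFun (Fin n) ℝ i‖ := by
        congr 1
        exact h.symm
    _ ≤ ∑ i, ‖v i • EuclideanSpace.basisFun (Fin n) ℝ i‖ := norm_sum_le _ _
    _ = ∑ i, |v i| := by simp [norm_smul]

/-- The plane spanned by two coordinate vectors. -/
def coordPlane (i j : Fin n) (h : i ≠ j) : Plane n where
  a := EuclideanSpace.single i 1
  b := EuclideanSpace.single j 1
  norm_a := by simp
  norm_b := by simp
  inner_ab := by simp [EuclideanSpace.inner_single_left, h]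

theorem inner_coordPlane_gen (i j : Fin n) (h : i ≠ j) (w z : Eu n) :
    inner ℝ w ((coordPlane i j h).gen z) = z i * w j - z j * w i := by
  rw [Plane.gen_apply, inner_sub_right, real_inner_smul_right, real_inner_smul_right]
  simp [coordPlane, EuclideanSpace.inner_single_left, EuclideanSpace.inner_single_right]

theorem inner_eq_sum (v w : Eu n) : inner ℝ v w = ∑ i, v i * w i := by
  simp [PiLp.inner_apply, mul_comm]

theorem sum_sq_sph (x : Sph n) : ∑ i, (x : Eu n) i * (x : Eu n) i = 1 := by
  rw [← inner_eq_sum, inner_self_sph]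

/-- The coordinate rotation fields span the tangent space at `x`: from `x i w j = x j w i` one gets
`w j = ∑ x i (x i w j) = x j ⟨x, w⟩`. -/
theorem eq_zero_of_inner_gen_eq_zero {x : Sph n} {w : Eu n} (h0 : inner ℝ w (x : Eu n) = 0)
    (h : ∀ i j, ∀ hij : i ≠ j, inner ℝ w ((coordPlane i j hij).gen x) = 0) : w = 0 := by
  ext j
  have h1 : ∀ i, (x : Eu n) i * w j = (x : Eu n) j * w i := by
    intro i
    rcases eq_or_ne i j with rfl | hij
    · rfl
    · have := h i j hij
      rw [inner_coordPlane_gen] at this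
      linarith
  have h2 : w j = ∑ i, (x : Eu n) i * ((x : Eu n) i * w j) := by
    simp_rw [← mul_assoc]
    rw [← Finset.sum_mul, sum_sq_sph, one_mul]
  rw [h2]
  simp_rw [h1]
  rw [inner_eq_sum] at h0
  calc ∑ i, (x : Eu n) i * ((x : Eu n) j * w i) = (x : Eu n) j * ∑ i, w i * (x : Eu n) i := by
        rw [Finset.mul_sum]
        exact Finset.sum_congr rfl fun i _ => by ring
    _ = 0 := by rw [h0, mul_zero]

theorem integrable_inner_of_continuous {g : Sph n → Eu n} (hg : Integrable g (sphMeasure n))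
    {X : Sph n → Eu n} (hX : Continuous X) :
    Integrable (fun x => inner ℝ (g x) (X x)) (sphMeasure n) := by
  obtain ⟨C, hC⟩ := (isCompact_univ (X := Sph n)).exists_bound_of_continuousOn hX.continuousOn
  refine (hg.norm.mul_const C).mono' (hg.aestronglyMeasurable.inner hX.aestronglyMeasurable)
    (Eventually.of_forall fun x => ?_)
  refine (norm_inner_le_norm _ _).trans ?_
  gcongr
  exact hC x (mem_univ x)

theorem coord_eq_inner (z : Eu n) (i : Fin n) :
    z i = inner ℝ z (EuclideanSpace.single i 1) := by
  simp [EuclideanSpace.inner_single_right]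

theorem clm_apply_eq_sum (T : Eu n →L[ℝ] Eu n) (z : Eu n) :
    T z = ∑ i, z i • T (EuclideanSpace.single i 1) := by
  conv_lhs => rw [← (EuclideanSpace.basisFun (Fin n) ℝ).sum_repr z]
  simp [map_sum]

theorem continuous_gen_coe (P : Plane n) : Continuous fun x : Sph n => P.gen (x : Eu n) :=
  P.gen.continuous.comp continuous_subtype_val

theorem continuous_coord (i : Fin n) : Continuous fun x : Sph n => (x : Eu n) i := by
  have : Continuous fun z : Eu n => z i := by fun_prop
  exact this.comp continuous_subtype_val

/-- Differentiating `⟨g, x⟩ = 0`: the weak Jacobian maps the normal `x` to `-g`. -/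
theorem IsWeakJacobian.ae_apply_normal {u : Sph n → ℝ} {g : Sph n → Eu n}
    {A : Sph n → Eu n →L[ℝ] Eu n} (hg : IsWeakGradient u g) (hA : IsWeakJacobian g A) :
    ∀ᵐ x ∂(sphMeasure n), A x (x : Eu n) = -g x := by
  have hP : ∀ P : Plane n, ∀ᵐ x ∂(sphMeasure n), inner ℝ (g x) (P.gen (x : Eu n)) =
      - inner ℝ (A x (x : Eu n)) (P.gen (x : Eu n)) := by
    intro P
    have hAe : ∀ e, Integrable (fun x => inner ℝ (A x e) (P.gen (x : Eu n))) (sphMeasure n) :=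
      fun e => integrable_inner_of_continuous (hA e).integrable_grad (continuous_gen_coe P)
    have hsum : ∀ x : Sph n, inner ℝ (A x (x : Eu n)) (P.gen (x : Eu n)) =
        ∑ i, inner ℝ (A x (EuclideanSpace.single i 1)) (P.gen (x : Eu n)) * (x : Eu n) i := by
      intro x
      rw [clm_apply_eq_sum (A x) x, sum_inner]
      exact Finset.sum_congr rfl fun i _ => by rw [real_inner_smul_left, mul_comm]
    have hAx : Integrable (fun x => inner ℝ (A x (x : Eu n)) (P.gen (x : Eu n)))
        (sphMeasure n) := by
      simp_rw [hsum]
      exact integrable_finsetSum _ fun i _ =>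
        integrable_mul_of_continuous (hAe _) (continuous_coord i)
    refine ae_eq_of_integral_contDiff_eq
      (integrable_inner_of_continuous hg.integrable_grad (continuous_gen_coe P)) hAx.neg
      fun φ hφ => ?_
    have hφc : Continuous fun x : Sph n => φ x := hφ.continuous.comp continuous_subtype_val
    have hDc : Continuous fun x : Sph n => fderiv ℝ φ x (P.gen x) :=
      ((hφ.continuous_fderiv (by simp)).comp continuous_subtype_val).clm_apply
        (continuous_gen_coe P)
    -- The `i`-th component of `g` is tested with `x i φ`. After summation over `i` the terms
    -- containing the derivative of `φ` form `⟨g, x⟩`, which vanishes.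
    have hpiece : ∀ i : Fin n,
        ∫ x, inner ℝ (g x) (EuclideanSpace.single i 1) *
          (P.gen (x : Eu n) i * φ x + (x : Eu n) i * fderiv ℝ φ x (P.gen x)) ∂(sphMeasure n) =
        - ∫ x, inner ℝ (A x (EuclideanSpace.single i 1)) (P.gen (x : Eu n)) * (x : Eu n) i * φ x
          ∂(sphMeasure n) := by
      intro i
      have hc : ContDiff ℝ ∞ (fun z : Eu n => z i) := by fun_prop
      have := (hA (EuclideanSpace.single i 1)).integral_gen P (hc.mul hφ)
      have e : ∀ x : Sph n, fderiv ℝ (fun z : Eu n => z i * φ z) x (P.gen x) =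
          P.gen (x : Eu n) i * φ x + (x : Eu n) i * fderiv ℝ φ x (P.gen x) := by
        intro x
        have h1 : HasFDerivAt (fun z : Eu n => z i)
            (EuclideanSpace.proj i : Eu n →L[ℝ] ℝ) (x : Eu n) :=
          (EuclideanSpace.proj i : Eu n →L[ℝ] ℝ).hasFDerivAt
        have h2 := (h1.mul (hφ.differentiable (by simp) (x : Eu n)).hasFDerivAt).fderiv
        have h3 : fderiv ℝ (fun z : Eu n => z i * φ z) x = _ := h2
        rw [h3]
        simp
        ring
      simp only [e] at this
      rw [this]
      congr 1
      exact integral_congr_ae (Eventually.of_forall fun x => by simp only; ring)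
    have hi1 : ∀ i ∈ Finset.univ, Integrable (fun x : Sph n =>
        inner ℝ (g x) (EuclideanSpace.single i 1) *
          (P.gen (x : Eu n) i * φ x + (x : Eu n) i * fderiv ℝ φ x (P.gen x))) (sphMeasure n) := by
      intro i _
      refine integrable_mul_of_continuous
        (integrable_inner_of_continuous hg.integrable_grad continuous_const) ?_
      have hc : Continuous fun x : Sph n => P.gen (x : Eu n) i := by
        have : Continuous fun z : Eu n => z i := by fun_prop
        exact this.comp (continuous_gen_coe P)
      exact (hc.mul hφc).add ((continuous_coord i).mul hDc)
    have hi2 : ∀ i ∈ Finset.univ, Integrable (fun x : Sph n =>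
        inner ℝ (A x (EuclideanSpace.single i 1)) (P.gen (x : Eu n)) * (x : Eu n) i * φ x)
        (sphMeasure n) := fun i _ =>
      integrable_mul_of_continuous (integrable_mul_of_continuous (hAe _) (continuous_coord i)) hφc
    have htot := Finset.sum_congr (rfl : (Finset.univ : Finset (Fin n)) = Finset.univ)
      fun i _ => hpiece i
    rw [← integral_finsetSum _ hi1, Finset.sum_neg_distrib, ← integral_finsetSum _ hi2] at htot
    have e1 : ∫ x, inner ℝ (g x) (P.gen (x : Eu n)) * φ x ∂(sphMeasure n) =
        ∫ x, ∑ i, inner ℝ (g x) (EuclideanSpace.single i 1) *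
          (P.gen (x : Eu n) i * φ x + (x : Eu n) i * fderiv ℝ φ x (P.gen x)) ∂(sphMeasure n) := by
      refine integral_congr_ae ?_
      filter_upwards [hg.tangent] with x hx
      rw [inner_eq_sum] at hx
      calc inner ℝ (g x) (P.gen (x : Eu n)) * φ x
          = (∑ i, g x i * P.gen (x : Eu n) i) * φ x +
            (∑ i, g x i * (x : Eu n) i) * fderiv ℝ φ x (P.gen x) := by
              rw [hx, inner_eq_sum]; ring
        _ = _ := by
              rw [Finset.sum_mul, Finset.sum_mul, ← Finset.sum_add_distrib]
              refine Finset.sum_congr rfl fun i _ => ?_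
              rw [← coord_eq_inner]
              ring
    rw [e1, htot, ← integral_neg]
    refine integral_congr_ae (Eventually.of_forall fun x => ?_)
    simp only
    rw [hsum x, neg_mul, Finset.sum_mul]
  have hall : ∀ᵐ x ∂(sphMeasure n), ∀ i j, ∀ hij : i ≠ j,
      inner ℝ (g x) ((coordPlane i j hij).gen (x : Eu n)) =
      - inner ℝ (A x (x : Eu n)) ((coordPlane i j hij).gen (x : Eu n)) := by
    simp only [ae_all_iff]
    exact fun i j hij => hP _
  have htan : ∀ᵐ x ∂(sphMeasure n), ∀ i : Fin n,
      inner ℝ (A x (EuclideanSpace.single i 1)) (x : Eu n) = 0 := by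
    rw [ae_all_iff]
    exact fun i => (hA _).tangent
  filter_upwards [hall, htan, hg.tangent] with x h1 h2 h3
  have : g x + A x (x : Eu n) = 0 := by
    refine eq_zero_of_inner_gen_eq_zero (x := x) ?_ fun i j hij => ?_
    · rw [inner_add_left, h3, clm_apply_eq_sum (A x) x, sum_inner, zero_add]
      exact Finset.sum_eq_zero fun i _ => by rw [real_inner_smul_left, h2, mul_zero]
    · rw [inner_add_left, h1 i j hij]; ring
  exact eq_neg_of_add_eq_zero_right this

/-- The difference quotients of the continuous `u` along a rotation are within `K / (m + 1)` of `⟨g,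
gen x⟩` almost everywhere, so they are uniformly Cauchy and their limit is a continuous
representative. -/
theorem exists_continuous_of_forall_plane {u : Sph n → ℝ} (hu : Continuous u)
    {g : Sph n → Eu n} {K : ℝ} (hK : 0 ≤ K)
    (htan : ∀ᵐ x ∂(sphMeasure n), inner ℝ (g x) (x : Eu n) = 0)
    (h : ∀ (P : Plane n) (t : ℝ), ∀ᵐ x ∂(sphMeasure n),
      |u (P.sph t x) - u x - t * inner ℝ (g x) (P.gen (x : Eu n))| ≤ K * t ^ 2) :
    ∃ g' : Sph n → Eu n, Continuous g' ∧ ∀ᵐ x ∂(sphMeasure n), g x = g' x := by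
  have hplane : ∀ P : Plane n, ∃ v : C(Sph n, ℝ),
      ∀ᵐ x ∂(sphMeasure n), inner ℝ (g x) (P.gen (x : Eu n)) = v x := by
    intro P
    set q : ℕ → C(Sph n, ℝ) := fun m =>
      ⟨fun x => ((m : ℝ) + 1) * (u (P.sph (((m : ℝ) + 1)⁻¹) x) - u x),
        continuous_const.mul ((hu.comp (P.sph _).continuous).sub hu)⟩ with hq
    have hqx : ∀ m x, q m x = ((m : ℝ) + 1) * (u (P.sph (((m : ℝ) + 1)⁻¹) x) - u x) :=
      fun m x => rfl
    have hae : ∀ m, ∀ᵐ x ∂(sphMeasure n),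
        |q m x - inner ℝ (g x) (P.gen (x : Eu n))| ≤ K / ((m : ℝ) + 1) := by
      intro m
      filter_upwards [h P (((m : ℝ) + 1)⁻¹)] with x hx
      have hm : (0 : ℝ) < m + 1 := by positivity
      have e : q m x - inner ℝ (g x) (P.gen (x : Eu n)) = ((m : ℝ) + 1) *
          (u (P.sph (((m : ℝ) + 1)⁻¹) x) - u x -
            ((m : ℝ) + 1)⁻¹ * inner ℝ (g x) (P.gen (x : Eu n))) := by
        rw [hqx, mul_sub _ (_ - _), ← mul_assoc, mul_inv_cancel₀ hm.ne', one_mul]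
      rw [e, abs_mul, abs_of_pos hm]
      calc ((m : ℝ) + 1) * _ ≤ ((m : ℝ) + 1) * (K * (((m : ℝ) + 1)⁻¹) ^ 2) := by gcongr
        _ = K / ((m : ℝ) + 1) := by field_simp
    have hdist : ∀ m k N : ℕ, N ≤ m → N ≤ k → dist (q m) (q k) ≤ 2 * K / ((N : ℝ) + 1) := by
      intro m k N hm hk
      rw [ContinuousMap.dist_le (by positivity)]
      refine forall_of_ae_of_isClosed
        (isClosed_le ((q m).continuous.dist (q k).continuous) continuous_const) ?_
      filter_upwards [hae m, hae k] with x h1 h2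
      have h3 : K / ((m : ℝ) + 1) ≤ K / ((N : ℝ) + 1) := by gcongr
      have h4 : K / ((k : ℝ) + 1) ≤ K / ((N : ℝ) + 1) := by gcongr
      have h5 : 2 * K / ((N : ℝ) + 1) = K / ((N : ℝ) + 1) + K / ((N : ℝ) + 1) := by ring
      rw [Real.dist_eq, h5]
      have := abs_sub_le (q m x) (inner ℝ (g x) (P.gen (x : Eu n))) (q k x)
      rw [abs_sub_comm (inner ℝ (g x) (P.gen (x : Eu n))) (q k x)] at this
      linarith
    have hb : Tendsto (fun N : ℕ => 2 * K / ((N : ℝ) + 1)) atTop (𝓝 0) :=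
      tendsto_const_nhds.div_atTop (tendsto_atTop_add_const_right _ _ tendsto_natCast_atTop_atTop)
    obtain ⟨v, hv⟩ := cauchySeq_tendsto_of_complete (cauchySeq_of_le_tendsto_0 _ hdist hb)
    refine ⟨v, ?_⟩
    filter_upwards [ae_all_iff.2 hae] with x hx
    have t1 : Tendsto (fun m => q m x) atTop (𝓝 (v x)) :=
      ((continuous_eval_const x).tendsto v).comp hv
    have t2 : Tendsto (fun m => q m x) atTop (𝓝 (inner ℝ (g x) (P.gen (x : Eu n)))) := by
      rw [tendsto_iff_dist_tendsto_zero]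
      refine squeeze_zero (fun _ => dist_nonneg) (fun m => hx m) ?_
      exact tendsto_const_nhds.div_atTop
        (tendsto_atTop_add_const_right _ _ tendsto_natCast_atTop_atTop)
    exact tendsto_nhds_unique t2 t1
  choose v hv using hplane
  classical
  set w : Fin n → Fin n → Sph n → ℝ := fun i j x =>
    if hij : i ≠ j then v (coordPlane i j hij) x else 0 with hw
  have hwc : ∀ i j, Continuous (w i j) := by
    intro i j
    by_cases hij : i ≠ j
    · simp only [hw, dif_pos hij]; exact (v _).continuous
    · simp only [hw, dif_neg hij]; exact continuous_const
  have hwae : ∀ i j, ∀ᵐ x ∂(sphMeasure n),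
      w i j x = (x : Eu n) i * g x j - (x : Eu n) j * g x i := by
    intro i j
    by_cases hij : i ≠ j
    · filter_upwards [hv (coordPlane i j hij)] with x hx
      simp only [hw, dif_pos hij]
      rw [← hx, inner_coordPlane_gen]
    · refine Eventually.of_forall fun x => ?_
      simp only [hw, dif_neg hij]
      rw [not_ne_iff.1 hij]; ring
  -- Since `|x| = 1` and `⟨g, x⟩ = 0`, one has `g j = ∑ x i (x i g j - x j g i)`, which recovers the
  -- field from its components along rotations.
  refine ⟨fun x => ∑ j, (∑ i, (x : Eu n) i * w i j x) • EuclideanSpace.single j (1 : ℝ), ?_, ?_⟩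
  · refine continuous_finsetSum _ fun j _ => ?_
    have hj : Continuous fun x : Sph n => ∑ i, (x : Eu n) i * w i j x :=
      continuous_finsetSum _ fun i _ => (continuous_coord i).mul (hwc i j)
    exact hj.smul continuous_const
  · filter_upwards [ae_all_iff.2 fun i => ae_all_iff.2 fun j => hwae i j, htan] with x hx ht
    have hj : ∀ j, ∑ i, (x : Eu n) i * w i j x = g x j := by
      intro j
      calc ∑ i, (x : Eu n) i * w i j x
          = ∑ i, ((x : Eu n) i * (x : Eu n) i * g x j - (x : Eu n) j * (g x i * (x : Eu n) i)) :=
            Finset.sum_congr rfl fun i _ => by rw [hx i j]; ring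
        _ = g x j := by
            rw [Finset.sum_sub_distrib, ← Finset.sum_mul, ← Finset.mul_sum, sum_sq_sph,
              ← inner_eq_sum, ht]
            ring
    simp only [hj]
    have := (EuclideanSpace.basisFun (Fin n) ℝ).sum_repr (g x)
    simpa using this.symm

/-- The right side is four times the squared chord of the angle, so angles are at most twice chords.
The factor `4` comes from `cos θ ≤ 1 - 2 θ² / π²` and `π² ≤ 16`. -/
theorem theta_sq_le {θ : ℝ} (h0 : 0 ≤ θ) (hπ : θ ≤ Real.pi) :
    θ ^ 2 ≤ 4 * (2 - 2 * Real.cos θ) := by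
  have h := Real.cos_le_one_sub_mul_cos_sq (x := θ) (by rw [abs_of_nonneg h0]; exact hπ)
  have hp : Real.pi ^ 2 ≤ 16 := by nlinarith [Real.pi_lt_four, Real.pi_pos]
  have h2 : θ ^ 2 * (1 / 8) ≤ 2 / Real.pi ^ 2 * θ ^ 2 := by
    have : (1 : ℝ) / 8 ≤ 2 / Real.pi ^ 2 := by
      rw [div_le_div_iff₀ (by norm_num) (by positivity)]
      linarith
    nlinarith [sq_nonneg θ]
  nlinarith

theorem abs_sin_sub_self_le {θ : ℝ} (h0 : 0 ≤ θ) (hπ : θ ≤ Real.pi) :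
    |Real.sin θ - θ| ≤ θ ^ 2 := by
  have h1 := Real.sin_le h0
  rw [abs_of_nonpos (by linarith)]
  rcases eq_or_lt_of_le h0 with rfl | hpos
  · simp
  rcases le_total θ 1 with h | h
  · have := Real.sin_gt_sub_cube hpos
    nlinarith [mul_nonneg (sq_nonneg θ) (sub_nonneg.2 h)]
  · have := Real.sin_nonneg_of_nonneg_of_le_pi h0 hπ
    nlinarith

/-- Any two points of the sphere are joined by a rotation. -/
theorem exists_plane_rot (hn : 2 ≤ n) (x y : Sph n) : ∃ (P : Plane n) (θ : ℝ), P.a = x ∧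
    0 ≤ θ ∧ θ ≤ Real.pi ∧ (y : Eu n) = Real.cos θ • (x : Eu n) + Real.sin θ • P.b := by
  set c : ℝ := inner ℝ (x : Eu n) (y : Eu n) with hc
  have hc1 : |c| ≤ 1 := by
    have := abs_real_inner_le_norm (x : Eu n) (y : Eu n)
    rwa [norm_coe_sph, norm_coe_sph, one_mul] at this
  set w : Eu n := y - c • (x : Eu n) with hw
  have hxw : inner ℝ (x : Eu n) w = 0 := by
    rw [hw, inner_sub_right, real_inner_smul_right, inner_self_sph]; ring
  have hnw : ‖w‖ ^ 2 = 1 - c ^ 2 := by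
    rw [hw, norm_sub_sq_real, real_inner_smul_right, real_inner_comm, norm_smul, norm_coe_sph,
      norm_coe_sph, ← hc, Real.norm_eq_abs, mul_one, sq_abs]
    ring
  have hsin : Real.sin (Real.arccos c) = ‖w‖ := by
    rw [Real.sin_arccos, ← hnw, Real.sqrt_sq (norm_nonneg _)]
  have hcos : Real.cos (Real.arccos c) = c := Real.cos_arccos (abs_le.1 hc1).1 (abs_le.1 hc1).2
  have hb : ∃ b : Eu n, ‖b‖ = 1 ∧ inner ℝ (x : Eu n) b = 0 ∧ w = ‖w‖ • b := by
    rcases eq_or_ne w 0 with h0 | h0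
    · have hfr := finrank_tangentSubmodule x
      have : Nontrivial (tangentSubmodule x) :=
        Module.nontrivial_of_finrank_pos (R := ℝ) (by omega)
      obtain ⟨b, hb⟩ := exists_norm_eq (tangentSubmodule x) zero_le_one
      exact ⟨b, hb, mem_tangentSubmodule.1 b.2, by simp [h0]⟩
    · refine ⟨‖w‖⁻¹ • w, by rw [norm_smul, norm_inv, norm_norm,
        inv_mul_cancel₀ (norm_ne_zero_iff.2 h0)], by rw [real_inner_smul_right, hxw, mul_zero], ?_⟩
      rw [smul_smul, mul_inv_cancel₀ (norm_ne_zero_iff.2 h0), one_smul]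
  obtain ⟨b, hb1, hb2, hb3⟩ := hb
  refine ⟨⟨x, b, norm_coe_sph x, hb1, hb2⟩, Real.arccos c, rfl, Real.arccos_nonneg _,
    Real.arccos_le_pi _, ?_⟩
  rw [hcos, hsin, ← hb3, hw]
  module

theorem Plane.sph_eq {P : Plane n} {x y : Sph n} {θ : ℝ} (hP : P.a = x)
    (hy : (y : Eu n) = Real.cos θ • (x : Eu n) + Real.sin θ • P.b) :
    P.sph θ x = y ∧ P.gen (x : Eu n) = P.b := by
  have hg : P.gen (x : Eu n) = P.b := by
    rw [← hP, P.gen_apply, P.inner_aa, P.inner_ba]; simp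
  refine ⟨Subtype.ext ?_, hg⟩
  rw [P.coe_sph, P.rot_apply, hg, hy, ← hP, P.gen_apply, P.inner_ab, P.inner_bb]
  module

theorem theta_le_two_mul_dist {P : Plane n} {x y : Sph n} {θ : ℝ} (hP : P.a = x) (h0 : 0 ≤ θ)
    (hπ : θ ≤ Real.pi) (hy : (y : Eu n) = Real.cos θ • (x : Eu n) + Real.sin θ • P.b) :
    θ ≤ 2 * ‖(y : Eu n) - x‖ := by
  have h1 : ‖(y : Eu n) - x‖ ^ 2 = 2 - 2 * Real.cos θ := by
    rw [norm_sub_sq_real, norm_coe_sph, norm_coe_sph, hy, inner_add_left, real_inner_smul_left,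
      real_inner_smul_left, inner_self_sph, ← hP, P.inner_ba]
    ring
  have h2 := theta_sq_le h0 hπ
  rw [← h1] at h2
  exact abs_le_of_sq_le_sq' (by linarith) (by positivity) |>.2

/-- The weak mean value inequality is applied twice along rotations: to the components of the
gradient for a Lipschitz bound, then to `u` for a Taylor bound with `O(t²)` error. The Taylor bound
yields a continuous gradient, so almost everywhere becomes everywhere, and any two points are joined
by a rotation. The constant `8 n + 8` is `4 (2 n + 2)`, the `4` from replacing angles by chords. -/
theorem MemW2Inf.exists_isC11 (hn : 2 ≤ n) {u : Sph n → ℝ} (hu : MemW2Inf u) {ε : ℝ}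
    (hε : w2InfNorm u ≤ ε) : ∃ g, (∀ᵐ x ∂(sphMeasure n), weakGradient u x = g x) ∧
      IsC11 u g ε ((8 * n + 8) * ε) := by
  have hg := hu.isWeakGradient
  have hA := hu.isWeakJacobian
  set g := weakGradient u
  set A := weakJacobian u
  rw [w2InfNorm] at hε
  have n1 : 0 ≤ (eLpNorm u ⊤ (sphMeasure n)).toReal := ENNReal.toReal_nonneg
  have n2 : 0 ≤ (eLpNorm (weakGradient u) ⊤ (sphMeasure n)).toReal := ENNReal.toReal_nonneg
  have n3 : 0 ≤ (eLpNorm (weakHessian u) ⊤ (sphMeasure n)).toReal := ENNReal.toReal_nonneg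
  have hε0 : 0 ≤ ε := by linarith
  have hum : MemLp u ⊤ (sphMeasure n) := by
    obtain ⟨C, hC⟩ := (isCompact_univ (X := Sph n)).exists_bound_of_continuousOn
      hu.continuous.continuousOn
    exact memLp_top_of_bound hu.continuous.aestronglyMeasurable C
      (Eventually.of_forall fun x => hC x (mem_univ x))
  have bu : ∀ x, |u x| ≤ ε := by
    refine forall_of_ae_of_isClosed (isClosed_le hu.continuous.abs continuous_const) ?_
    filter_upwards [ae_norm_le_of_memLp_top hum] with x hx
    rw [Real.norm_eq_abs] at hx
    linarith
  have bg : ∀ᵐ x ∂(sphMeasure n), ‖g x‖ ≤ ε := by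
    filter_upwards [ae_norm_le_of_memLp_top hu.gradient_bounded] with x hx
    linarith
  -- The covariant Hessian ignores the normal direction, but fixed basis vectors have a normal part.
  -- There the Jacobian equals `-g`, which costs the second `ε`.
  have bA : ∀ᵐ x ∂(sphMeasure n), ∀ i, ‖A x (EuclideanSpace.single i 1)‖ ≤ 2 * ε := by
    filter_upwards [ae_norm_le_of_memLp_top hu.hessian_bounded, bg, hA.ae_apply_normal hg]
      with x h1 h2 h3 i
    set e : Eu n := EuclideanSpace.single i 1
    have he : ‖e‖ = 1 := by simp [e]
    have e1 : A x e = weakHessian u x e + inner ℝ (x : Eu n) e • A x (x : Eu n) := by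
      change A x e = A x (tangentProj (x : Eu n) e) + _
      rw [tangentProj_apply, map_sub, map_smul]
      abel
    rw [e1]
    have h4 : ‖weakHessian u x e‖ ≤ ε := by
      refine ((weakHessian u x).le_opNorm e).trans ?_
      rw [he, mul_one]
      linarith
    have h5 : ‖inner ℝ (x : Eu n) e • A x (x : Eu n)‖ ≤ ε := by
      rw [norm_smul, h3, norm_neg]
      have := norm_inner_le_norm (𝕜 := ℝ) (x : Eu n) e
      rw [norm_coe_sph, he] at this
      nlinarith [norm_nonneg (g x), norm_nonneg (inner ℝ (x : Eu n) e)]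
    linarith [norm_add_le (weakHessian u x e) (inner ℝ (x : Eu n) e • A x (x : Eu n))]
  have lipg : ∀ (P : Plane n) (t : ℝ), ∀ᵐ x ∂(sphMeasure n),
      ‖g (P.sph t x) - g x‖ ≤ 2 * n * ε * |t| := by
    intro P t
    have hcomp : ∀ i, ∀ᵐ x ∂(sphMeasure n), |g (P.sph t x) i - g x i| ≤ 2 * ε * |t| := by
      intro i
      have := P.ae_abs_sub_le_of_weak_deriv (k := 0) (T := t) (M := 2 * ε)
        (hA (EuclideanSpace.single i 1)).integrable_fun
        (integrable_inner_of_continuous (hA (EuclideanSpace.single i 1)).integrable_grad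
          (continuous_gen_coe P)) (integrable_zero _ _ _)
        (fun φ hφ => (hA (EuclideanSpace.single i 1)).integral_gen P hφ) (fun s _ => by
          filter_upwards [P.ae_comp_sph s bA] with x hx
          simp only [Pi.zero_apply, sub_zero]
          refine (abs_real_inner_le_norm _ _).trans ?_
          have h1 := P.norm_gen_le (P.sph s x : Eu n)
          rw [norm_coe_sph] at h1
          nlinarith [hx i, norm_nonneg (P.gen (P.sph s x : Eu n)),
            norm_nonneg (A (P.sph s x) (EuclideanSpace.single i 1))])
      filter_upwards [this] with x hx
      simpa [EuclideanSpace.inner_single_right] using hx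
    filter_upwards [ae_all_iff.2 hcomp] with x hx
    refine (norm_le_sum_abs _).trans ?_
    calc ∑ i, |(g (P.sph t x) - g x) i| ≤ ∑ _i : Fin n, 2 * ε * |t| :=
          Finset.sum_le_sum fun i _ => hx i
      _ = _ := by rw [Finset.sum_const, Finset.card_univ, Fintype.card_fin, nsmul_eq_mul]; ring
  have taylor : ∀ (P : Plane n) (t : ℝ), ∀ᵐ x ∂(sphMeasure n),
      |u (P.sph t x) - u x - t * inner ℝ (g x) (P.gen (x : Eu n))| ≤
        (2 * n + 1) * ε * t ^ 2 := by
    intro P t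
    have hI := integrable_inner_of_continuous hg.integrable_grad (continuous_gen_coe P)
    have := P.ae_abs_sub_le_of_weak_deriv (k := fun x => inner ℝ (g x) (P.gen (x : Eu n)))
      (T := t) (M := (2 * n + 1) * ε * |t|)
      (integrable_of_continuous hu.continuous) hI hI (fun φ hφ => hg.integral_gen P hφ)
      (fun s hs => by
        filter_upwards [lipg P s, bg] with x h1 h2
        -- Both the gradient and the rotation field vary along the orbit; the two terms separate
        -- these contributions, each of order `ε |s|`.
        have e : inner ℝ (g (P.sph s x)) (P.gen (P.sph s x : Eu n)) -
            inner ℝ (g x) (P.gen (x : Eu n)) =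
            inner ℝ (g (P.sph s x) - g x) (P.gen (P.sph s x : Eu n)) +
            inner ℝ (g x) (P.gen ((P.sph s x : Eu n) - x)) := by
          rw [map_sub, inner_sub_left, inner_sub_right]; ring
        rw [e]
        have a1 := P.norm_gen_le (P.sph s x : Eu n)
        rw [norm_coe_sph] at a1
        have a2 := P.norm_gen_le ((P.sph s x : Eu n) - x)
        have a3 := P.norm_rot_sub_le s (x : Eu n)
        rw [norm_coe_sph, mul_one] at a3
        have b1 : |inner ℝ (g (P.sph s x) - g x) (P.gen (P.sph s x : Eu n))| ≤
            2 * n * ε * |s| * 1 :=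
          (abs_real_inner_le_norm _ _).trans (by gcongr)
        have b2 : |inner ℝ (g x) (P.gen ((P.sph s x : Eu n) - x))| ≤ ε * |s| :=
          (abs_real_inner_le_norm _ _).trans (by gcongr; exact a2.trans a3)
        calc _ ≤ _ := abs_add_le _ _
          _ ≤ (2 * n + 1) * ε * |s| := by linarith
          _ ≤ _ := by gcongr)
    filter_upwards [this] with x hx
    rwa [mul_assoc _ |t| |t|, abs_mul_abs_self, ← sq] at hx
  obtain ⟨g', hg'c, hg'⟩ := exists_continuous_of_forall_plane hu.continuous
    (by positivity) hg.tangent taylor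
  have tan' : ∀ x : Sph n, inner ℝ (x : Eu n) (g' x) = 0 := by
    refine forall_of_ae_of_isClosed
      (isClosed_eq (continuous_subtype_val.inner hg'c) continuous_const) ?_
    filter_upwards [hg', hg.tangent] with x h1 h2
    rw [← h1, real_inner_comm, h2]
  have bg' : ∀ x, ‖g' x‖ ≤ ε := by
    refine forall_of_ae_of_isClosed (isClosed_le hg'c.norm continuous_const) ?_
    filter_upwards [hg', bg] with x h1 h2
    rwa [← h1]
  have lip' : ∀ (P : Plane n) (t : ℝ) (x : Sph n),
      ‖g' (P.sph t x) - g' x‖ ≤ 2 * n * ε * |t| := by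
    intro P t
    refine forall_of_ae_of_isClosed (isClosed_le
      ((hg'c.comp (P.sph t).continuous).sub hg'c).norm continuous_const) ?_
    filter_upwards [hg', P.ae_comp_sph t hg', lipg P t] with x h1 h2 h3
    rwa [← h1, ← h2]
  have taylor' : ∀ (P : Plane n) (t : ℝ) (x : Sph n),
      |u (P.sph t x) - u x - t * inner ℝ (g' x) (P.gen (x : Eu n))| ≤
        (2 * n + 1) * ε * t ^ 2 := by
    intro P t
    refine forall_of_ae_of_isClosed (isClosed_le
      (((hu.continuous.comp (P.sph t).continuous).sub hu.continuous).sub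
        (continuous_const.mul (hg'c.inner (continuous_gen_coe P)))).abs continuous_const) ?_
    filter_upwards [hg', taylor P t] with x h1 h2
    rwa [← h1]
  refine ⟨g', hg', bu, bg', tan', fun x y => ?_, fun x y => ?_⟩
  all_goals
    obtain ⟨P, θ, hP, hθ0, hθπ, hy⟩ := exists_plane_rot hn x y
    have hθ := theta_le_two_mul_dist hP hθ0 hθπ hy
    obtain ⟨hs, hgen⟩ := Plane.sph_eq hP hy
  · have := lip' P θ x
    rw [hs, abs_of_nonneg hθ0] at this
    refine this.trans ?_
    calc 2 * n * ε * θ ≤ 2 * n * ε * (2 * ‖(y : Eu n) - x‖) := by gcongr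
      _ ≤ (8 * n + 8) * ε * ‖(y : Eu n) - x‖ := by
        have : 0 ≤ ε * ‖(y : Eu n) - x‖ := by positivity
        have h2 : 0 ≤ (n : ℝ) * (ε * ‖(y : Eu n) - x‖) := by positivity
        nlinarith
  · have h1 := taylor' P θ x
    rw [hs, hgen] at h1
    have e : inner ℝ (g' x) ((y : Eu n) - x) = Real.sin θ * inner ℝ (g' x) P.b := by
      rw [hy, inner_sub_right, inner_add_right, real_inner_smul_right, real_inner_smul_right,
        real_inner_comm, tan' x]
      ring
    have e2 : u y - u x - inner ℝ (g' x) ((y : Eu n) - x) =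
        (u y - u x - θ * inner ℝ (g' x) P.b) - (Real.sin θ - θ) * inner ℝ (g' x) P.b := by
      rw [e]; ring
    have h2 : |(Real.sin θ - θ) * inner ℝ (g' x) P.b| ≤ θ ^ 2 * ε := by
      rw [abs_mul]
      have h3 := abs_real_inner_le_norm (g' x) P.b
      rw [P.norm_b, mul_one] at h3
      exact mul_le_mul (abs_sin_sub_self_le hθ0 hθπ) (h3.trans (bg' x)) (abs_nonneg _)
        (sq_nonneg _)
    rw [e2]
    have h4 := abs_sub (u y - u x - θ * inner ℝ (g' x) P.b)
      ((Real.sin θ - θ) * inner ℝ (g' x) P.b)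
    have h5 : θ ^ 2 ≤ 4 * ‖(y : Eu n) - x‖ ^ 2 := by nlinarith
    calc _ ≤ (2 * n + 2) * ε * θ ^ 2 := by linarith
      _ ≤ (2 * n + 2) * ε * (4 * ‖(y : Eu n) - x‖ ^ 2) := by gcongr
      _ = _ := by ring

/-- With a vanishing gradient the mean value inequality makes `u` invariant under every plane
rotation, and these act transitively. -/
theorem eq_of_weakGradient_ae_eq_zero (hn : 2 ≤ n) {u : Sph n → ℝ} (hu : Continuous u)
    {g : Sph n → Eu n} (hg : IsWeakGradient u g) (h0 : ∀ᵐ x ∂(sphMeasure n), g x = 0)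
    (x y : Sph n) : u x = u y := by
  obtain ⟨P, θ, hP, -, -, hy⟩ := exists_plane_rot hn x y
  obtain ⟨hs, -⟩ := Plane.sph_eq hP hy
  have := P.ae_abs_sub_le_of_weak_deriv (k := 0) (T := θ) (M := 0)
    (integrable_of_continuous hu)
    (integrable_inner_of_continuous hg.integrable_grad (continuous_gen_coe P))
    (integrable_zero _ _ _) (fun φ hφ => hg.integral_gen P hφ) (fun s _ => by
      filter_upwards [P.ae_comp_sph s h0] with x hx
      simp [hx])
  have h := forall_of_ae_of_isClosed (p := fun x => u (P.sph θ x) = u x)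
    (isClosed_eq (hu.comp (P.sph θ).continuous) hu) (by
      filter_upwards [this] with x hx
      simp only [Pi.zero_apply, mul_zero, sub_zero, zero_mul] at hx
      exact sub_eq_zero.1 (abs_nonpos_iff.1 hx)) x
  rw [← h, hs]

end

/-! ### The area formula for embedded spheres. -/

section

open scoped NNReal ENNReal

variable {n : ℕ}

/-! ### Comparing measures through local densities -/

theorem measure_le_mul_of_locally {X : Type*} [TopologicalSpace X] [CompactSpace X]
    [MeasurableSpace X] [BorelSpace X] {μ ν : Measure X} {K : ℝ≥0∞}
    (h : ∀ x, ∃ U ∈ 𝓝 x, ∀ A ⊆ U, MeasurableSet A → μ A ≤ K * ν A) {A : Set X}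
    (hA : MeasurableSet A) : μ A ≤ K * ν A := by
  have key := (isCompact_univ (X := X)).induction_on
    -- The measurable enlargement `B'` makes the property inherited by subsets and lets a measurable
    -- set be split along a union, as compactness induction requires.
    (p := fun B => ∃ B', B ⊆ B' ∧ MeasurableSet B' ∧ ∀ A ⊆ B', MeasurableSet A → μ A ≤ K * ν A)
    ⟨∅, subset_rfl, MeasurableSet.empty, fun A hA _ => by
      rw [subset_empty_iff.1 hA]; simp⟩
    (fun s t hst ⟨B', h1, h2, h3⟩ => ⟨B', hst.trans h1, h2, h3⟩)
    (fun s t ⟨B, h1, h2, h3⟩ ⟨C, k1, k2, k3⟩ => ⟨B ∪ C, union_subset_union h1 k1, h2.union k2,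
      fun A hA hAm => by
        rw [← measure_inter_add_sdiff A h2, ← measure_inter_add_sdiff (μ := ν) A h2, mul_add]
        refine add_le_add (h3 _ inter_subset_right (hAm.inter h2)) (k3 _ ?_ (hAm.diff h2))
        rintro x ⟨hx, hxB⟩
        exact (hA hx).resolve_left hxB⟩)
    (fun x _ => by
      obtain ⟨U, hU, hUA⟩ := h x
      obtain ⟨V, hVU, hV, hxV⟩ := mem_nhds_iff.1 hU
      exact ⟨V, mem_nhdsWithin_of_mem_nhds (hV.mem_nhds hxV), V, subset_rfl, hV.measurableSet,
        fun A hA => hUA A (hA.trans hVU)⟩)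
  obtain ⟨B, h1, -, h3⟩ := key
  exact h3 A ((subset_univ A).trans h1) hA

/-- The factor `K` is lost twice, once in the hypothesis and once for the oscillation of `D` near
`x`. Compactness globalizes the bounds, and `K` tends to `1`. -/
theorem eq_withDensity_of_locally {X : Type*} [TopologicalSpace X] [CompactSpace X]
    [MeasurableSpace X] [BorelSpace X] {μ ν : Measure X} [IsFiniteMeasure ν] {D : X → ℝ≥0}
    (hD : Continuous D) (hD0 : ∀ x, 0 < D x)
    (h : ∀ K : ℝ≥0, 1 < K → ∀ x, ∃ U ∈ 𝓝 x, ∀ A ⊆ U, MeasurableSet A →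
      μ A ≤ K * (D x * ν A) ∧ D x * ν A ≤ K * μ A) :
    μ = ν.withDensity (fun x => (D x : ℝ≥0∞)) := by
  have step : ∀ K : ℝ≥0, 1 < K → ∀ x, ∃ U ∈ 𝓝 x, ∀ A ⊆ U, MeasurableSet A →
      μ A ≤ (K * K) * ν.withDensity (fun x => (D x : ℝ≥0∞)) A ∧
      ν.withDensity (fun x => (D x : ℝ≥0∞)) A ≤ (K * K) * μ A := by
    intro K hK x
    obtain ⟨U, hU, hUA⟩ := h K hK x
    have hD1 : ∀ᶠ y in 𝓝 x, D x < K * D y := by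
      have : Tendsto (fun y => K * D y) (𝓝 x) (𝓝 (K * D x)) := (hD.tendsto x).const_mul K
      exact this.eventually_const_lt (lt_mul_of_one_lt_left (hD0 x) hK)
    have hD2 : ∀ᶠ y in 𝓝 x, D y < K * D x :=
      (hD.tendsto x).eventually_lt_const (lt_mul_of_one_lt_left (hD0 x) hK)
    refine ⟨_, inter_mem hU (hD1.and hD2), fun A hA hAm => ?_⟩
    obtain ⟨h1, h2⟩ := hUA A (fun y hy => (hA hy).1) hAm
    have e1 : (D x : ℝ≥0∞) * ν A ≤ K * ν.withDensity (fun x => (D x : ℝ≥0∞)) A := by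
      rw [withDensity_apply _ hAm, ← setLIntegral_const,
        ← lintegral_const_mul _ hD.measurable.coe_nnreal_ennreal]
      refine setLIntegral_mono' hAm fun y hy => ?_
      exact_mod_cast (hA hy).2.1.le
    have e2 : ν.withDensity (fun x => (D x : ℝ≥0∞)) A ≤ K * (D x * ν A) := by
      rw [withDensity_apply _ hAm, ← mul_assoc, ← setLIntegral_const]
      refine setLIntegral_mono' hAm fun y hy => ?_
      exact_mod_cast (hA hy).2.2.le
    constructor
    · calc μ A ≤ K * (D x * ν A) := h1
        _ ≤ K * (K * ν.withDensity (fun x => (D x : ℝ≥0∞)) A) := by gcongr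
        _ = _ := by rw [mul_assoc]
    · calc _ ≤ K * (D x * ν A) := e2
        _ ≤ K * (K * μ A) := by gcongr
        _ = _ := by rw [mul_assoc]
  have hlim : ∀ a : ℝ≥0∞, Tendsto (fun K : ℝ≥0 => ((K : ℝ≥0∞) * K) * a) (𝓝[>] 1) (𝓝 a) := by
    intro a
    have h1 : Tendsto (fun K : ℝ≥0 => ((K * K : ℝ≥0) : ℝ≥0∞)) (𝓝[>] 1)
        (𝓝 ((1 * 1 : ℝ≥0) : ℝ≥0∞)) := by
      refine ENNReal.tendsto_coe.2 (Tendsto.mono_left ?_ nhdsWithin_le_nhds)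
      exact tendsto_id.mul tendsto_id
    have h2 := ENNReal.Tendsto.mul_const (b := a) h1 (Or.inl (by simp))
    simpa using h2
  refine Measure.ext fun A hA => le_antisymm ?_ ?_
  · refine ge_of_tendsto (hlim _) ?_
    filter_upwards [self_mem_nhdsWithin] with K hK
    refine measure_le_mul_of_locally (fun x => ?_) hA
    obtain ⟨U, hU, hUA⟩ := step K hK x
    exact ⟨U, hU, fun B hB hBm => (hUA B hB hBm).1⟩
  · refine ge_of_tendsto (hlim _) ?_
    filter_upwards [self_mem_nhdsWithin] with K hK
    refine measure_le_mul_of_locally (fun x => ?_) hA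
    obtain ⟨U, hU, hUA⟩ := step K hK x
    exact ⟨U, hU, fun B hB hBm => (hUA B hB hBm).2⟩

/-! ### The area formula for embeddings of the sphere -/

/-- Near `a` secants are almost tangential, and by the two-point differentiability `hΨ` the map `Ψ`
acts on them almost as `L`. Since `L` is bounded below on the tangent space, additive errors become
factors close to `1`. -/
theorem image_measure_comparison {Ψ : Sph n → Eu n} {a : Sph n} {L : Eu n →L[ℝ] Eu n} {c : ℝ}
    (hc : 0 < c) (hL : ∀ z, inner ℝ (a : Eu n) z = 0 → c * ‖z‖ ≤ ‖L z‖)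
    (hΨ : ∀ δ : ℝ, 0 < δ → ∃ η : ℝ, 0 < η ∧ ∀ x y : Sph n, dist x a ≤ η → dist y a ≤ η →
      ‖Ψ x - Ψ y - L ((x : Eu n) - y)‖ ≤ δ * ‖(x : Eu n) - y‖) {K : ℝ} (hK : 1 < K) :
    ∃ U ∈ 𝓝 a, ∀ x ∈ U, ∀ y ∈ U,
      ‖(x : Eu n) - y‖ ≤
        K * ‖(tangentSubmodule a).orthogonalProjectionOnto ((x : Eu n) - y)‖ ∧
      ‖Ψ x - Ψ y‖ ≤
        K * ‖L ((tangentSubmodule a).orthogonalProjectionOnto ((x : Eu n) - y) : Eu n)‖ ∧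
      ‖L ((tangentSubmodule a).orthogonalProjectionOnto ((x : Eu n) - y) : Eu n)‖ ≤
        K * ‖Ψ x - Ψ y‖ := by
  -- The choice satisfies `K (1 - s) = 1` and `1 + s ≤ K`, so a relative error `s` costs at most the
  -- factor `K` in either direction.
  set s : ℝ := (K - 1) / K with hs
  have hK0 : 0 < K := by linarith
  have hs0 : 0 < s := div_pos (by linarith) hK0
  have hsK : K * (1 - s) = 1 := by rw [hs]; field_simp; ring
  have hs1 : s < 1 := by
    by_contra! h
    nlinarith
  obtain ⟨η₁, hη₁, h1⟩ := hΨ (c * s / 4) (by positivity)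
  set η := min η₁ (min (1 / 2) (min s (c * s / (4 * (‖L‖ + 1))))) with hη
  have hLn := norm_nonneg L
  have hη0 : 0 < η := by positivity
  have a1 : η ≤ η₁ := min_le_left _ _
  have a2 : η ≤ 1 / 2 := (min_le_right _ _).trans (min_le_left _ _)
  have a3 : η ≤ s := (min_le_right _ _).trans ((min_le_right _ _).trans (min_le_left _ _))
  have a4 : η ≤ c * s / (4 * (‖L‖ + 1)) :=
    (min_le_right _ _).trans ((min_le_right _ _).trans (min_le_right _ _))
  have a5 : ‖L‖ * η ≤ c * s / 4 := by
    calc ‖L‖ * η ≤ (‖L‖ + 1) * (c * s / (4 * (‖L‖ + 1))) := by gcongr; linarith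
      _ = c * s / 4 := by field_simp
  refine ⟨closedBall a η, closedBall_mem_nhds a hη0, fun x hx y hy => ?_⟩
  rw [mem_closedBall] at hx hy
  set w : Eu n := (x : Eu n) - y with hw
  set p : tangentSubmodule a := (tangentSubmodule a).orthogonalProjectionOnto w with hp
  have b1 : (1 - η) * ‖w‖ ≤ ‖p‖ := norm_secant_le_norm_proj a x y hx hy
  have b2 : ‖w - p‖ ≤ η * ‖w‖ :=
    (norm_secant_sub_proj_le a x y).trans (by gcongr; exact max_le hx hy)
  have b3 : c * ‖p‖ ≤ ‖L p‖ := by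
    have := hL p (mem_tangentSubmodule.1 p.2)
    rwa [← Submodule.coe_norm] at this
  have b4 : ‖Ψ x - Ψ y - L w‖ ≤ c * s / 4 * ‖w‖ := h1 x y (hx.trans a1) (hy.trans a1)
  have b5 : ‖L w - L p‖ ≤ c * s / 4 * ‖w‖ := by
    rw [← map_sub]
    calc ‖L (w - p)‖ ≤ ‖L‖ * ‖w - p‖ := L.le_opNorm _
      _ ≤ ‖L‖ * (η * ‖w‖) := by gcongr
      _ = ‖L‖ * η * ‖w‖ := by ring
      _ ≤ _ := by gcongr
  have b6 : ‖Ψ x - Ψ y - L p‖ ≤ s * ‖L p‖ := by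
    have e : Ψ x - Ψ y - L p = (Ψ x - Ψ y - L w) + (L w - L p) := by abel
    have c1 : ‖w‖ ≤ 2 * ‖p‖ := by nlinarith [norm_nonneg w]
    rw [e]
    refine (norm_add_le _ _).trans ?_
    calc _ ≤ c * s / 4 * ‖w‖ + c * s / 4 * ‖w‖ := add_le_add b4 b5
      _ = s * (c * (‖w‖ / 2)) := by ring
      _ ≤ s * (c * ‖p‖) := by gcongr; linarith
      _ ≤ _ := by gcongr
  have hLp := norm_nonneg (L p)
  refine ⟨?_, ?_, ?_⟩
  · have : (1 - s) * ‖w‖ ≤ ‖p‖ := le_trans (by gcongr) b1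
    calc ‖w‖ = K * ((1 - s) * ‖w‖) := by rw [← mul_assoc, hsK, one_mul]
      _ ≤ _ := by gcongr
  · have c1 := norm_sub_norm_le (Ψ x - Ψ y) (L p)
    have c2 : 1 + s ≤ K := by nlinarith
    nlinarith
  · have c1 := norm_sub_norm_le (L p) (Ψ x - Ψ y)
    rw [norm_sub_rev (L p) (Ψ x - Ψ y)] at c1
    have c2 : (1 - s) * ‖L p‖ ≤ ‖Ψ x - Ψ y‖ := by linarith
    calc ‖L p‖ = K * ((1 - s) * ‖L p‖) := by rw [← mul_assoc, hsK, one_mul]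
      _ ≤ _ := by gcongr

/-- The restriction of a linear map to the tangent space of the sphere at `a`. -/
abbrev tangentRestrict (a : Sph n) (L : Eu n →L[ℝ] Eu n) : tangentSubmodule a →ₗ[ℝ] Eu n :=
  (L : Eu n →ₗ[ℝ] Eu n) ∘ₗ (tangentSubmodule a).subtype

/-- For a small piece `A` near `a`, the sets `A` and `π '' A` are nearly isometric, and so are `Ψ ''
A` and the linear image of `π '' A`. Linear maps scale the measure by `normDet`, so the pullback of
the Hausdorff measure has density `D`. -/
theorem hausdorffMeasure_restrict_range_eq_map {Ψ : Sph n → Eu n} (hΨc : Continuous Ψ)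
    (hΨi : Function.Injective Ψ) {L : Sph n → Eu n →L[ℝ] Eu n} {c : ℝ}
    (hc : 0 < c) (hL : ∀ (a : Sph n) (z : Eu n), inner ℝ (a : Eu n) z = 0 → c * ‖z‖ ≤ ‖L a z‖)
    (hΨ : ∀ a : Sph n, ∀ δ : ℝ, 0 < δ → ∃ η : ℝ, 0 < η ∧ ∀ x y : Sph n,
      dist x a ≤ η → dist y a ≤ η → ‖Ψ x - Ψ y - L a ((x : Eu n) - y)‖ ≤ δ * ‖(x : Eu n) - y‖)
    {D : Sph n → ℝ≥0} (hD : Continuous D) (hD0 : ∀ x, 0 < D x)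
    (hdet : ∀ a, (tangentRestrict a (L a)).normDet = D a) :
    (μHE[n - 1] : Measure (Eu n)).restrict (range Ψ) =
      ((sphMeasure n).withDensity (fun x => (D x : ℝ≥0∞))).map Ψ := by
  have hemb : MeasurableEmbedding Ψ := (hΨc.isClosedEmbedding hΨi).measurableEmbedding
  have key : (μHE[n - 1] : Measure (Eu n)).comap Ψ =
      (sphMeasure n).withDensity (fun x => (D x : ℝ≥0∞)) := by
    refine eq_withDensity_of_locally hD hD0 fun K hK a => ?_
    obtain ⟨K', hK'1, hK'⟩ : ∃ K' : ℝ≥0, 1 < K' ∧ K' ^ (n - 1) * K' ^ (n - 1) ≤ K := by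
      have ht : Tendsto (fun K' : ℝ≥0 => K' ^ (n - 1) * K' ^ (n - 1)) (𝓝[>] 1) (𝓝 1) := by
        have : Continuous fun K' : ℝ≥0 => K' ^ (n - 1) * K' ^ (n - 1) := by fun_prop
        have h1 := (this.tendsto 1).mono_left (nhdsWithin_le_nhds (s := Ioi 1))
        simpa using h1
      have h2 := (ht.eventually_lt_const hK).and self_mem_nhdsWithin
      obtain ⟨K', h3, h4⟩ := h2.exists
      exact ⟨K', h4, h3.le⟩
    obtain ⟨U, hU, hUxy⟩ := image_measure_comparison hc (hL a) (hΨ a)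
      (K := K') (by exact_mod_cast hK'1)
    refine ⟨U, hU, fun A hA hAm => ?_⟩
    set π : Sph n → tangentSubmodule a :=
      fun x => (tangentSubmodule a).orthogonalProjectionOnto (x : Eu n) with hπ
    set T := tangentRestrict a (L a) with hT
    have hT' : ∀ x y : Sph n, dist (T (π x)) (T (π y)) =
        ‖L a ((tangentSubmodule a).orthogonalProjectionOnto ((x : Eu n) - y) : Eu n)‖ := by
      intro x y
      rw [dist_eq_norm, ← map_sub, hπ]
      simp only
      rw [← map_sub]
      rfl
    have hπ' : ∀ x y : Sph n, dist (π x) (π y) =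
        ‖(tangentSubmodule a).orthogonalProjectionOnto ((x : Eu n) - y)‖ := by
      intro x y
      rw [dist_eq_norm, hπ]
      simp only
      rw [← map_sub]
    have m1 : μHE[n - 1] (Ψ '' A) ≤ (K' : ℝ≥0∞) ^ (n - 1) * μHE[n - 1] ((T ∘ π) '' A) :=
      euclideanHausdorffMeasure_image_le_of_dist_le (n - 1) A Ψ (T ∘ π) K' fun x hx y hy => by
        rw [Function.comp_apply, Function.comp_apply, hT', dist_eq_norm]
        exact (hUxy x (hA hx) y (hA hy)).2.1
    have m2 : μHE[n - 1] ((T ∘ π) '' A) ≤ (K' : ℝ≥0∞) ^ (n - 1) * μHE[n - 1] (Ψ '' A) :=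
      euclideanHausdorffMeasure_image_le_of_dist_le (n - 1) A (T ∘ π) Ψ K' fun x hx y hy => by
        rw [Function.comp_apply, Function.comp_apply, hT', dist_eq_norm]
        exact (hUxy x (hA hx) y (hA hy)).2.2
    have m3 : sphMeasure n A ≤ (K' : ℝ≥0∞) ^ (n - 1) * μHE[n - 1] (π '' A) := by
      have := euclideanHausdorffMeasure_image_le_of_dist_le (n - 1) A (fun x : Sph n => x) π K'
        fun x hx y hy => by
          rw [hπ', Subtype.dist_eq, dist_eq_norm]
          exact (hUxy x (hA hx) y (hA hy)).1
      rwa [image_id'] at this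
    have m4 : μHE[n - 1] (π '' A) ≤ sphMeasure n A := by
      have := euclideanHausdorffMeasure_image_le_of_dist_le (n - 1) A π (fun x : Sph n => x) 1
        fun x hx y hy => by
          rw [hπ', Subtype.dist_eq x y, dist_eq_norm, NNReal.coe_one, one_mul]
          exact Submodule.norm_orthogonalProjectionOnto_apply_le _ _
      simpa [sphMeasure] using this
    have m5 : μHE[n - 1] ((T ∘ π) '' A) = D a * μHE[n - 1] (π '' A) := by
      have h1 := T.euclideanHausdorffMeasure_image (π '' A)
      rw [finrank_tangentSubmodule, hdet, ENNReal.ofReal_coe_nnreal, ← image_comp] at h1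
      exact h1
    rw [hemb.comap_apply]
    have hKK : ((K' : ℝ≥0∞) ^ (n - 1)) * (K' : ℝ≥0∞) ^ (n - 1) ≤ K := by exact_mod_cast hK'
    have hK1 : (K' : ℝ≥0∞) ^ (n - 1) ≤ K := by
      refine le_trans ?_ hKK
      exact le_mul_of_one_le_left' (one_le_pow₀ (by exact_mod_cast hK'1.le))
    constructor
    · calc _ ≤ (K' : ℝ≥0∞) ^ (n - 1) * (D a * μHE[n - 1] (π '' A)) := by rw [← m5]; exact m1
        _ ≤ K * (D a * sphMeasure n A) := by gcongr
    · calc D a * sphMeasure n A ≤ D a * ((K' : ℝ≥0∞) ^ (n - 1) * μHE[n - 1] (π '' A)) := by gcongr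
        _ = (K' : ℝ≥0∞) ^ (n - 1) * μHE[n - 1] ((T ∘ π) '' A) := by rw [m5]; ring
        _ ≤ (K' : ℝ≥0∞) ^ (n - 1) * ((K' : ℝ≥0∞) ^ (n - 1) * μHE[n - 1] (Ψ '' A)) := by gcongr
        _ ≤ K * μHE[n - 1] (Ψ '' A) := by rw [← mul_assoc]; gcongr
  rw [← key, hemb.map_comap]

/-- For `ρ = 1` the Gram matrix in an orthonormal basis of the tangent space is the identity plus
the rank one matrix of the coordinates of `p`, with determinant `1 + |p|²`. -/
theorem normDet_tangent_rank_one (a : Sph n) {ρ : ℝ} (hρ : 0 < ρ) {p : Eu n}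
    (hp : inner ℝ (a : Eu n) p = 0) :
    (tangentRestrict a (ρ • (ContinuousLinearMap.id ℝ (Eu n) +
      (innerSL ℝ p).smulRight (a : Eu n)))).normDet = ρ ^ (n - 1) * Real.sqrt (1 + ‖p‖ ^ 2) := by
  have e : tangentRestrict a (ρ • (ContinuousLinearMap.id ℝ (Eu n) +
      (innerSL ℝ p).smulRight (a : Eu n))) =
      ρ • tangentRestrict a (ContinuousLinearMap.id ℝ (Eu n) +
      (innerSL ℝ p).smulRight (a : Eu n)) := rfl
  rw [e, LinearMap.normDet_smul, finrank_tangentSubmodule, Real.norm_of_nonneg hρ.le]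
  congr 1
  rw [eq_comm, Real.sqrt_eq_iff_mul_self_eq (by positivity) (LinearMap.normDet_nonneg _), ← sq]
  set b := stdOrthonormalBasis ℝ (tangentSubmodule a)
  have h := LinearMap.normDet_sq_eq_det_gram (tangentRestrict a (ContinuousLinearMap.id ℝ (Eu n) +
      (innerSL ℝ p).smulRight (a : Eu n))) b
  refine Eq.trans ?_ h.symm
  set q : tangentSubmodule a := ⟨p, mem_tangentSubmodule.2 hp⟩
  have hG : Matrix.gram ℝ (fun i => tangentRestrict a (ContinuousLinearMap.id ℝ (Eu n) +
      (innerSL ℝ p).smulRight (a : Eu n)) (b i)) =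
      1 + Matrix.replicateCol Unit (fun i => inner ℝ q (b i)) *
        Matrix.replicateRow Unit (fun i => inner ℝ q (b i)) := by
    ext i j
    have hb : inner ℝ (b i : Eu n) (b j : Eu n) = (1 : Matrix _ _ ℝ) i j := by
      rw [← Submodule.coe_inner, b.inner_eq_ite, Matrix.one_apply]
    have h1 : ∀ i, inner ℝ (a : Eu n) (b i : Eu n) = 0 := fun i => mem_tangentSubmodule.1 (b i).2
    have h1' : ∀ i, inner ℝ (b i : Eu n) (a : Eu n) = 0 := fun i => by rw [real_inner_comm, h1]
    have hT : ∀ i, tangentRestrict a (ContinuousLinearMap.id ℝ (Eu n) +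
      (innerSL ℝ p).smulRight (a : Eu n)) (b i) =
        (b i : Eu n) + inner ℝ p (b i : Eu n) • (a : Eu n) := fun i => rfl
    rw [Matrix.gram_apply, hT, hT, inner_add_left, inner_add_right, inner_add_right,
      real_inner_smul_left, real_inner_smul_right, real_inner_smul_right, real_inner_smul_left,
      inner_self_sph, h1, h1', hb]
    simp only [Matrix.add_apply, Matrix.mul_apply, Matrix.replicateCol_apply,
      Matrix.replicateRow_apply, Finset.univ_unique, Finset.sum_singleton, Submodule.coe_inner]
    ring
  refine Eq.trans ?_ (congrArg Matrix.det hG).symm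
  rw [Matrix.det_one_add_replicateCol_mul_replicateRow]
  congr 1
  have h2 := b.sum_sq_norm_inner_left q
  rw [Submodule.coe_norm] at h2
  rw [dotProduct]
  refine h2.symm.trans ?_
  refine Finset.sum_congr rfl fun i _ => ?_
  rw [Real.norm_eq_abs, sq_abs, sq]

end

/-! ### Lipschitz functions and fields on the sphere through homogeneous extension. -/

section

open scoped NNReal ENNReal

set_option linter.unusedSectionVars false

variable {n : ℕ} {F : Type*} [NormedAddCommGroup F] [NormedSpace ℝ F]

/-! ### Zero-homogeneous extensions -/

/-- The direction of a nonzero vector. -/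
def direction (z : Eu n) (hz : z ≠ 0) : Sph n :=
  ⟨‖z‖⁻¹ • z, by
    rw [mem_sphere, dist_zero_right, norm_smul, norm_inv, norm_norm,
      inv_mul_cancel₀ (norm_ne_zero_iff.2 hz)]⟩

open Classical in
/-- The `0`-homogeneous extension of a function on the sphere. -/
def homExt (f : Sph n → F) (z : Eu n) : F :=
  if hz : z ≠ 0 then f (direction z hz) else 0

theorem homExt_of_ne (f : Sph n → F) {z : Eu n} (hz : z ≠ 0) :
    homExt f z = f (direction z hz) := dif_pos hz

theorem direction_smul {t : ℝ} (ht : 0 < t) (x : Sph n) (h : t • (x : Eu n) ≠ 0) :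
    direction (t • (x : Eu n)) h = x := by
  ext1
  change ‖t • (x : Eu n)‖⁻¹ • t • (x : Eu n) = x
  rw [norm_smul, norm_coe_sph, mul_one, Real.norm_of_nonneg ht.le, smul_smul,
    inv_mul_cancel₀ ht.ne', one_smul]

theorem smul_coe_ne_zero {t : ℝ} (ht : 0 < t) (x : Sph n) : t • (x : Eu n) ≠ 0 :=
  smul_ne_zero ht.ne' (coe_sph_ne_zero x)

theorem homExt_smul (f : Sph n → F) {t : ℝ} (ht : 0 < t) (x : Sph n) :
    homExt f (t • (x : Eu n)) = f x := by
  rw [homExt_of_ne f (smul_coe_ne_zero ht x), direction_smul ht]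

theorem homExt_coe (f : Sph n → F) (x : Sph n) : homExt f (x : Eu n) = f x := by
  have := homExt_smul f one_pos x
  rwa [one_smul] at this

theorem norm_smul_direction {z : Eu n} (hz : z ≠ 0) : ‖z‖ • (direction z hz : Eu n) = z := by
  change ‖z‖ • ‖z‖⁻¹ • z = z
  rw [smul_smul, mul_inv_cancel₀ (norm_ne_zero_iff.2 hz), one_smul]

theorem homExt_smul' (f : Sph n → F) {t : ℝ} (ht : 0 < t) (z : Eu n) :
    homExt f (t • z) = homExt f z := by
  by_cases hz : z = 0
  · rw [hz, smul_zero]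
  · have hn : 0 < ‖z‖ := norm_pos_iff.2 hz
    conv_lhs => rw [← norm_smul_direction hz, smul_smul, homExt_smul f (mul_pos ht hn)]
    rw [homExt_of_ne f hz]

theorem hasFDerivAt_norm_smul {t : ℝ} (ht : 0 < t) (x : Sph n) :
    HasFDerivAt (fun z : Eu n => ‖z‖) (innerSL ℝ (x : Eu n)) (t • (x : Eu n)) := by
  have h0 : ‖t • (x : Eu n)‖ = t := by
    rw [norm_smul, norm_coe_sph, mul_one, Real.norm_of_nonneg ht.le]
  have h := (hasStrictFDerivAt_norm_sq (t • (x : Eu n))).hasFDerivAt.sqrt (by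
    rw [h0]; positivity)
  have e : (fun z : Eu n => √(‖z‖ ^ 2)) = fun z => ‖z‖ := by
    funext z; exact Real.sqrt_sq (norm_nonneg z)
  rw [e] at h
  refine h.congr_fderiv ?_
  rw [h0, Real.sqrt_sq ht.le]
  ext z
  simp only [map_smul, _root_.smul_apply, nsmul_eq_mul, smul_eq_mul]
  simp
  field_simp

theorem hasFDerivAt_inv_norm_smul {t : ℝ} (ht : 0 < t) (x : Sph n) :
    HasFDerivAt (fun z : Eu n => ‖z‖⁻¹ • z) (t⁻¹ • tangentProj (x : Eu n)) (t • (x : Eu n)) := by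
  have h0 : ‖t • (x : Eu n)‖ = t := by
    rw [norm_smul, norm_coe_sph, mul_one, Real.norm_of_nonneg ht.le]
  have h1 := (hasDerivAt_inv (x := ‖t • (x : Eu n)‖) (by rw [h0]; exact ht.ne')).comp_hasFDerivAt
    (t • (x : Eu n)) (hasFDerivAt_norm_smul ht x)
  have h := h1.smul (hasFDerivAt_id (𝕜 := ℝ) (t • (x : Eu n)))
  refine h.congr_fderiv ?_
  ext1 z
  simp only [_root_.add_apply, _root_.smul_apply,
    ContinuousLinearMap.smulRight_apply, Function.comp_apply, h0, tangentProj_apply,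
    ContinuousLinearMap.id_apply, innerSL_apply_apply, smul_eq_mul, smul_smul, id]
  rw [smul_sub, smul_smul, show -(t ^ 2)⁻¹ * inner ℝ (x : Eu n) z * t =
    - (t⁻¹ * inner ℝ (x : Eu n) z) by field_simp]
  module

/-- The extension factors through the radial retraction `z ↦ z / |z|`, which takes values in the
sphere, so a derivative within the sphere suffices. -/
theorem hasFDerivAt_homExt {f : Sph n → F} {x : Sph n} {L : Eu n →L[ℝ] F}
    (h : HasFDerivWithinAt (homExt f) L (sphere (0 : Eu n) 1) x) {t : ℝ} (ht : 0 < t) :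
    HasFDerivAt (homExt f) (t⁻¹ • (L ∘L tangentProj (x : Eu n))) (t • (x : Eu n)) := by
  have e0 : ‖t • (x : Eu n)‖⁻¹ • t • (x : Eu n) = x :=
    congrArg Subtype.val (direction_smul ht x (smul_coe_ne_zero ht x))
  have hne : ∀ᶠ z in 𝓝 (t • (x : Eu n)), z ≠ 0 :=
    isOpen_ne.mem_nhds (smul_coe_ne_zero ht x)
  have h1 := HasFDerivWithinAt.comp_hasFDerivAt_of_eq (t • (x : Eu n)) h
    (hasFDerivAt_inv_norm_smul ht x) (hne.mono fun z hz => (direction z hz).2) e0.symm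
  have h2 : HasFDerivAt (homExt f) (L ∘L (t⁻¹ • tangentProj (x : Eu n))) (t • (x : Eu n)) := by
    refine h1.congr_of_eventuallyEq (hne.mono fun z hz => ?_)
    rw [Function.comp_apply, homExt_smul' f (inv_pos.2 (norm_pos_iff.2 hz))]
  refine h2.congr_fderiv ?_
  ext1 z
  simp

theorem fderiv_homExt_apply_self {f : Sph n → F} {x : Sph n}
    (h : DifferentiableAt ℝ (homExt f) (x : Eu n)) :
    fderiv ℝ (homExt f) (x : Eu n) (x : Eu n) = 0 := by
  have h1 := (hasFDerivAt_homExt (f := f) (x := x) h.hasFDerivAt.hasFDerivWithinAt one_pos)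
  rw [one_smul] at h1
  rw [h1.fderiv]
  simp [tangentProj_apply]

theorem hasFDerivAt_homExt_smul {f : Sph n → F} {x : Sph n}
    (h : DifferentiableAt ℝ (homExt f) (x : Eu n)) {t : ℝ} (ht : 0 < t) :
    HasFDerivAt (homExt f) (t⁻¹ • fderiv ℝ (homExt f) (x : Eu n)) (t • (x : Eu n)) := by
  refine (hasFDerivAt_homExt h.hasFDerivAt.hasFDerivWithinAt ht).congr_fderiv ?_
  congr 1
  ext1 z
  rw [ContinuousLinearMap.comp_apply, tangentProj_apply, map_sub, map_smul,
    fderiv_homExt_apply_self h, smul_zero, sub_zero]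

theorem differentiableAt_homExt_of_smul {f : Sph n → F} {z : Eu n} {t : ℝ} (ht : 0 < t)
    (h : DifferentiableAt ℝ (homExt f) (t • z)) : DifferentiableAt ℝ (homExt f) z := by
  have e : homExt f = homExt f ∘ fun z : Eu n => t • z := by
    funext w; exact (homExt_smul' f ht w).symm
  rw [e]
  exact h.comp z (differentiableAt_id.const_smul t)

theorem continuousAt_homExt {f : Sph n → F} (hf : Continuous f) {z : Eu n} (hz : z ≠ 0) :
    ContinuousAt (homExt f) z := by
  have h : ContinuousOn (homExt f) {z : Eu n | z ≠ 0} := by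
    rw [continuousOn_iff_continuous_domRestrict]
    have e : {z : Eu n | z ≠ 0}.domRestrict (homExt f) = fun z => f (direction z.1 z.2) := by
      funext z; exact homExt_of_ne f z.2
    rw [e]
    refine hf.comp (Continuous.subtype_mk ?_ _)
    exact (continuous_subtype_val.norm.inv₀ fun z => norm_ne_zero_iff.2 z.2).smul
      continuous_subtype_val
  exact h.continuousAt (isOpen_ne.mem_nhds hz)

/-! ### Rademacher's theorem on the sphere -/

theorem norm_direction_sub_le {z w : Eu n} (hz : z ≠ 0) (hw : w ≠ 0) :
    ‖(direction z hz : Eu n) - direction w hw‖ ≤ 2 / ‖z‖ * ‖z - w‖ := by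
  have hzn : 0 < ‖z‖ := norm_pos_iff.2 hz
  have hwn : 0 < ‖w‖ := norm_pos_iff.2 hw
  have e : (direction z hz : Eu n) - direction w hw =
      ‖z‖⁻¹ • (z - w) + ((‖w‖ - ‖z‖) * (‖z‖⁻¹ * ‖w‖⁻¹)) • w := by
    change ‖z‖⁻¹ • z - ‖w‖⁻¹ • w = _
    rw [show (‖w‖ - ‖z‖) * (‖z‖⁻¹ * ‖w‖⁻¹) = ‖z‖⁻¹ - ‖w‖⁻¹ by field_simp]
    module
  rw [e]
  refine (norm_add_le _ _).trans ?_
  rw [norm_smul, norm_smul, norm_mul, norm_mul, norm_inv, norm_inv, norm_norm, norm_norm]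
  have h1 : ‖‖w‖ - ‖z‖‖ ≤ ‖z - w‖ := by
    rw [norm_sub_rev z w]; exact abs_norm_sub_norm_le w z
  calc ‖z‖⁻¹ * ‖z - w‖ + ‖‖w‖ - ‖z‖‖ * (‖z‖⁻¹ * ‖w‖⁻¹) * ‖w‖
      = ‖z‖⁻¹ * ‖z - w‖ + ‖‖w‖ - ‖z‖‖ * ‖z‖⁻¹ := by field_simp
    _ ≤ ‖z‖⁻¹ * ‖z - w‖ + ‖z - w‖ * ‖z‖⁻¹ := by gcongr
    _ = _ := by ring

theorem lipschitzOnWith_homExt {f : Sph n → F} {K : ℝ≥0} (hf : LipschitzWith K f) {a : ℝ≥0}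
    (ha : 0 < a) : LipschitzOnWith (K * (2 / a)) (homExt f) {z | (a : ℝ) < ‖z‖} := by
  apply LipschitzOnWith.of_dist_le_mul
  intro z hz w hw
  have ha' : (0 : ℝ) < a := ha
  have hzn : (a : ℝ) < ‖z‖ := hz
  have hwn : (a : ℝ) < ‖w‖ := hw
  have hz0 : z ≠ 0 := norm_pos_iff.1 (ha'.trans hzn)
  have hw0 : w ≠ 0 := norm_pos_iff.1 (ha'.trans hwn)
  rw [homExt_of_ne f hz0, homExt_of_ne f hw0]
  refine (hf.dist_le_mul _ _).trans ?_
  rw [Subtype.dist_eq, dist_eq_norm, dist_eq_norm]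
  push_cast
  rw [mul_assoc]
  gcongr
  refine (norm_direction_sub_le hz0 hw0).trans ?_
  gcongr

theorem isOpen_lt_norm (a : ℝ) : IsOpen {z : Eu n | a < ‖z‖} :=
  isOpen_lt continuous_const continuous_norm

/-- Outside the ball of radius `1/2` the radial retraction is `4`-Lipschitz. Where the extension is
not differentiable, `fderiv` is zero, so the bound holds at every point. -/
theorem norm_fderiv_homExt_le {f : Sph n → F} {K : ℝ≥0} (hf : LipschitzWith K f) (x : Sph n) :
    ‖fderiv ℝ (homExt f) (x : Eu n)‖ ≤ 4 * K := by
  have h1 := lipschitzOnWith_homExt hf (a := 1 / 2) (by norm_num)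
  by_cases hd : DifferentiableAt ℝ (homExt f) (x : Eu n)
  · have := hd.hasFDerivAt.le_of_lipschitzOn ((isOpen_lt_norm (n := n) (1 / 2)).mem_nhds (by
      change (1 / 2 : ℝ) < ‖(x : Eu n)‖
      rw [norm_coe_sph]; norm_num)) (by simpa using h1)
    refine this.trans (le_of_eq ?_)
    push_cast
    ring
  · rw [fderiv_zero_of_not_differentiableAt hd, norm_zero]; positivity

/-- The extension is Lipschitz away from the origin, so Rademacher's theorem applies in the ambient
space. By homogeneity the bad set is, off the origin, a cone; its volume vanishes, hence so does the
measure of its trace on the sphere. -/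
theorem ae_differentiableAt_homExt [FiniteDimensional ℝ F] {f : Sph n → F} {K : ℝ≥0}
    (hf : LipschitzWith K f) (hn : 1 ≤ n) :
    ∀ᵐ (x : Sph n) ∂(sphMeasure n), DifferentiableAt ℝ (homExt f) (x : Eu n) := by
  have : CompleteSpace F := FiniteDimensional.complete ℝ F
  have h1 : ∀ m : ℕ, ∀ᵐ z : Eu n, ((m : ℝ) + 1)⁻¹ < ‖z‖ → DifferentiableAt ℝ (homExt f) z := by
    intro m
    have hm : (0 : ℝ≥0) < ((m : ℝ≥0) + 1)⁻¹ := by positivity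
    have h := (lipschitzOnWith_homExt hf hm).ae_differentiableWithinAt_of_mem
      (μ := (volume : Measure (Eu n)))
    filter_upwards [h] with z hz hzm
    have hmem : z ∈ {z : Eu n | (((((m : ℝ≥0) + 1)⁻¹ : ℝ≥0)) : ℝ) < ‖z‖} := by
      have h : ((((m : ℝ≥0) + 1)⁻¹ : ℝ≥0) : ℝ) < ‖z‖ := by
        push_cast
        exact hzm
      exact h
    exact (hz hmem).differentiableAt ((isOpen_lt_norm _).mem_nhds hmem)
  have h2 : ∀ᵐ z : Eu n, z ≠ 0 → DifferentiableAt ℝ (homExt f) z := by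
    filter_upwards [ae_all_iff.2 h1] with z hz hz0
    obtain ⟨m, hm⟩ := exists_nat_one_div_lt (norm_pos_iff.2 hz0)
    exact hz m (by rwa [one_div] at hm)
  obtain ⟨c, hc0, -, hc⟩ := exists_toSphere_eq_smul hn
  set Bd : Set (Sph n) := {x | ¬ DifferentiableAt ℝ (homExt f) (x : Eu n)} with hBd
  have hBm : MeasurableSet Bd :=
    (continuous_subtype_val.measurable (measurableSet_of_differentiableAt ℝ (homExt f))).compl
  have h3 : (volume : Measure (Eu n)).toSphere Bd = 0 := by
    rw [Measure.toSphere_apply' _ hBm]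
    refine mul_eq_zero_of_right _ (measure_mono_null ?_ h2)
    rintro _ ⟨t, ht, _, ⟨x, hx, rfl⟩, rfl⟩ hcon
    exact hx (differentiableAt_homExt_of_smul ht.1 (hcon (smul_coe_ne_zero ht.1 x)))
  rw [hc, Measure.smul_apply, smul_eq_mul] at h3
  exact (mul_eq_zero.1 h3).resolve_left hc0

/-! ### The divergence theorem on the sphere -/

theorem measurable_fderiv_homExt_apply [CompleteSpace F] [MeasurableSpace F] [BorelSpace F]
    [SecondCountableTopology F] (f : Sph n → F) {v : Sph n → Eu n} (hv : Continuous v) :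
    Measurable fun x : Sph n => fderiv ℝ (homExt f) (x : Eu n) (v x) := by
  have h1 : Measurable fun x : Sph n => fderiv ℝ (homExt f) (x : Eu n) :=
    (measurable_fderiv ℝ (homExt f)).comp continuous_subtype_val.measurable
  have h2 : Continuous fun q : (Eu n →L[ℝ] F) × Eu n => q.1 q.2 :=
    isBoundedBilinearMap_apply.continuous
  exact h2.measurable.comp (h1.prodMk hv.measurable)

theorem integrable_fderiv_homExt_apply {f : Sph n → ℝ} {K : ℝ≥0}
    (hf : LipschitzWith K f) {v : Sph n → Eu n} (hv : Continuous v) :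
    Integrable (fun x : Sph n => fderiv ℝ (homExt f) (x : Eu n) (v x)) (sphMeasure n) := by
  obtain ⟨C, hC⟩ := (isCompact_univ (X := Sph n)).exists_bound_of_continuousOn hv.continuousOn
  refine Integrable.of_bound (measurable_fderiv_homExt_apply f hv).aestronglyMeasurable
    (4 * K * C) (Eventually.of_forall fun x => ?_)
  refine (ContinuousLinearMap.le_opNorm _ _).trans ?_
  exact mul_le_mul (norm_fderiv_homExt_le hf x) (hC x (mem_univ x)) (norm_nonneg _) (by positivity)

/-- Difference quotients along a rotation have zero integral by invariance of the measure; the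
Lipschitz constant dominates them. -/
theorem integral_fderiv_homExt_gen {f : Sph n → ℝ} {K : ℝ≥0} (hf : LipschitzWith K f)
    (hn : 1 ≤ n) (P : Plane n) :
    ∫ x : Sph n, fderiv ℝ (homExt f) (x : Eu n) (P.gen x) ∂(sphMeasure n) = 0 := by
  set q : ℕ → Sph n → ℝ := fun m x => ((m : ℝ) + 1) * (f (P.sph ((m : ℝ) + 1)⁻¹ x) - f x)
  have hq0 : ∀ m, ∫ x : Sph n, q m x ∂(sphMeasure n) = 0 := by
    intro m
    have h1 := integrable_of_continuous hf.continuous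
    simp only [q]
    rw [integral_const_mul, integral_sub (P.integrable_comp_sph _ h1) h1, P.integral_comp_sph,
      sub_self, mul_zero]
  have hlim : Tendsto (fun m => ∫ x : Sph n, q m x ∂(sphMeasure n)) atTop
      (𝓝 (∫ x : Sph n, fderiv ℝ (homExt f) (x : Eu n) (P.gen x) ∂(sphMeasure n))) := by
    refine tendsto_integral_of_dominated_convergence (fun _ => (K : ℝ)) (fun m => ?_)
      (integrable_const _) (fun m => Eventually.of_forall fun x => ?_) ?_
    · exact (continuous_const.mul ((hf.continuous.comp (P.sph _).continuous).sub
        hf.continuous)).aestronglyMeasurable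
    · have hm : (0 : ℝ) < m + 1 := by positivity
      have h1 := hf.dist_le_mul (P.sph ((m : ℝ) + 1)⁻¹ x) x
      rw [Subtype.dist_eq, dist_eq_norm, dist_eq_norm, P.coe_sph] at h1
      have h2 := P.norm_rot_sub_le ((m : ℝ) + 1)⁻¹ (x : Eu n)
      rw [norm_coe_sph, mul_one, abs_of_pos (by positivity)] at h2
      simp only [q]
      rw [norm_mul, Real.norm_of_nonneg hm.le]
      calc ((m : ℝ) + 1) * ‖f (P.sph ((m : ℝ) + 1)⁻¹ x) - f x‖
          ≤ ((m : ℝ) + 1) * (K * ((m : ℝ) + 1)⁻¹) := by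
            gcongr
            exact h1.trans (by gcongr)
        _ = K := by field_simp
    · filter_upwards [ae_differentiableAt_homExt hf hn] with x hx
      have hd : HasDerivAt (fun t => homExt f (P.rot t x))
          (fderiv ℝ (homExt f) (x : Eu n) (P.gen x)) 0 := by
        have h1 := P.hasDerivAt_rot 0 (x : Eu n)
        have h2 : HasFDerivAt (homExt f) (fderiv ℝ (homExt f) (x : Eu n)) (P.rot 0 (x : Eu n)) := by
          rw [P.rot_zero]; exact hx.hasFDerivAt
        have h3 := h2.comp_hasDerivAt 0 h1
        rw [P.rot_zero] at h3
        exact h3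
      have hs := hd.tendsto_slope_zero
      have ht : Tendsto (fun m : ℕ => ((m : ℝ) + 1)⁻¹) atTop (𝓝[≠] 0) := by
        refine tendsto_nhdsWithin_iff.2 ⟨?_, Eventually.of_forall fun m => ?_⟩
        · exact tendsto_inv_atTop_zero.comp
            (tendsto_atTop_add_const_right _ _ tendsto_natCast_atTop_atTop)
        · have : ((m : ℝ) + 1)⁻¹ ≠ 0 := by positivity
          exact this
      refine (hs.comp ht).congr fun m => ?_
      simp only [Function.comp_apply, zero_add, inv_inv, smul_eq_mul, q, P.rot_zero]
      rw [homExt_coe, ← P.coe_sph, homExt_coe]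
  simp only [hq0] at hlim
  exact (tendsto_nhds_unique tendsto_const_nhds hlim).symm

theorem trace_eq_sum (T : Eu n →L[ℝ] Eu n) : LinearMap.trace ℝ (Eu n) (T : Eu n →ₗ[ℝ] Eu n) =
    ∑ i, T (EuclideanSpace.single i 1) i := by
  rw [LinearMap.trace_eq_sum_inner _ (EuclideanSpace.basisFun (Fin n) ℝ)]
  refine Finset.sum_congr rfl fun i _ => ?_
  simp [EuclideanSpace.inner_single_left]

theorem lipschitz_mul_coord {X : Sph n → Eu n} {K : ℝ≥0} (hX : LipschitzWith K X) (i j : Fin n) :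
    ∃ K' : ℝ≥0, LipschitzWith K' fun x : Sph n => (x : Eu n) i * X x j := by
  obtain ⟨C, hC⟩ := (isCompact_univ (X := Sph n)).exists_bound_of_continuousOn
    hX.continuous.continuousOn
  refine ⟨K + C.toNNReal, LipschitzWith.of_dist_le_mul fun x y => ?_⟩
  have hd := hX.dist_le_mul x y
  have hx : |(x : Eu n) i| ≤ 1 := by
    have := PiLp.norm_apply_le (x : Eu n) i
    rwa [norm_coe_sph] at this
  have hy : |X y j| ≤ C := (PiLp.norm_apply_le (X y) j).trans (hC y (mem_univ y))
  have h1 : |X x j - X y j| ≤ K * dist x y := by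
    have := PiLp.norm_apply_le (X x - X y) j
    rw [dist_eq_norm (X x)] at hd
    exact this.trans hd
  have h2 : |(x : Eu n) i - (y : Eu n) i| ≤ dist x y := by
    have := PiLp.norm_apply_le ((x : Eu n) - (y : Eu n)) i
    rwa [← dist_eq_norm, ← Subtype.dist_eq] at this
  rw [Real.dist_eq, show (x : Eu n) i * X x j - (y : Eu n) i * X y j =
    (x : Eu n) i * (X x j - X y j) + ((x : Eu n) i - (y : Eu n) i) * X y j by ring]
  refine (abs_add_le _ _).trans ?_
  rw [abs_mul, abs_mul]
  push_cast
  have hC0 : 0 ≤ C := (abs_nonneg _).trans hy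
  rw [Real.coe_toNNReal C hC0, add_mul, mul_comm C]
  have hKd : 0 ≤ K * dist x y := by positivity
  refine add_le_add ?_ (mul_le_mul h2 hy (abs_nonneg _) dist_nonneg)
  calc _ ≤ 1 * (K * dist x y) := mul_le_mul hx h1 (abs_nonneg _) zero_le_one
    _ = _ := one_mul _

/-- The divergence theorem for Lipschitz tangential fields on the sphere. -/
theorem integral_trace_fderiv_homExt {X : Sph n → Eu n} {K : ℝ≥0} (hX : LipschitzWith K X)
    (hn : 1 ≤ n) (htan : ∀ x : Sph n, inner ℝ (x : Eu n) (X x) = 0) :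
    ∫ x : Sph n, LinearMap.trace ℝ (Eu n) (fderiv ℝ (homExt X) (x : Eu n) : Eu n →ₗ[ℝ] Eu n)
      ∂(sphMeasure n) = 0 := by
  classical
  choose K' hK' using lipschitz_mul_coord hX
  set w : Fin n → Fin n → Sph n → Eu n := fun i j x =>
    if h : i ≠ j then (coordPlane i j h).gen x else 0 with hw
  have hwc : ∀ i j, Continuous (w i j) := by
    intro i j
    by_cases hij : i ≠ j
    · simp only [hw, dif_pos hij]; exact continuous_gen_coe _
    · simp only [hw, dif_neg hij]; exact continuous_const
  have hweq : ∀ i j x, w i j x = (x : Eu n) i • EuclideanSpace.single j (1 : ℝ) -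
      (x : Eu n) j • EuclideanSpace.single i (1 : ℝ) := by
    intro i j x
    by_cases hij : i ≠ j
    · simp only [hw, dif_pos hij]
      rw [Plane.gen_apply]
      simp [coordPlane, EuclideanSpace.inner_single_left]
    · simp only [hw, dif_neg hij]
      rw [not_ne_iff.1 hij, sub_self]
  -- The divergence of a tangential field is the sum over `i, j` of the derivative of `x i X j`
  -- along the field `x i e j - x j e i`. This uses `|x| = 1`, `⟨x, X⟩ = 0` and `B x = 0`, and each
  -- summand integrates to zero.
  have hae : ∀ᵐ (x : Sph n) ∂(sphMeasure n),
      LinearMap.trace ℝ (Eu n) (fderiv ℝ (homExt X) (x : Eu n) : Eu n →ₗ[ℝ] Eu n) =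
      ∑ i, ∑ j, fderiv ℝ (homExt fun x : Sph n => (x : Eu n) i * X x j) (x : Eu n) (w i j x) := by
    filter_upwards [ae_differentiableAt_homExt hX hn] with x hx
    set B := fderiv ℝ (homExt X) (x : Eu n) with hB
    have hBx : B x = 0 := fderiv_homExt_apply_self hx
    have hterm : ∀ i j (v : Eu n),
        fderiv ℝ (homExt fun x : Sph n => (x : Eu n) i * X x j) (x : Eu n) v =
        X x j * tangentProj (x : Eu n) v i + (x : Eu n) i * B v j := by
      intro i j v
      have hdir := hasFDerivAt_inv_norm_smul (n := n) one_pos x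
      rw [one_smul, inv_one, one_smul] at hdir
      have hpr : ∀ (k : Fin n) (z : Eu n),
          HasFDerivAt (fun z : Eu n => z k) (EuclideanSpace.proj k : Eu n →L[ℝ] ℝ) z :=
        fun k z => ContinuousLinearMap.hasFDerivAt (EuclideanSpace.proj k : Eu n →L[ℝ] ℝ)
      have h1 := (hpr i _).comp (x : Eu n) hdir
      have h2 := (hpr j _).comp (x : Eu n)
        hx.hasFDerivAt
      have h3 := h1.mul h2
      have hev : homExt (fun x : Sph n => (x : Eu n) i * X x j) =ᶠ[𝓝 (x : Eu n)]
          ((fun z : Eu n => z i) ∘ fun z : Eu n => ‖z‖⁻¹ • z) *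
            ((fun z : Eu n => z j) ∘ homExt X) := by
        filter_upwards [isOpen_ne.mem_nhds (coe_sph_ne_zero x)] with z hz
        rw [homExt_of_ne _ hz]
        simp only [Pi.mul_apply, Function.comp_apply, homExt_of_ne X hz]
        rfl
      have h4 := h3.congr_of_eventuallyEq hev
      rw [h4.fderiv]
      have e1 : homExt X (x : Eu n) = X x := homExt_coe X x
      simp [e1]
      ring
    have hP : ∀ i j, tangentProj (x : Eu n) ((x : Eu n) i • EuclideanSpace.single j (1 : ℝ) -
      (x : Eu n) j • EuclideanSpace.single i (1 : ℝ)) i =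
        (x : Eu n) i * (if i = j then 1 else 0) - (x : Eu n) j := by
      intro i j
      rw [tangentProj_apply, inner_sub_right, real_inner_smul_right, real_inner_smul_right]
      have e : inner ℝ (x : Eu n) (EuclideanSpace.single j (1 : ℝ)) = (x : Eu n) j := by
        simp [EuclideanSpace.inner_single_right]
      have e' : inner ℝ (x : Eu n) (EuclideanSpace.single i (1 : ℝ)) = (x : Eu n) i := by
        simp [EuclideanSpace.inner_single_right]
      rw [e, e', mul_comm ((x : Eu n) i), sub_self, zero_smul, sub_zero]
      by_cases hij : i = j <;> simp [hij]
    have hxX : ∑ j, (x : Eu n) j * X x j = 0 := by rw [← inner_eq_sum, htan]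
    have hBsum : ∀ j, ∑ i, (x : Eu n) i * B (EuclideanSpace.single i 1) j = 0 := by
      intro j
      have h := congrArg (fun z : Eu n => z j) hBx
      rw [clm_apply_eq_sum B x] at h
      simpa using h
    simp only [hterm, hweq, hP]
    simp only [map_sub, map_smul, PiLp.sub_apply, PiLp.smul_apply, smul_eq_mul]
    rw [trace_eq_sum]
    have e1 : ∀ i j, X x j * ((x : Eu n) i * (if i = j then (1 : ℝ) else 0) - (x : Eu n) j) +
        (x : Eu n) i * ((x : Eu n) i * B (EuclideanSpace.single j 1) j -
          (x : Eu n) j * B (EuclideanSpace.single i 1) j) =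
        (if i = j then (x : Eu n) j * X x j else 0) - (x : Eu n) j * X x j +
        ((x : Eu n) i * (x : Eu n) i) * B (EuclideanSpace.single j 1) j -
        (x : Eu n) j * ((x : Eu n) i * B (EuclideanSpace.single i 1) j) := by
      intro i j
      split_ifs with h
      · rw [h]; ring
      · ring
    simp only [e1, Finset.sum_add_distrib, Finset.sum_sub_distrib, hxX]
    have e2 : ∑ i, ∑ j, (if i = j then (x : Eu n) j * X x j else 0) = 0 := by
      simp [hxX]
    have e3 : ∑ i, ∑ j, (x : Eu n) j * ((x : Eu n) i * B (EuclideanSpace.single i 1) j) = 0 := by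
      rw [Finset.sum_comm]
      refine Finset.sum_eq_zero fun j _ => ?_
      rw [← Finset.mul_sum, hBsum, mul_zero]
    have e4 : ∑ i, ∑ j, ((x : Eu n) i * (x : Eu n) i) * B (EuclideanSpace.single j 1) j =
        ∑ j, B (EuclideanSpace.single j 1) j := by
      simp_rw [← Finset.mul_sum]
      rw [← Finset.sum_mul, sum_sq_sph, one_mul]
    rw [e2, e3, e4]
    simp
  rw [integral_congr_ae hae]
  have hint : ∀ i j, Integrable (fun x : Sph n =>
      fderiv ℝ (homExt fun x : Sph n => (x : Eu n) i * X x j) (x : Eu n) (w i j x))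
      (sphMeasure n) := fun i j => integrable_fderiv_homExt_apply (hK' i j) (hwc i j)
  rw [integral_finsetSum _ fun i _ => integrable_finsetSum _ fun j _ => hint i j]
  refine Finset.sum_eq_zero fun i _ => ?_
  rw [integral_finsetSum _ fun j _ => hint i j]
  refine Finset.sum_eq_zero fun j _ => ?_
  by_cases hij : i ≠ j
  · simp only [hw, dif_pos hij]
    exact integral_fderiv_homExt_gen (hK' i j) hn _
  · simp only [hw, dif_neg hij, map_zero, integral_zero]

end

section

open scoped NNReal ENNReal

variable {n : ℕ}

/-! ### Normal and mean curvature of radial graphs -/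

/-- Away from the origin, `E` is the region below the radial graph `r (1 + u)`. -/
def IsRadialRegion (E : Set (Eu n)) (r : ℝ) (u : Sph n → ℝ) : Prop :=
  ∀ (x : Sph n) (t : ℝ), 0 < t → (t • (x : Eu n) ∈ E ↔ t < r * (1 + u x))

/-- The logarithmic gradient `∇u / (1 + u)`. -/
def slope (u : Sph n → ℝ) (g : Sph n → Eu n) (x : Sph n) : Eu n := (1 + u x)⁻¹ • g x

/-- The normal of the radial graph of `r (1 + u)` over `x`. -/
def graphNormal (u : Sph n → ℝ) (g : Sph n → Eu n) (x : Sph n) : Eu n :=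
  (Real.sqrt (1 + ‖slope u g x‖ ^ 2))⁻¹ • ((x : Eu n) - slope u g x)

/-- The parametrization of the radial graph. -/
def graphMap (r : ℝ) (u : Sph n → ℝ) (x : Sph n) : Eu n := (r * (1 + u x)) • (x : Eu n)

/-- Points `x + t (ν - ν')` with small `t > 0` would lie outside `E` according to `ν` and inside
according to `ν'`. -/
theorem IsExteriorNormal.unique {E : Set (Eu n)} {x ν ν' : Eu n} (h : IsExteriorNormal E x ν)
    (h' : IsExteriorNormal E x ν') : ν = ν' := by
  by_contra hne
  have hv : 0 < ‖ν - ν'‖ := norm_pos_iff.2 (sub_ne_zero.2 hne)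
  have hsq : 0 < ‖ν - ν'‖ ^ 2 := by positivity
  have e1 : inner ℝ (ν - ν') ν = ‖ν - ν'‖ ^ 2 / 2 := by
    rw [norm_sub_sq_real, inner_sub_left, real_inner_self_eq_norm_sq, h.1, h'.1,
      real_inner_comm ν ν']
    ring
  have e2 : inner ℝ (ν - ν') ν' = -(‖ν - ν'‖ ^ 2 / 2) := by
    rw [norm_sub_sq_real, inner_sub_left, real_inner_self_eq_norm_sq, h.1, h'.1]
    ring
  have hδ : 0 < ‖ν - ν'‖ / 4 := by positivity
  have hc : Tendsto (fun t : ℝ => x + t • (ν - ν')) (𝓝[>] 0) (𝓝 x) := by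
    have : Continuous fun t : ℝ => x + t • (ν - ν') := by fun_prop
    have h0 := (this.tendsto 0).mono_left (nhdsWithin_le_nhds (s := Ioi 0))
    simpa using h0
  have h1 := hc.eventually (h.2 _ hδ)
  have h2 := hc.eventually (h'.2 _ hδ)
  obtain ⟨t, ⟨ht1, ht2⟩, ht0⟩ := ((h1.and h2).and self_mem_nhdsWithin).exists
  have ht0 : 0 < t := ht0
  have e3 : x + t • (ν - ν') - x = t • (ν - ν') := by abel
  rw [e3, norm_smul, Real.norm_of_nonneg ht0.le, real_inner_smul_left] at ht1 ht2
  rw [e1] at ht1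
  rw [e2] at ht2
  have hlt : ‖ν - ν'‖ / 4 * (t * ‖ν - ν'‖) < t * (‖ν - ν'‖ ^ 2 / 2) := by
    nlinarith [mul_pos ht0 hsq]
  exact ht1.2 hlt (ht2.1 (by linarith))

theorem IsExteriorNormal.exteriorNormal_eq {E : Set (Eu n)} {x ν : Eu n}
    (h : IsExteriorNormal E x ν) : exteriorNormal E x = ν := by
  have hex : ∃ ν, IsExteriorNormal E x ν := ⟨ν, h⟩
  rw [exteriorNormal, dif_pos hex]
  exact hex.choose_spec.unique h

theorem isExteriorNormal_of_hasFDerivAt {E : Set (Eu n)} {Φ : Eu n → ℝ} {z₀ ν : Eu n} {J : ℝ}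
    (hJ : 0 < J) (hν : ‖ν‖ = 1) (h0 : Φ z₀ = 0) (hΦ : HasFDerivAt Φ (J • innerSL ℝ ν) z₀)
    (hE : ∀ᶠ z in 𝓝 z₀, z ∈ E ↔ Φ z < 0) : IsExteriorNormal E z₀ ν := by
  refine ⟨hν, fun δ hδ => ?_⟩
  have h1 := hΦ.isLittleO.bound (mul_pos hJ hδ)
  filter_upwards [h1, hE] with z hz hzE
  rw [h0, sub_zero, _root_.smul_apply, innerSL_apply_apply, smul_eq_mul, real_inner_comm,
    Real.norm_eq_abs, abs_le] at hz
  rw [hzE]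
  constructor
  · intro h
    have := mul_lt_mul_of_pos_left h hJ
    nlinarith
  · intro h
    have := mul_lt_mul_of_pos_left h hJ
    nlinarith

theorem IsC11.hasFDerivWithinAt {u : Sph n → ℝ} {g : Sph n → Eu n} {M L : ℝ} (h : IsC11 u g M L)
    (x : Sph n) :
    HasFDerivWithinAt (homExt u) (innerSL ℝ (g x)) (sphere (0 : Eu n) 1) (x : Eu n) := by
  rw [hasFDerivWithinAt_iff_isLittleO]
  have h1 : (fun y => homExt u y - homExt u (x : Eu n) - innerSL ℝ (g x) (y - (x : Eu n)))
      =O[𝓝[sphere (0 : Eu n) 1] (x : Eu n)] fun y => ‖y - (x : Eu n)‖ ^ 2 := by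
    refine Asymptotics.IsBigO.of_bound L ?_
    filter_upwards [self_mem_nhdsWithin] with y hy
    have := h.taylor x ⟨y, hy⟩
    rw [homExt_coe u x, show homExt u y = u ⟨y, hy⟩ from homExt_coe u ⟨y, hy⟩, norm_pow, norm_norm]
    exact this
  refine h1.trans_isLittleO ?_
  have h2 : (fun y : Eu n => ‖y - (x : Eu n)‖ ^ 2) =o[𝓝 (x : Eu n)] fun y => y - (x : Eu n) :=
    Asymptotics.isLittleO_pow_sub_sub (x : Eu n) one_lt_two
  exact h2.mono nhdsWithin_le_nhds

theorem IsC11.hasFDerivAt_homExt {u : Sph n → ℝ} {g : Sph n → Eu n} {M L : ℝ} (h : IsC11 u g M L)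
    (x : Sph n) {t : ℝ} (ht : 0 < t) :
    HasFDerivAt (homExt u) (t⁻¹ • innerSL ℝ (g x)) (t • (x : Eu n)) := by
  refine (GaussCurv.hasFDerivAt_homExt (h.hasFDerivWithinAt x) ht).congr_fderiv ?_
  congr 1
  ext1 z
  rw [ContinuousLinearMap.comp_apply, tangentProj_apply, map_sub, map_smul, innerSL_apply_apply,
    innerSL_apply_apply, real_inner_comm (x : Eu n) (g x), h.tangent, smul_zero, sub_zero]

theorem norm_graphNormal {u : Sph n → ℝ} {g : Sph n → Eu n} {M L : ℝ} (h : IsC11 u g M L)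
    (x : Sph n) : ‖graphNormal u g x‖ = 1 := by
  have h1 : ‖(x : Eu n) - slope u g x‖ ^ 2 = 1 + ‖slope u g x‖ ^ 2 := by
    rw [norm_sub_sq_real, norm_coe_sph, slope, real_inner_smul_right, h.tangent]
    ring
  have h2 : ‖(x : Eu n) - slope u g x‖ = Real.sqrt (1 + ‖slope u g x‖ ^ 2) := by
    rw [← h1, Real.sqrt_sq (norm_nonneg _)]
  have h3 : 0 < Real.sqrt (1 + ‖slope u g x‖ ^ 2) := Real.sqrt_pos.2 (by positivity)
  rw [graphNormal, norm_smul, h2, norm_inv, Real.norm_of_nonneg h3.le, inv_mul_cancel₀ h3.ne']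

section

variable {E : Set (Eu n)} {r : ℝ} {u : Sph n → ℝ} {g : Sph n → Eu n} {M L : ℝ}

theorem IsC11.one_add_pos (h : IsC11 u g M L) (hM : M ≤ 1 / 2) (x : Sph n) : 1 / 2 ≤ 1 + u x := by
  have := (_root_.abs_le.1 (h.abs_le x)).1
  linarith

theorem IsC11.radius_pos (h : IsC11 u g M L) (hM : M ≤ 1 / 2) (hr : 0 < r) (x : Sph n) :
    0 < r * (1 + u x) :=
  mul_pos hr (by linarith [h.one_add_pos hM x])

theorem IsC11.dist_le (h : IsC11 u g M L) (hL : 0 ≤ L) (x y : Sph n) :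
    |u y - u x| ≤ (M + 2 * L) * ‖(y : Eu n) - x‖ := by
  have h1 := h.taylor x y
  have h2 : |inner ℝ (g x) ((y : Eu n) - x)| ≤ M * ‖(y : Eu n) - x‖ :=
    (abs_real_inner_le_norm _ _).trans (by gcongr; exact h.norm_le x)
  have h3 : ‖(y : Eu n) - x‖ ≤ 2 := by
    refine (norm_sub_le _ _).trans ?_
    rw [norm_coe_sph, norm_coe_sph]; norm_num
  have h4 : L * ‖(y : Eu n) - x‖ ^ 2 ≤ 2 * L * ‖(y : Eu n) - x‖ := by
    have := mul_le_mul_of_nonneg_left h3 (mul_nonneg hL (norm_nonneg ((y : Eu n) - x)))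
    nlinarith
  calc |u y - u x| = |(u y - u x - inner ℝ (g x) ((y : Eu n) - x)) +
        inner ℝ (g x) ((y : Eu n) - x)| := by ring_nf
    _ ≤ _ := abs_add_le _ _
    _ ≤ _ := by linarith

theorem IsC11.continuous (h : IsC11 u g M L) : Continuous u := by
  rw [continuous_iff_continuousAt]
  intro x
  have h1 := (h.hasFDerivAt_homExt x one_pos).continuousAt
  rw [one_smul] at h1
  have h2 : ContinuousAt (homExt u ∘ ((↑) : Sph n → Eu n)) x :=
    ContinuousAt.comp h1 continuous_subtype_val.continuousAt
  exact h2.congr (Eventually.of_forall fun y => homExt_coe u y)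

theorem IsC11.continuous_grad (h : IsC11 u g M L) : Continuous g := by
  by_cases hL : 0 ≤ L
  · refine (LipschitzWith.of_dist_le_mul (K := ⟨L, hL⟩) fun x y => ?_).continuous
    rw [dist_eq_norm, Subtype.dist_eq, dist_eq_norm]
    exact h.lipschitz y x
  · refine continuous_of_const fun x y => ?_
    have h1 := h.lipschitz x y
    have h2 := mul_nonpos_of_nonpos_of_nonneg (le_of_not_ge hL) (norm_nonneg ((y : Eu n) - x))
    have h3 : ‖g y - g x‖ = 0 := le_antisymm (h1.trans h2) (norm_nonneg _)
    exact (sub_eq_zero.1 (norm_eq_zero.1 h3)).symm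

theorem slope_tangent (h : IsC11 u g M L) (x : Sph n) : inner ℝ (x : Eu n) (slope u g x) = 0 := by
  rw [slope, real_inner_smul_right, h.tangent, mul_zero]

theorem norm_slope_le (h : IsC11 u g M L) (hM : M ≤ 1 / 2) (x : Sph n) :
    ‖slope u g x‖ ≤ 2 * ‖g x‖ := by
  have h1 := h.one_add_pos hM x
  rw [slope, norm_smul, norm_inv, Real.norm_of_nonneg (by linarith)]
  gcongr
  rw [inv_le_comm₀ (by linarith) two_pos]
  linarith

theorem slope_lipschitz (h : IsC11 u g M L) (hM : M ≤ 1 / 2) (hL : 0 ≤ L) :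
    LipschitzWith (2 * M + 6 * L).toNNReal (slope u g) := by
  refine LipschitzWith.of_dist_le_mul fun x y => ?_
  have hM0 : 0 ≤ M := (abs_nonneg _).trans (h.abs_le x)
  rw [Real.coe_toNNReal _ (by positivity), dist_eq_norm, Subtype.dist_eq, dist_eq_norm]
  have hx := h.one_add_pos hM x
  have hy := h.one_add_pos hM y
  have ix : (1 + u x)⁻¹ ≤ 2 := by
    rw [inv_le_comm₀ (by linarith) two_pos]; linarith
  have iy : (1 + u y)⁻¹ ≤ 2 := by
    rw [inv_le_comm₀ (by linarith) two_pos]; linarith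
  have ix0 : 0 ≤ (1 + u x)⁻¹ := inv_nonneg.2 (by linarith)
  have iy0 : 0 ≤ (1 + u y)⁻¹ := inv_nonneg.2 (by linarith)
  have e : slope u g x - slope u g y = (1 + u x)⁻¹ • (g x - g y) +
      ((1 + u x)⁻¹ * (1 + u y)⁻¹ * (u y - u x)) • g y := by
    have hx' : 1 + u x ≠ 0 := by linarith
    have hy' : 1 + u y ≠ 0 := by linarith
    rw [slope, slope, show (1 + u x)⁻¹ * (1 + u y)⁻¹ * (u y - u x) = (1 + u x)⁻¹ - (1 + u y)⁻¹ by
      field_simp; ring]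
    module
  rw [e]
  have hd := h.dist_le hL x y
  have hg := h.lipschitz y x
  rw [norm_sub_rev (y : Eu n) x] at hd
  have hn0 := norm_nonneg ((x : Eu n) - y)
  refine (norm_add_le _ _).trans ?_
  rw [norm_smul, norm_smul, norm_mul, norm_mul, Real.norm_of_nonneg ix0, Real.norm_of_nonneg iy0,
    Real.norm_eq_abs]
  calc (1 + u x)⁻¹ * ‖g x - g y‖ + (1 + u x)⁻¹ * (1 + u y)⁻¹ * |u y - u x| * ‖g y‖
      ≤ 2 * (L * ‖(x : Eu n) - y‖) + 2 * 2 * ((M + 2 * L) * ‖(x : Eu n) - y‖) * (1 / 2) := by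
        gcongr
        exact (h.norm_le y).trans hM
    _ = _ := by ring

theorem IsRadialRegion.mem_iff (hE : IsRadialRegion E r u) {z : Eu n} (hz : z ≠ 0) :
    z ∈ E ↔ ‖z‖ - r * (1 + homExt u z) < 0 := by
  have := hE (direction z hz) ‖z‖ (norm_pos_iff.2 hz)
  rw [norm_smul_direction] at this
  rw [this, homExt_of_ne u hz, sub_neg]

theorem norm_graphMap (h : IsC11 u g M L) (hM : M ≤ 1 / 2) (hr : 0 < r) (x : Sph n) :
    ‖graphMap r u x‖ = r * (1 + u x) := by
  rw [graphMap, norm_smul, norm_coe_sph, mul_one, Real.norm_of_nonneg (h.radius_pos hM hr x).le]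

theorem isExteriorNormal_graphMap (h : IsC11 u g M L) (hM : M ≤ 1 / 2) (hr : 0 < r)
    (hE : IsRadialRegion E r u) (x : Sph n) :
    IsExteriorNormal E (graphMap r u x) (graphNormal u g x) := by
  have hρ := h.radius_pos hM hr x
  have hu1 : 1 + u x ≠ 0 := by linarith [h.one_add_pos hM x]
  have hJ : 0 < Real.sqrt (1 + ‖slope u g x‖ ^ 2) := Real.sqrt_pos.2 (by positivity)
  refine isExteriorNormal_of_hasFDerivAt (Φ := fun z => ‖z‖ - r * (1 + homExt u z)) hJ
    (norm_graphNormal h x) ?_ ?_ ?_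
  · rw [norm_graphMap h hM hr, graphMap, homExt_smul u hρ, sub_self]
  · have h1 := (hasFDerivAt_norm_smul hρ x).sub
      (((h.hasFDerivAt_homExt x hρ).const_add 1).const_mul r)
    refine h1.congr_fderiv ?_
    ext1 z
    simp only [_root_.sub_apply, _root_.smul_apply, innerSL_apply_apply, smul_eq_mul, graphNormal,
      slope, real_inner_smul_left, inner_sub_left]
    field_simp
  · filter_upwards [isOpen_ne.mem_nhds (smul_coe_ne_zero hρ x)] with z hz
    exact hE.mem_iff hz

theorem exteriorNormal_graphMap (h : IsC11 u g M L) (hM : M ≤ 1 / 2) (hr : 0 < r)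
    (hE : IsRadialRegion E r u) (x : Sph n) :
    exteriorNormal E (graphMap r u x) = graphNormal u g x :=
  (isExteriorNormal_graphMap h hM hr hE x).exteriorNormal_eq

/-- The origin has to be excluded: a radial region is unconstrained there, and for `radialSet`,
whose parameter `t` is positive, the origin is an additional frontier point. -/
theorem mem_frontier_iff (h : IsC11 u g M L) (hM : M ≤ 1 / 2) (hr : 0 < r)
    (hE : IsRadialRegion E r u) {z : Eu n} (hz : z ≠ 0) :
    z ∈ frontier E ↔ z = graphMap r u (direction z hz) := by
  set x := direction z hz with hx
  have hzx : ‖z‖ • (x : Eu n) = z := norm_smul_direction hz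
  have hzn : 0 < ‖z‖ := norm_pos_iff.2 hz
  have hcont : ContinuousAt (fun w : Eu n => ‖w‖ - r * (1 + homExt u w)) z :=
    continuous_norm.continuousAt.sub
      (continuousAt_const.mul (continuousAt_const.add (continuousAt_homExt h.continuous hz)))
  have hne : ∀ᶠ w in 𝓝 z, w ≠ 0 := isOpen_ne.mem_nhds hz
  have heq : z = graphMap r u x ↔ ‖z‖ = r * (1 + u x) := by
    constructor
    · intro hz'
      exact (congrArg norm hz').trans (norm_graphMap h hM hr x)
    · intro hz'
      rw [graphMap, ← hz', hzx]
  rw [heq, frontier_eq_closure_inter_closure]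
  constructor
  · rintro ⟨h1, h2⟩
    rcases lt_trichotomy ‖z‖ (r * (1 + u x)) with h3 | h3 | h3
    · exfalso
      rw [closure_compl] at h2
      refine h2 (mem_interior_iff_mem_nhds.2 ?_)
      have h4 : ∀ᶠ w in 𝓝 z, ‖w‖ - r * (1 + homExt u w) < 0 := by
        refine hcont.eventually_lt_const ?_
        simp only [homExt_of_ne u hz]; linarith
      filter_upwards [h4, hne] with w hw hw0
      exact (hE.mem_iff hw0).2 hw
    · exact h3
    · exfalso
      have h4 : ∀ᶠ w in 𝓝 z, 0 < ‖w‖ - r * (1 + homExt u w) := by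
        refine hcont.eventually_const_lt ?_
        simp only [homExt_of_ne u hz]; linarith
      obtain ⟨w, hw3, hw1, hw2⟩ := ((mem_closure_iff_frequently.1 h1).and_eventually
        (h4.and hne)).exists
      have := (hE.mem_iff hw2).1 hw3
      linarith
  · intro h3
    have hc : Tendsto (fun t : ℝ => t • (x : Eu n)) (𝓝 ‖z‖) (𝓝 z) := by
      have : Continuous fun t : ℝ => t • (x : Eu n) := by fun_prop
      have h4 := this.tendsto ‖z‖
      rwa [hzx] at h4
    constructor
    · refine mem_closure_of_tendsto (hc.mono_left (nhdsWithin_le_nhds (s := Iio ‖z‖))) ?_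
      filter_upwards [self_mem_nhdsWithin, nhdsWithin_le_nhds (Ioi_mem_nhds hzn)] with t ht ht0
      exact (hE x t ht0).2 (h3 ▸ ht)
    · refine mem_closure_of_tendsto (hc.mono_left (nhdsWithin_le_nhds (s := Ioi ‖z‖))) ?_
      filter_upwards [self_mem_nhdsWithin, nhdsWithin_le_nhds (Ioi_mem_nhds hzn)] with t ht ht0
      intro hmem
      have h5 := (hE x t ht0).1 hmem
      have h6 : ‖z‖ < t := ht
      linarith

theorem graphMap_mem_frontier (h : IsC11 u g M L) (hM : M ≤ 1 / 2) (hr : 0 < r)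
    (hE : IsRadialRegion E r u) (x : Sph n) : graphMap r u x ∈ frontier E := by
  have hρ := h.radius_pos hM hr x
  have hne : graphMap r u x ≠ 0 := smul_coe_ne_zero hρ x
  rw [mem_frontier_iff h hM hr hE hne]
  congr 1
  exact (direction_smul hρ x hne).symm

theorem exteriorNormal_eq_homExt (h : IsC11 u g M L) (hM : M ≤ 1 / 2) (hr : 0 < r)
    (hE : IsRadialRegion E r u) {z : Eu n} (hz : z ≠ 0) (hzE : z ∈ frontier E) :
    exteriorNormal E z = homExt (graphNormal u g) z := by
  have h1 := (mem_frontier_iff h hM hr hE hz).1 hzE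
  rw [homExt_of_ne _ hz]
  conv_lhs => rw [h1]
  exact exteriorNormal_graphMap h hM hr hE _

theorem homExt_graphNormal_apply (u : Sph n → ℝ) (g : Sph n → Eu n) {z : Eu n} (hz : z ≠ 0) :
    homExt (graphNormal u g) z = (Real.sqrt (1 + ‖homExt (slope u g) z‖ ^ 2))⁻¹ •
      (‖z‖⁻¹ • z - homExt (slope u g) z) := by
  rw [homExt_of_ne _ hz, homExt_of_ne _ hz]
  rfl

theorem hasFDerivAt_homExt_graphNormal {x : Sph n} {B : Eu n →L[ℝ] Eu n}
    (hB : HasFDerivAt (homExt (slope u g)) B (x : Eu n)) {J : ℝ}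
    (hJ : J = Real.sqrt (1 + ‖slope u g x‖ ^ 2)) :
    HasFDerivAt (homExt (graphNormal u g)) (J⁻¹ • (tangentProj (x : Eu n) - B) +
      (-(J⁻¹ ^ 3) • (innerSL ℝ (slope u g x) ∘L B)).smulRight ((x : Eu n) - slope u g x))
      (x : Eu n) := by
  have hJ0 : 0 < J := by rw [hJ]; exact Real.sqrt_pos.2 (by positivity)
  have hdir := hasFDerivAt_inv_norm_smul (n := n) one_pos x
  rw [one_smul, inv_one, one_smul] at hdir
  have e0 : homExt (slope u g) (x : Eu n) = slope u g x := homExt_coe _ x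
  have h1 := (hB.norm_sq.const_add 1).sqrt (by positivity)
  have hs : Real.sqrt (1 + ‖homExt (slope u g) (x : Eu n)‖ ^ 2) = J := by rw [e0, hJ]
  have h2 := (hasDerivAt_inv (x := Real.sqrt (1 + ‖homExt (slope u g) (x : Eu n)‖ ^ 2))
    (by rw [hs]; exact hJ0.ne')).comp_hasFDerivAt (x : Eu n) h1
  have h3 := h2.smul (hdir.sub hB)
  have h4 := h3.congr_of_eventuallyEq (f₁ := homExt (graphNormal u g)) (by
    filter_upwards [isOpen_ne.mem_nhds (coe_sph_ne_zero x)] with z hz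
    exact homExt_graphNormal_apply u g hz)
  refine h4.congr_fderiv ?_
  ext1 v
  have hn1 : ‖(x : Eu n)‖⁻¹ • (x : Eu n) = x := by rw [norm_coe_sph, inv_one, one_smul]
  simp only [_root_.add_apply, _root_.smul_apply, _root_.sub_apply,
    ContinuousLinearMap.smulRight_apply, ContinuousLinearMap.comp_apply, Function.comp_apply,
    innerSL_apply_apply, smul_eq_mul, e0, ← hJ, hn1, Pi.sub_apply]
  congr 2
  rw [nsmul_eq_mul]
  push_cast
  field_simp

theorem trace_graphNormal {x : Sph n} (B : Eu n →L[ℝ] Eu n) (p : Eu n) (hBx : B x = 0) (j k : ℝ) :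
    LinearMap.trace ℝ (Eu n) ((j • (tangentProj (x : Eu n) - B) +
      (-k • (innerSL ℝ p ∘L B)).smulRight ((x : Eu n) - p) : Eu n →L[ℝ] Eu n) :
        Eu n →ₗ[ℝ] Eu n) =
      j * ((n - 1 : ℝ) - LinearMap.trace ℝ (Eu n) (B : Eu n →ₗ[ℝ] Eu n)) +
        k * inner ℝ p (B p) := by
  have e : ((j • (tangentProj (x : Eu n) - B) +
      (-k • (innerSL ℝ p ∘L B)).smulRight ((x : Eu n) - p) : Eu n →L[ℝ] Eu n) :
        Eu n →ₗ[ℝ] Eu n) =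
      j • (((ContinuousLinearMap.id ℝ (Eu n) ∘L tangentProj (x : Eu n) : Eu n →L[ℝ] Eu n) :
        Eu n →ₗ[ℝ] Eu n) - (B : Eu n →ₗ[ℝ] Eu n)) +
      ((-k • (innerSL ℝ p ∘L B) : Eu n →L[ℝ] ℝ) : Eu n →ₗ[ℝ] ℝ).smulRight ((x : Eu n) - p) := rfl
  rw [e, map_add, map_smul, map_sub, trace_comp_tangentProj (norm_coe_sph x),
    LinearMap.trace_smulRight]
  have e1 : LinearMap.trace ℝ (Eu n) ((ContinuousLinearMap.id ℝ (Eu n) : Eu n →L[ℝ] Eu n) :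
      Eu n →ₗ[ℝ] Eu n) = n := by
    have : ((ContinuousLinearMap.id ℝ (Eu n) : Eu n →L[ℝ] Eu n) : Eu n →ₗ[ℝ] Eu n) =
      LinearMap.id := rfl
    rw [this, LinearMap.trace_id]
    simp
  rw [e1]
  have e2 : ((-k • (innerSL ℝ p ∘L B) : Eu n →L[ℝ] ℝ) : Eu n →ₗ[ℝ] ℝ) ((x : Eu n) - p) =
      k * inner ℝ p (B p) := by
    change (-k) * inner ℝ p (B ((x : Eu n) - p)) = _
    rw [map_sub, hBx, zero_sub, inner_neg_right]
    ring
  rw [e2, ContinuousLinearMap.id_apply, inner_self_sph, smul_eq_mul]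

theorem hasDerivAt_graphMap_greatCircle (h : IsC11 u g M L) (x : Sph n) (v : Eu n) :
    HasDerivAt (fun t => (r * (1 + homExt u (greatCircle (x : Eu n) v t))) •
      greatCircle (x : Eu n) v t)
      ((r * (1 + u x)) • v + (r * inner ℝ (g x) v) • (x : Eu n)) 0 := by
  have h1 := hasDerivAt_greatCircle (x : Eu n) v
  have h2 := h.hasFDerivAt_homExt x one_pos
  rw [one_smul, inv_one, one_smul] at h2
  have h3 := HasFDerivAt.comp_hasDerivAt_of_eq 0 h2 h1 (greatCircle_zero _ _).symm
  have h4 := ((h3.const_add 1).const_mul r).smul h1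
  simp only [Function.comp_apply, greatCircle_zero, homExt_coe] at h4
  exact h4

/-- The mean curvature of a radial graph of class `C^{1,1}`. -/
theorem meanCurvature_graphMap (h : IsC11 u g M L) (hM : M ≤ 1 / 2) (hr : 0 < r)
    (hE : IsRadialRegion E r u) {x : Sph n}
    (hd : DifferentiableAt ℝ (homExt (slope u g)) (x : Eu n)) {J : ℝ}
    (hJ : J = Real.sqrt (1 + ‖slope u g x‖ ^ 2)) :
    meanCurvature E (graphMap r u x) = (r * (1 + u x))⁻¹ *
      (J⁻¹ * ((n - 1 : ℝ) - LinearMap.trace ℝ (Eu n)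
        (fderiv ℝ (homExt (slope u g)) (x : Eu n) : Eu n →ₗ[ℝ] Eu n)) +
      J⁻¹ ^ 3 * inner ℝ (slope u g x)
        (fderiv ℝ (homExt (slope u g)) (x : Eu n) (slope u g x))) := by
  set B := fderiv ℝ (homExt (slope u g)) (x : Eu n) with hBdef
  set N := graphNormal u g with hN
  set z₀ := graphMap r u x with hz₀
  have hρ := h.radius_pos hM hr x
  have hu1 : 1 + u x ≠ 0 := by linarith [h.one_add_pos hM x]
  have hz0 : z₀ ≠ 0 := smul_coe_ne_zero hρ x
  have hJ0 : 0 < J := by rw [hJ]; exact Real.sqrt_pos.2 (by positivity)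
  have hDN := hasFDerivAt_homExt_graphNormal hd.hasFDerivAt hJ
  have hDN' := hasFDerivAt_homExt_smul hDN.differentiableAt hρ
  rw [hDN.fderiv, ← hBdef] at hDN'
  set T : Eu n →L[ℝ] Eu n := J⁻¹ • (tangentProj (x : Eu n) - B) +
      (-(J⁻¹ ^ 3) • (innerSL ℝ (slope u g x) ∘L B)).smulRight ((x : Eu n) - slope u g x) with hT
  have hνx : exteriorNormal E z₀ = N x := exteriorNormal_graphMap h hM hr hE x
  have hwithin : HasFDerivWithinAt (exteriorNormal E) ((r * (1 + u x))⁻¹ • T) (frontier E) z₀ := by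
    refine hDN'.hasFDerivWithinAt.congr_of_eventuallyEq ?_ ?_
    · filter_upwards [self_mem_nhdsWithin, nhdsWithin_le_nhds (isOpen_ne.mem_nhds hz0)] with z hz hz'
      exact exteriorNormal_eq_homExt h hM hr hE hz' hz
    · exact hνx.trans (homExt_smul N hρ x).symm
  -- Only tangent directions have a determined derivative of the normal. Each tangent vector `τ` of
  -- the graph is realized by the curve on the graph over the great circle with velocity `v`, the
  -- rescaled tangential part of `τ`.
  have htan : ∀ τ : Eu n, inner ℝ (N x) τ = 0 →
      fderivWithin ℝ (exteriorNormal E) (frontier E) z₀ τ = ((r * (1 + u x))⁻¹ • T) τ := by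
    intro τ hτ
    set v : Eu n := (r * (1 + u x))⁻¹ • (τ - inner ℝ (x : Eu n) τ • (x : Eu n)) with hv
    have hxv : inner ℝ (x : Eu n) v = 0 := by
      rw [hv, real_inner_smul_right, inner_sub_right, real_inner_smul_right, inner_self_sph]
      ring
    have hp : inner ℝ (slope u g x) τ = inner ℝ (x : Eu n) τ := by
      rw [hN, graphNormal, real_inner_smul_left, inner_sub_left, ← hJ] at hτ
      have := (mul_eq_zero.1 hτ).resolve_left (inv_ne_zero hJ0.ne')
      linarith
    have hgp : g x = (1 + u x) • slope u g x := by
      rw [slope, smul_smul, mul_inv_cancel₀ hu1, one_smul]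
    have hgv : r * inner ℝ (g x) v = inner ℝ (x : Eu n) τ := by
      rw [hgp, hv, real_inner_smul_left, real_inner_smul_right, inner_sub_right,
        real_inner_smul_right, hp, real_inner_comm (x : Eu n) (slope u g x), slope_tangent h]
      field_simp
      try ring
    have hc := hasDerivAt_graphMap_greatCircle (r := r) h x v
    rw [hgv, hv, smul_smul, mul_inv_cancel₀ hρ.ne', one_smul, sub_add_cancel] at hc
    rw [← hv] at hc
    refine fderivWithin_apply_eq_of_curve hwithin ?_ hc (Eventually.of_forall fun t => ?_)
    · rw [greatCircle_zero, homExt_coe, hz₀, graphMap]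
    · have hmem : greatCircle (x : Eu n) v t ∈ sphere (0 : Eu n) 1 := by
        rw [mem_sphere, dist_zero_right]
        exact norm_greatCircle (norm_coe_sph x) hxv t
      have h5 := graphMap_mem_frontier h hM hr hE ⟨_, hmem⟩
      rw [graphMap] at h5
      rw [show homExt u (greatCircle (x : Eu n) v t) = u ⟨_, hmem⟩ from homExt_coe u ⟨_, hmem⟩]
      exact h5
  have hNn : ‖N x‖ = 1 := norm_graphNormal h x
  have hcomp : (fderivWithin ℝ (exteriorNormal E) (frontier E) z₀ ∘L tangentProj (N x)) =
      ((r * (1 + u x))⁻¹ • T) ∘L tangentProj (N x) := by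
    ext1 v
    rw [ContinuousLinearMap.comp_apply, ContinuousLinearMap.comp_apply]
    refine htan _ ?_
    exact Submodule.mem_orthogonal_singleton_iff_inner_right.1
      (Submodule.starProjection_apply_mem _ _)
  -- Differentiating `|N| = 1` shows that the correction for the projection onto the tangent plane
  -- vanishes, so the full trace of `T` may be used.
  have hNT : inner ℝ (N x) (T (N x)) = 0 := by
    have h6 := hDN.norm_sq
    have h7 : (fun z => ‖homExt (graphNormal u g) z‖ ^ 2) =ᶠ[𝓝 (x : Eu n)] fun _ => (1 : ℝ) := by
      filter_upwards [isOpen_ne.mem_nhds (coe_sph_ne_zero x)] with z hz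
      rw [homExt_of_ne _ hz, norm_graphNormal h, one_pow]
    have h8 := (h6.congr_of_eventuallyEq h7.symm).unique (hasFDerivAt_const (1 : ℝ) (x : Eu n))
    have h9 := DFunLike.congr_fun h8 (N x)
    have e0 : homExt (graphNormal u g) (x : Eu n) = N x := homExt_coe _ x
    rw [e0] at h9
    simpa using h9
  rw [meanCurvature, hνx, tangentialDiv, hcomp, trace_comp_tangentProj hNn]
  have hBx : B x = 0 := fderiv_homExt_apply_self hd
  have e1 : (((r * (1 + u x))⁻¹ • T : Eu n →L[ℝ] Eu n) : Eu n →ₗ[ℝ] Eu n) =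
      (r * (1 + u x))⁻¹ • (T : Eu n →ₗ[ℝ] Eu n) := rfl
  rw [e1, map_smul, _root_.smul_apply, real_inner_smul_right, hNT, mul_zero, sub_zero, hT,
    trace_graphNormal B _ hBx, smul_eq_mul]

end

end

section

open scoped NNReal ENNReal

variable {n : ℕ}

/-! ### The curvature integral of a radial graph -/

theorem measure_singleton_euclideanHausdorff {d : ℕ} (hd : 0 < d) (x : Eu n) :
    (μHE[d] : Measure (Eu n)) {x} = 0 := by
  have := Measure.nullSingletonClass_hausdorff (Eu n) (d := d) (by exact_mod_cast hd)
  rw [Measure.euclideanHausdorffMeasure_def, Measure.smul_apply, measure_singleton, smul_zero]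

/-- The weight `s^{n-2} e^{-s²/2}`. -/
def gaussWeight (n : ℕ) (s : ℝ) : ℝ := s ^ (n - 2) * Real.exp (-s ^ 2 / 2)

theorem gaussWeight_pos {s : ℝ} (hs : 0 < s) : 0 < gaussWeight n s := by
  unfold gaussWeight; positivity

theorem contDiff_gaussWeight (n : ℕ) : ContDiff ℝ 1 (gaussWeight n) := by
  unfold gaussWeight; fun_prop

theorem continuous_gaussWeight (n : ℕ) : Continuous (gaussWeight n) :=
  (contDiff_gaussWeight n).continuous

theorem hasDerivAt_gaussWeight (hn : 2 ≤ n) {s : ℝ} (hs : 0 < s) :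
    HasDerivAt (gaussWeight n) (s⁻¹ * ((n - 2 - s ^ 2 : ℝ) * gaussWeight n s)) s := by
  have h1 := (hasDerivAt_pow (n - 2) s).mul
    ((((hasDerivAt_pow 2 s).neg).div_const 2).exp)
  refine h1.congr_deriv ?_
  have hcast : ((n - 2 : ℕ) : ℝ) = (n : ℝ) - 2 := by
    rw [Nat.cast_sub hn]; norm_num
  unfold gaussWeight
  -- The derivative of `s ^ (n - 2)` has exponent `n - 3`, which is truncated when `n = 2`.
  rcases Nat.eq_zero_or_pos (n - 2) with h0 | h0
  · rw [h0] at hcast ⊢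
    simp only [pow_zero, Nat.cast_zero] at hcast ⊢
    rw [← hcast]
    simp only [Pi.neg_apply]
    field_simp
    try simp
    try ring
  · obtain ⟨k, hk⟩ := Nat.exists_eq_succ_of_ne_zero h0.ne'
    rw [← hcast, hk]
    simp only [Nat.succ_eq_add_one, Nat.add_sub_cancel, pow_succ, Pi.neg_apply]
    field_simp
    push_cast
    try ring

section

variable {E : Set (Eu n)} {r : ℝ} {u : Sph n → ℝ} {g : Sph n → Eu n} {M L : ℝ}

theorem continuous_slope (h : IsC11 u g M L) (hM : M ≤ 1 / 2) : Continuous (slope u g) :=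
  ((continuous_const.add h.continuous).inv₀ fun x hx => by
    have h1 := h.one_add_pos hM x
    have h2 : 1 + u x = 0 := hx
    linarith).smul h.continuous_grad

theorem continuous_graphMap (h : IsC11 u g M L) : Continuous (graphMap r u) :=
  (continuous_const.mul (continuous_const.add h.continuous)).smul continuous_subtype_val

theorem injective_graphMap (h : IsC11 u g M L) (hM : M ≤ 1 / 2) (hr : 0 < r) :
    Function.Injective (graphMap r u) := by
  intro x y hxy
  have hx := h.radius_pos hM hr x
  have hy := h.radius_pos hM hr y
  have hxy' : (r * (1 + u x)) • (x : Eu n) = (r * (1 + u y)) • (y : Eu n) := hxy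
  have h1 := homExt_smul (fun x : Sph n => (x : Eu n)) hx x
  rw [hxy', homExt_smul _ hy] at h1
  exact Subtype.ext h1.symm

/-- The area formula needs differentiability for pairs of points near `a`, not only for pairs
containing `a`. Expanding at `y` and moving the gradient from `y` to `a` by its Lipschitz bound
gives an error linear in `η`. -/
theorem norm_graphMap_sub_le (h : IsC11 u g M L) (hM : M ≤ 1 / 2) (hL : 0 ≤ L) (hr : 0 < r)
    (a x y : Sph n) {η : ℝ} (hx : dist x a ≤ η) (hy : dist y a ≤ η) :
    ‖graphMap r u x - graphMap r u y - ((r * (1 + u a)) • (ContinuousLinearMap.id ℝ (Eu n) +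
      (innerSL ℝ (slope u g a)).smulRight (a : Eu n))) ((x : Eu n) - y)‖ ≤
      r * (2 * M + 7 * L) * η * ‖(x : Eu n) - y‖ := by
  have hM0 : 0 ≤ M := (abs_nonneg _).trans (h.abs_le x)
  have hu1 : 1 + u a ≠ 0 := by linarith [h.one_add_pos hM a]
  rw [Subtype.dist_eq, dist_eq_norm] at hx hy
  have hη : 0 ≤ η := (norm_nonneg _).trans hx
  set d := ‖(x : Eu n) - y‖ with hd
  have hd0 : 0 ≤ d := norm_nonneg _
  have hd2 : d ≤ 2 * η := by
    have : (x : Eu n) - y = ((x : Eu n) - a) - ((y : Eu n) - a) := by abel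
    rw [hd, this]
    exact (norm_sub_le _ _).trans (by linarith)
  have hgp : inner ℝ (g a) ((x : Eu n) - y) = (1 + u a) * inner ℝ (slope u g a) ((x : Eu n) - y) := by
    rw [slope, real_inner_smul_left, ← mul_assoc, mul_inv_cancel₀ hu1, one_mul]
  have e : graphMap r u x - graphMap r u y - ((r * (1 + u a)) • (ContinuousLinearMap.id ℝ (Eu n) +
      (innerSL ℝ (slope u g a)).smulRight (a : Eu n))) ((x : Eu n) - y) =
      (r * (u x - u a)) • ((x : Eu n) - y) + (r * (u x - u y)) • ((y : Eu n) - a) +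
      (r * ((u x - u y - inner ℝ (g y) ((x : Eu n) - y)) +
        inner ℝ (g y - g a) ((x : Eu n) - y))) • (a : Eu n) := by
    rw [inner_sub_left, hgp]
    simp only [graphMap, _root_.smul_apply, _root_.add_apply, ContinuousLinearMap.id_apply,
      ContinuousLinearMap.smulRight_apply, innerSL_apply_apply]
    module
  have b1 : |u x - u a| ≤ (M + 2 * L) * η :=
    (h.dist_le hL a x).trans (by gcongr)
  have b2 : |u x - u y| ≤ (M + 2 * L) * d := h.dist_le hL y x
  have b3 : |u x - u y - inner ℝ (g y) ((x : Eu n) - y)| ≤ 2 * L * η * d := by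
    refine (h.taylor y x).trans ?_
    rw [← hd]
    calc L * d ^ 2 = L * d * d := by ring
      _ ≤ L * (2 * η) * d := by gcongr
      _ = _ := by ring
  have b4 : |inner ℝ (g y - g a) ((x : Eu n) - y)| ≤ L * η * d :=
    (abs_real_inner_le_norm _ _).trans (by gcongr; exact (h.lipschitz a y).trans (by gcongr))
  rw [e]
  refine (norm_add₃_le).trans ?_
  rw [norm_smul, norm_smul, norm_smul, norm_coe_sph, norm_mul, norm_mul, norm_mul,
    Real.norm_of_nonneg hr.le, Real.norm_eq_abs, Real.norm_eq_abs, Real.norm_eq_abs, mul_one]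
  have b5 := abs_add_le (u x - u y - inner ℝ (g y) ((x : Eu n) - y))
    (inner ℝ (g y - g a) ((x : Eu n) - y))
  calc r * |u x - u a| * d + r * |u x - u y| * ‖(y : Eu n) - a‖ +
        r * |u x - u y - inner ℝ (g y) ((x : Eu n) - y) + inner ℝ (g y - g a) ((x : Eu n) - y)|
      ≤ r * ((M + 2 * L) * η) * d + r * ((M + 2 * L) * d) * η + r * (2 * L * η * d + L * η * d) := by
        gcongr
        linarith
    _ = _ := by ring

theorem hausdorffMeasure_restrict_frontier (h : IsC11 u g M L) (hM : M ≤ 1 / 2) (hL : 0 ≤ L)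
    (hr : 0 < r) (hn : 2 ≤ n) (hE : IsRadialRegion E r u) :
    (μHE[n - 1] : Measure (Eu n)).restrict (frontier E) =
      ((sphMeasure n).withDensity (fun x =>
        (((r * (1 + u x)) ^ (n - 1) * Real.sqrt (1 + ‖slope u g x‖ ^ 2)).toNNReal : ℝ≥0∞))).map
        (graphMap r u) := by
  have hD0 : ∀ x, 0 < (r * (1 + u x)) ^ (n - 1) * Real.sqrt (1 + ‖slope u g x‖ ^ 2) := fun x =>
    mul_pos (pow_pos (h.radius_pos hM hr x) _) (Real.sqrt_pos.2 (by positivity))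
  -- The frontier and the graph can differ only in the origin, which is null because `n - 1 > 0`.
  have hfr : ((μHE[n - 1] : Measure (Eu n))).restrict (frontier E) =
      (μHE[n - 1] : Measure (Eu n)).restrict (range (graphMap r u)) := by
    refine Measure.restrict_congr_set ?_
    have h0 : ∀ᵐ z ∂(μHE[n - 1] : Measure (Eu n)), z ≠ 0 := by
      rw [ae_iff]
      simpa using measure_singleton_euclideanHausdorff (n := n) (d := n - 1) (by omega) 0
    filter_upwards [h0] with z hz
    refine propext ⟨fun hzE => ?_, ?_⟩
    · exact ⟨_, ((mem_frontier_iff h hM hr hE hz).1 hzE).symm⟩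
    · rintro ⟨x, rfl⟩
      exact graphMap_mem_frontier h hM hr hE x
  rw [hfr]
  refine hausdorffMeasure_restrict_range_eq_map (continuous_graphMap h) (injective_graphMap h hM hr)
    (L := fun a => (r * (1 + u a)) • (ContinuousLinearMap.id ℝ (Eu n) +
      (innerSL ℝ (slope u g a)).smulRight (a : Eu n))) (c := r / 2) (by positivity) ?_ ?_ ?_ ?_ ?_
  · intro a z hz
    have h1 : ‖z‖ ≤ ‖(ContinuousLinearMap.id ℝ (Eu n) +
        (innerSL ℝ (slope u g a)).smulRight (a : Eu n)) z‖ := by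
      refine (sq_le_sq₀ (norm_nonneg _) (norm_nonneg _)).1 ?_
      rw [_root_.add_apply, ContinuousLinearMap.smulRight_apply, ContinuousLinearMap.id_apply,
        norm_add_sq_real, real_inner_smul_right, real_inner_comm, hz]
      nlinarith [sq_nonneg ‖innerSL ℝ (slope u g a) z • (a : Eu n)‖]
    rw [_root_.smul_apply, norm_smul, Real.norm_of_nonneg (h.radius_pos hM hr a).le]
    have h2 : r / 2 ≤ r * (1 + u a) := by nlinarith [h.one_add_pos hM a]
    exact mul_le_mul h2 h1 (norm_nonneg _) (h.radius_pos hM hr a).le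
  · intro a δ hδ
    have hM0 : 0 ≤ M := (abs_nonneg _).trans (h.abs_le a)
    have hK : 0 < r * (2 * M + 7 * L) + 1 := by positivity
    refine ⟨δ / (r * (2 * M + 7 * L) + 1), by positivity, fun x y hx hy => ?_⟩
    refine (norm_graphMap_sub_le h hM hL hr a x y hx hy).trans ?_
    gcongr
    rw [mul_div_assoc', div_le_iff₀ hK]
    nlinarith
  · refine continuous_real_toNNReal.comp (((continuous_const.mul
      (continuous_const.add h.continuous)).pow _).mul ?_)
    exact (continuous_const.add ((continuous_slope h hM).norm.pow 2)).sqrt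
  · intro x
    exact Real.toNNReal_pos.2 (hD0 x)
  · intro a
    rw [normDet_tangent_rank_one a (h.radius_pos hM hr a) (slope_tangent h a),
      Real.coe_toNNReal _ (hD0 a).le]

/-- The trace of the derivative of `slope u g`. -/
def slopeDiv (u : Sph n → ℝ) (g : Sph n → Eu n) (x : Sph n) : ℝ :=
  LinearMap.trace ℝ (Eu n) (fderiv ℝ (homExt (slope u g)) (x : Eu n) : Eu n →ₗ[ℝ] Eu n)

/-- The quadratic remainder `⟨p, Dp p⟩ / (1 + |p|²)` with `p = slope u g`. -/
def slopeQuad (u : Sph n → ℝ) (g : Sph n → Eu n) (x : Sph n) : ℝ :=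
  inner ℝ (slope u g x) (fderiv ℝ (homExt (slope u g)) (x : Eu n) (slope u g x)) /
    (1 + ‖slope u g x‖ ^ 2)

theorem measurable_slopeDiv (u : Sph n → ℝ) (g : Sph n → Eu n) : Measurable (slopeDiv u g) := by
  unfold slopeDiv
  simp only [trace_eq_sum]
  refine Finset.measurable_sum _ fun i _ => ?_
  have h1 := measurable_fderiv_homExt_apply (slope u g) (v := fun _ => EuclideanSpace.single i 1)
    continuous_const
  have h2 : Continuous fun z : Eu n => z i := by fun_prop
  exact h2.measurable.comp h1

theorem measurable_slopeQuad (h : IsC11 u g M L) (hM : M ≤ 1 / 2) :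
    Measurable (slopeQuad u g) := by
  have hs := continuous_slope h hM
  exact (hs.measurable.inner (measurable_fderiv_homExt_apply (slope u g) hs)).div
    (continuous_const.add (hs.norm.pow 2)).measurable

theorem norm_fderiv_slope_le (h : IsC11 u g M L) (hM : M ≤ 1 / 2) (hL : 0 ≤ L) (x : Sph n) :
    ‖fderiv ℝ (homExt (slope u g)) (x : Eu n)‖ ≤ 4 * (2 * M + 6 * L) := by
  have hM0 : 0 ≤ M := (abs_nonneg _).trans (h.abs_le x)
  have := norm_fderiv_homExt_le (slope_lipschitz h hM hL) x
  rwa [Real.coe_toNNReal _ (by positivity)] at this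

theorem abs_slopeDiv_le (h : IsC11 u g M L) (hM : M ≤ 1 / 2) (hL : 0 ≤ L) (x : Sph n) :
    |slopeDiv u g x| ≤ n * (4 * (2 * M + 6 * L)) := by
  rw [slopeDiv, trace_eq_sum]
  refine (Finset.abs_sum_le_sum_abs _ _).trans ?_
  have : ∀ i ∈ (Finset.univ : Finset (Fin n)),
      |fderiv ℝ (homExt (slope u g)) (x : Eu n) (EuclideanSpace.single i 1) i| ≤
        4 * (2 * M + 6 * L) := by
    intro i _
    refine (PiLp.norm_apply_le (fderiv ℝ (homExt (slope u g)) (x : Eu n)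
      (EuclideanSpace.single i 1)) i).trans ?_
    refine (ContinuousLinearMap.le_opNorm _ _).trans ?_
    rw [PiLp.norm_single, norm_one, mul_one]
    exact norm_fderiv_slope_le h hM hL x
  refine (Finset.sum_le_sum this).trans ?_
  simp

theorem abs_slopeQuad_le (h : IsC11 u g M L) (hM : M ≤ 1 / 2) (hL : 0 ≤ L) (x : Sph n) :
    |slopeQuad u g x| ≤ 4 * (2 * M + 6 * L) * ‖slope u g x‖ ^ 2 := by
  have h1 : (1 : ℝ) ≤ 1 + ‖slope u g x‖ ^ 2 := by nlinarith [sq_nonneg ‖slope u g x‖]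
  rw [slopeQuad, abs_div, abs_of_pos (by linarith : (0 : ℝ) < 1 + ‖slope u g x‖ ^ 2)]
  refine (div_le_self (abs_nonneg _) h1).trans ?_
  refine (abs_real_inner_le_norm _ _).trans ?_
  have h2 := ContinuousLinearMap.le_opNorm (fderiv ℝ (homExt (slope u g)) (x : Eu n)) (slope u g x)
  have h3 := mul_le_mul_of_nonneg_right (norm_fderiv_slope_le h hM hL x)
    (norm_nonneg (slope u g x))
  calc _ ≤ ‖slope u g x‖ * (4 * (2 * M + 6 * L) * ‖slope u g x‖) := by gcongr; exact h2.trans h3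
    _ = _ := by ring

theorem continuous_gaussWeight_radius (h : IsC11 u g M L) :
    Continuous fun x => gaussWeight n (r * (1 + u x)) :=
  (continuous_gaussWeight n).comp (continuous_const.mul (continuous_const.add h.continuous))

theorem integrable_weight_slopeDiv (h : IsC11 u g M L) (hM : M ≤ 1 / 2) (hL : 0 ≤ L) :
    Integrable (fun x => slopeDiv u g x * gaussWeight n (r * (1 + u x))) (sphMeasure n) :=
  integrable_mul_of_continuous (Integrable.of_bound (measurable_slopeDiv u g).aestronglyMeasurable
    _ (Eventually.of_forall fun x => abs_slopeDiv_le h hM hL x)) (continuous_gaussWeight_radius h)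

theorem integrable_weight_slopeQuad (h : IsC11 u g M L) (hM : M ≤ 1 / 2) (hL : 0 ≤ L) :
    Integrable (fun x => slopeQuad u g x * gaussWeight n (r * (1 + u x))) (sphMeasure n) := by
  refine integrable_mul_of_continuous (Integrable.of_bound
    (measurable_slopeQuad h hM).aestronglyMeasurable (4 * (2 * M + 6 * L))
    (Eventually.of_forall fun x => ?_)) (continuous_gaussWeight_radius h)
  have hM0 : 0 ≤ M := (abs_nonneg _).trans (h.abs_le x)
  have h1 : ‖slope u g x‖ ≤ 1 := (norm_slope_le h hM x).trans (by linarith [h.norm_le x])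
  refine (abs_slopeQuad_le h hM hL x).trans ?_
  have : ‖slope u g x‖ ^ 2 ≤ 1 := pow_le_one₀ (norm_nonneg _) h1
  have h2 : 0 ≤ 4 * (2 * M + 6 * L) := by positivity
  nlinarith

/-- The area density cancels the factor `ρ⁻¹ J⁻¹` of the curvature. This leaves the power `n - 2` of
the radius and confines `J` to the quadratic remainder. -/
theorem weightedCurvature_graphMap_ae (h : IsC11 u g M L) (hM : M ≤ 1 / 2) (hL : 0 ≤ L)
    (hr : 0 < r) (hn : 2 ≤ n) (hE : IsRadialRegion E r u) :
    ∀ᵐ x ∂(sphMeasure n),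
      ((r * (1 + u x)) ^ (n - 1) * Real.sqrt (1 + ‖slope u g x‖ ^ 2)).toNNReal •
        weightedCurvature E (graphMap r u x) =
      (n - 1 : ℝ) * gaussWeight n (r * (1 + u x)) - slopeDiv u g x * gaussWeight n (r * (1 + u x)) +
        slopeQuad u g x * gaussWeight n (r * (1 + u x)) := by
  filter_upwards [ae_differentiableAt_homExt (slope_lipschitz h hM hL) (by omega)] with x hx
  have hρ := h.radius_pos hM hr x
  have hJ0 : 0 < Real.sqrt (1 + ‖slope u g x‖ ^ 2) := Real.sqrt_pos.2 (by positivity)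
  have hJ2 : Real.sqrt (1 + ‖slope u g x‖ ^ 2) ^ 2 = 1 + ‖slope u g x‖ ^ 2 :=
    Real.sq_sqrt (by positivity)
  have hpow : (r * (1 + u x)) ^ (n - 1) = (r * (1 + u x)) * (r * (1 + u x)) ^ (n - 2) := by
    rw [← pow_succ']; congr 1; omega
  rw [NNReal.smul_def, Real.coe_toNNReal _ (by positivity), smul_eq_mul, weightedCurvature,
    norm_graphMap h hM hr, meanCurvature_graphMap h hM hr hE hx rfl, hpow, slopeQuad,
    slopeDiv, gaussWeight, show ∀ y : ℝ, y / (1 + ‖slope u g x‖ ^ 2) =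
      y / Real.sqrt (1 + ‖slope u g x‖ ^ 2) ^ 2 from fun y => by rw [hJ2]]
  generalize Real.sqrt (1 + ‖slope u g x‖ ^ 2) = J at hJ0
  generalize r * (1 + u x) = ρ at hρ
  field_simp

theorem integrableOn_weightedCurvature (h : IsC11 u g M L) (hM : M ≤ 1 / 2) (hL : 0 ≤ L)
    (hr : 0 < r) (hn : 2 ≤ n) (hE : IsRadialRegion E r u) :
    IntegrableOn (weightedCurvature E) (frontier E) (Measure.euclideanHausdorffMeasure (n - 1)) ∧
    curvatureIntegral E = ∫ x, ((n - 1 : ℝ) * gaussWeight n (r * (1 + u x)) -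
      slopeDiv u g x * gaussWeight n (r * (1 + u x)) +
        slopeQuad u g x * gaussWeight n (r * (1 + u x))) ∂(sphMeasure n) := by
  have hemb : MeasurableEmbedding (graphMap r u) :=
    ((continuous_graphMap h).isClosedEmbedding (injective_graphMap h hM hr)).measurableEmbedding
  have hae := weightedCurvature_graphMap_ae h hM hL hr hn hE
  have hDm : Measurable fun x =>
      ((r * (1 + u x)) ^ (n - 1) * Real.sqrt (1 + ‖slope u g x‖ ^ 2)).toNNReal := by
    refine (continuous_real_toNNReal.comp (((continuous_const.mul
      (continuous_const.add h.continuous)).pow _).mul ?_)).measurable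
    exact (continuous_const.add ((continuous_slope h hM).norm.pow 2)).sqrt
  have hw := integrable_of_continuous ((continuous_const (y := (n - 1 : ℝ))).mul
    (continuous_gaussWeight_radius (r := r) h))
  constructor
  · rw [IntegrableOn, hausdorffMeasure_restrict_frontier h hM hL hr hn hE,
      hemb.integrable_map_iff, integrable_withDensity_iff_integrable_smul hDm]
    refine (Integrable.congr ?_ (EventuallyEq.symm hae))
    exact (hw.sub (integrable_weight_slopeDiv h hM hL)).add (integrable_weight_slopeQuad h hM hL)
  · rw [curvatureIntegral, hausdorffMeasure_restrict_frontier h hM hL hr hn hE,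
      hemb.integral_map, integral_withDensity_eq_integral_smul hDm]
    exact integral_congr_ae hae

theorem LipschitzWith.exists_comp_contDiff {G : Type*} [NormedAddCommGroup G] [NormedSpace ℝ G]
    {F : Type*} [NormedAddCommGroup F] [NormedSpace ℝ F] {f : Sph n → G} {K : ℝ≥0}
    (hf : LipschitzWith K f) {φ : G → F} (hφ : ContDiff ℝ 1 φ) :
    ∃ K' : ℝ≥0, LipschitzWith K' (φ ∘ f) := by
  have h1 : LocallyLipschitz (φ ∘ f) := hφ.locallyLipschitz.comp hf.locallyLipschitz
  obtain ⟨K', h2⟩ := (h1.locallyLipschitzOn (s := univ)).exists_lipschitzOnWith_of_compact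
    isCompact_univ
  exact ⟨K', lipschitzOnWith_univ.1 h2⟩

/-- The divergence theorem for the Lipschitz field `w(ρ) p`. Since `∇u = (1 + u) p`, the gradient of
`w(ρ)` is `ρ w'(ρ) p = (n - 2 - ρ²) w(ρ) p`. -/
theorem integral_weight_slopeDiv (h : IsC11 u g M L) (hM : M ≤ 1 / 2) (hL : 0 ≤ L) (hr : 0 < r)
    (hn : 2 ≤ n) :
    ∫ x, slopeDiv u g x * gaussWeight n (r * (1 + u x)) ∂(sphMeasure n) =
      - ∫ x, (n - 2 - (r * (1 + u x)) ^ 2 : ℝ) * gaussWeight n (r * (1 + u x)) *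
        ‖slope u g x‖ ^ 2 ∂(sphMeasure n) := by
  have hne : Nonempty (Sph n) := ⟨⟨EuclideanSpace.single ⟨0, by omega⟩ 1, by simp⟩⟩
  obtain ⟨x₀⟩ := hne
  have hM0 : 0 ≤ M := (abs_nonneg _).trans (h.abs_le x₀)
  have hul : LipschitzWith (M + 2 * L).toNNReal u := by
    refine LipschitzWith.of_dist_le_mul fun x y => ?_
    rw [Real.coe_toNNReal _ (by positivity), Subtype.dist_eq, dist_eq_norm]
    exact h.dist_le hL y x
  have hsl := slope_lipschitz h hM hL
  have hφ : ContDiff ℝ 1 fun q : ℝ × Eu n => gaussWeight n (r * (1 + q.1)) • q.2 :=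
    ((contDiff_gaussWeight n).comp (by fun_prop)).smul contDiff_snd
  obtain ⟨K', hK'⟩ := LipschitzWith.exists_comp_contDiff (hul.prodMk hsl) hφ
  have hdiv := integral_trace_fderiv_homExt hK' (by omega) (fun x => by
    change inner ℝ (x : Eu n) (gaussWeight n (r * (1 + u x)) • slope u g x) = 0
    rw [real_inner_smul_right, slope_tangent h, mul_zero])
  have hae : ∀ᵐ (x : Sph n) ∂(sphMeasure n), LinearMap.trace ℝ (Eu n) (fderiv ℝ (homExt
      ((fun q : ℝ × Eu n => gaussWeight n (r * (1 + q.1)) • q.2) ∘ fun x => (u x, slope u g x)))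
        (x : Eu n) : Eu n →ₗ[ℝ] Eu n) =
      slopeDiv u g x * gaussWeight n (r * (1 + u x)) +
      (n - 2 - (r * (1 + u x)) ^ 2 : ℝ) * gaussWeight n (r * (1 + u x)) * ‖slope u g x‖ ^ 2 := by
    filter_upwards [ae_differentiableAt_homExt hsl (by omega)] with x hx
    have hρ := h.radius_pos hM hr x
    have hu1 : 1 + u x ≠ 0 := by linarith [h.one_add_pos hM x]
    have h2 := h.hasFDerivAt_homExt x one_pos
    rw [one_smul, inv_one, one_smul] at h2
    have e0 : homExt u (x : Eu n) = u x := homExt_coe u x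
    have e1 : homExt (slope u g) (x : Eu n) = slope u g x := homExt_coe _ x
    have hG := hasDerivAt_gaussWeight hn hρ
    rw [← e0] at hG
    have h3 := (hG.comp_hasFDerivAt (x : Eu n) ((h2.const_add 1).const_mul r)).smul hx.hasFDerivAt
    have hev : homExt ((fun q : ℝ × Eu n => gaussWeight n (r * (1 + q.1)) • q.2) ∘
        fun x => (u x, slope u g x)) =ᶠ[𝓝 (x : Eu n)]
        (gaussWeight n ∘ fun z => r * (1 + homExt u z)) • homExt (slope u g) := by
      filter_upwards [isOpen_ne.mem_nhds (coe_sph_ne_zero x)] with z hz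
      rw [homExt_of_ne _ hz]
      simp only [Function.comp_apply, Pi.smul_apply', homExt_of_ne _ hz]
    rw [(h3.congr_of_eventuallyEq hev).fderiv]
    set B := fderiv ℝ (homExt (slope u g)) (x : Eu n) with hB
    simp only [Function.comp_apply, e0, e1]
    have e2 : ∀ (a : ℝ) (ℓ : Eu n →L[ℝ] ℝ) (p : Eu n),
        ((a • B + ℓ.smulRight p : Eu n →L[ℝ] Eu n) : Eu n →ₗ[ℝ] Eu n) =
        a • (B : Eu n →ₗ[ℝ] Eu n) + (ℓ : Eu n →ₗ[ℝ] ℝ).smulRight p := fun _ _ _ => rfl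
    rw [e2, map_add, map_smul, LinearMap.trace_smulRight, slopeDiv, ← hB]
    have e3 : g x = (1 + u x) • slope u g x := by
      rw [slope, smul_smul, mul_inv_cancel₀ hu1, one_smul]
    simp only [ContinuousLinearMap.coe_coe, _root_.smul_apply, innerSL_apply_apply, smul_eq_mul]
    rw [e3, real_inner_smul_left, real_inner_self_eq_norm_sq]
    field_simp
    try ring
  rw [integral_congr_ae hae, integral_add (integrable_weight_slopeDiv h hM hL)] at hdiv
  · linarith
  · refine integrable_of_continuous ?_
    exact ((continuous_const.sub ((continuous_const.mul
      (continuous_const.add h.continuous)).pow 2)).mul (continuous_gaussWeight_radius h)).mul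
      ((continuous_slope h hM).norm.pow 2)

/-- The curvature integral of a radial graph, after integration by parts. -/
theorem curvatureIntegral_eq (h : IsC11 u g M L) (hM : M ≤ 1 / 2) (hL : 0 ≤ L)
    (hr : 0 < r) (hn : 2 ≤ n) (hE : IsRadialRegion E r u) :
    curvatureIntegral E = (n - 1 : ℝ) * (∫ x, gaussWeight n (r * (1 + u x)) ∂(sphMeasure n)) +
      (∫ x, (n - 2 - (r * (1 + u x)) ^ 2 : ℝ) * gaussWeight n (r * (1 + u x)) *
        ‖slope u g x‖ ^ 2 ∂(sphMeasure n)) +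
      ∫ x, slopeQuad u g x * gaussWeight n (r * (1 + u x)) ∂(sphMeasure n) := by
  have hw : Integrable (fun x => (n - 1 : ℝ) * gaussWeight n (r * (1 + u x))) (sphMeasure n) :=
    (integrable_of_continuous (continuous_gaussWeight_radius (r := r) h)).const_mul _
  have hd := integrable_weight_slopeDiv (r := r) h hM hL
  have hws : Integrable (fun x => (n - 1 : ℝ) * gaussWeight n (r * (1 + u x)) -
      slopeDiv u g x * gaussWeight n (r * (1 + u x))) (sphMeasure n) := hw.sub hd
  rw [(integrableOn_weightedCurvature h hM hL hr hn hE).2,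
    integral_add hws (integrable_weight_slopeQuad h hM hL), integral_sub hw hd, integral_const_mul,
    integral_weight_slopeDiv h hM hL hr hn]
  ring

end

end

/-! ### The volume constraint and the one-variable Taylor bounds. -/

section

open scoped NNReal ENNReal

variable {n : ℕ}

/-! ### Gaussian volume in polar coordinates -/

/-- The radial primitive `∫₀ˢ t^{n-1} e^{-t²/2} dt`. -/
def gaussPrim (n : ℕ) (s : ℝ) : ℝ := ∫ t in (0 : ℝ)..s, t ^ (n - 1) * Real.exp (-t ^ 2 / 2)

theorem continuous_gaussDensity (n : ℕ) :
    Continuous fun t : ℝ => t ^ (n - 1) * Real.exp (-t ^ 2 / 2) := by fun_prop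

theorem hasDerivAt_gaussPrim (hn : 2 ≤ n) (s : ℝ) :
    HasDerivAt (gaussPrim n) (s * gaussWeight n s) s := by
  have h := intervalIntegral.integral_hasDerivAt_right
    ((continuous_gaussDensity n).intervalIntegrable 0 s)
    (continuous_gaussDensity n).stronglyMeasurable.stronglyMeasurableAtFilter
    (continuous_gaussDensity n).continuousAt
  have e : s ^ (n - 1) * Real.exp (-s ^ 2 / 2) = s * gaussWeight n s := by
    rw [gaussWeight, ← mul_assoc, ← pow_succ']
    congr 2
    omega
  rw [e] at h
  exact h

theorem gaussPrim_nonneg {s : ℝ} (hs : 0 ≤ s) : 0 ≤ gaussPrim n s :=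
  intervalIntegral.integral_nonneg hs fun _ ht => mul_nonneg (pow_nonneg ht.1 _) (Real.exp_pos _).le

theorem gaussPrim_lt (hn : 2 ≤ n) {s t : ℝ} (hs : 0 ≤ s) (hst : s < t) :
    gaussPrim n s < gaussPrim n t := by
  have hmono : StrictMonoOn (gaussPrim n) (Ici 0) := by
    refine strictMonoOn_of_deriv_pos (convex_Ici 0)
      (fun x _ => (hasDerivAt_gaussPrim hn x).continuousAt.continuousWithinAt) fun x hx => ?_
    rw [interior_Ici] at hx
    rw [(hasDerivAt_gaussPrim hn x).deriv]
    exact mul_pos hx (gaussWeight_pos hx)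
  exact hmono hs (hs.trans hst.le) hst

theorem lintegral_volumeIoiPow_lt (k : ℕ) (ρ : ℝ) {w : ℝ → ℝ≥0∞}
    (hw : Measurable w) :
    ∫⁻ t : Ioi (0 : ℝ), {t : Ioi (0 : ℝ) | (t : ℝ) < ρ}.indicator (fun t => w t) t
      ∂(Measure.volumeIoiPow k) = ∫⁻ t in Ioc (0 : ℝ) ρ, ENNReal.ofReal (t ^ k) * w t := by
  have hm : MeasurableSet {t : Ioi (0 : ℝ) | (t : ℝ) < ρ} :=
    measurableSet_lt measurable_subtype_coe measurable_const
  have hm2 : Measurable fun t : Ioi (0 : ℝ) => ENNReal.ofReal ((t : ℝ) ^ k) := by fun_prop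
  rw [lintegral_indicator hm, Measure.volumeIoiPow, restrict_withDensity hm,
    lintegral_withDensity_eq_lintegral_mul _ hm2
      (show Measurable fun t : Ioi (0 : ℝ) => w t from hw.comp measurable_subtype_coe),
    ← Measure.restrict_congr_set (Ioo_ae_eq_Ioc (a := (0 : ℝ)) (b := ρ))]
  have := setLIntegral_subtype (μ := (volume : Measure ℝ)) measurableSet_Ioi
    {t : Ioi (0 : ℝ) | (t : ℝ) < ρ} (fun t : ℝ => ENNReal.ofReal (t ^ k) * w t)
  have himg : Subtype.val '' {t : Ioi (0 : ℝ) | (t : ℝ) < ρ} = Ioo (0 : ℝ) ρ := by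
    ext t
    constructor
    · rintro ⟨y, hy, rfl⟩
      exact ⟨y.2, hy⟩
    · rintro ⟨h1, h2⟩
      exact ⟨⟨t, h1⟩, h2, rfl⟩
  rw [himg] at this
  exact this

theorem setLIntegral_radial {E : Set (Eu n)} {r : ℝ} {u : Sph n → ℝ} (hu : Continuous u)
    (hE : IsRadialRegion E r u) {w : ℝ → ℝ≥0∞}
    (hw : Measurable w) (hn : 2 ≤ n) :
    ∫⁻ z in E, w ‖z‖ = ∫⁻ x, (∫⁻ t in Ioc (0 : ℝ) (r * (1 + u x)),
      ENNReal.ofReal (t ^ (n - 1)) * w t) ∂((volume : Measure (Eu n)).toSphere) := by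
  have : Nonempty (Fin n) := ⟨⟨0, by omega⟩⟩
  set A : Set (Sph n × Ioi (0 : ℝ)) := {q | (q.2 : ℝ) < r * (1 + u q.1)} with hA
  have hAm : MeasurableSet A :=
    (isOpen_lt (continuous_subtype_val.comp continuous_snd)
      (continuous_const.mul (continuous_const.add (hu.comp continuous_fst)))).measurableSet
  have hmp := (volume : Measure (Eu n)).measurePreserving_homeomorphUnitSphereProd
  have h4 : ∀ y : ({0}ᶜ : Set (Eu n)), ((homeomorphUnitSphereProd (Eu n) y).2 : ℝ) = ‖(y : Eu n)‖ :=
    fun y => by simp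
  have h5 : ∀ y : ({0}ᶜ : Set (Eu n)),
      ‖(y : Eu n)‖ • ((homeomorphUnitSphereProd (Eu n) y).1 : Eu n) = y := fun y => by
    have hy0 : ‖(y : Eu n)‖ ≠ 0 := norm_ne_zero_iff.2 y.2
    simp [smul_smul, hy0]
  have h6 : ∀ y : ({0}ᶜ : Set (Eu n)), homeomorphUnitSphereProd (Eu n) y ∈ A ↔ (y : Eu n) ∈ E := by
    intro y
    have h1 := hE ((homeomorphUnitSphereProd (Eu n) y).1) ‖(y : Eu n)‖ (norm_pos_iff.2 y.2)
    rw [h5] at h1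
    rw [h1, ← h4]
    exact Iff.rfl
  have himg : Subtype.val '' (homeomorphUnitSphereProd (Eu n) ⁻¹' A) = E ∩ {0}ᶜ := by
    ext z
    constructor
    · rintro ⟨y, hy, rfl⟩
      exact ⟨(h6 y).1 hy, y.2⟩
    · rintro ⟨hz, hz0⟩
      exact ⟨⟨z, hz0⟩, (h6 ⟨z, hz0⟩).2 hz, rfl⟩
  have hae : E =ᵐ[volume] (E ∩ {0}ᶜ : Set (Eu n)) := by
    have h0 : ∀ᵐ z : Eu n, z ∈ ({0}ᶜ : Set (Eu n)) :=
      compl_mem_ae_iff.2 (measure_singleton _)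
    filter_upwards [h0] with z hz
    exact propext ⟨fun h => ⟨h, hz⟩, fun h => h.1⟩
  have hdim : Module.finrank ℝ (Eu n) = n := finrank_euclideanSpace_fin
  rw [hdim] at hmp
  rw [setLIntegral_congr hae, ← himg,
    ← setLIntegral_subtype (measurableSet_singleton (0 : Eu n)).compl]
  have h3 := hmp.setLIntegral_comp_preimage_emb (homeomorphUnitSphereProd (Eu n)).measurableEmbedding
    (fun q => w (q.2 : ℝ)) A
  simp only [h4] at h3
  have hwm : Measurable fun q : Sph n × Ioi (0 : ℝ) => w (q.2 : ℝ) :=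
    hw.comp (measurable_subtype_coe.comp measurable_snd)
  rw [h3, ← lintegral_indicator hAm, lintegral_prod _ (hwm.indicator hAm).aemeasurable]
  refine lintegral_congr fun x => ?_
  rw [← lintegral_volumeIoiPow_lt (n - 1) _ hw]
  rfl

theorem continuous_gaussPrim (hn : 2 ≤ n) : Continuous (gaussPrim n) :=
  continuous_iff_continuousAt.2 fun s => (hasDerivAt_gaussPrim hn s).continuousAt

/-- The factor `c` contains the Gaussian normalization and the ratio of the two surface measures. It
does not depend on the set, so it drops out of an equality of volumes. -/
theorem exists_gaussianVolume_eq (hn : 2 ≤ n) : ∃ c : ℝ, 0 < c ∧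
    ∀ (E : Set (Eu n)) (r : ℝ) (u : Sph n → ℝ), Continuous u → (∀ x, 0 < r * (1 + u x)) →
      IsRadialRegion E r u →
      gaussianVolume E = c * ∫ x, gaussPrim n (r * (1 + u x)) ∂(sphMeasure n) := by
  obtain ⟨c, hc0, hct, hc⟩ := exists_toSphere_eq_smul (n := n) (by omega)
  refine ⟨1 / (2 * Real.pi) ^ ((n : ℝ) / 2) * c.toReal,
    mul_pos (by positivity) (ENNReal.toReal_pos hc0 hct), fun E r u hu hpos hE => ?_⟩
  have hw : Measurable fun t : ℝ => ENNReal.ofReal (Real.exp (-t ^ 2 / 2)) := by fun_prop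
  rw [gaussianVolume, mul_assoc]
  congr 1
  rw [integral_eq_lintegral_of_nonneg_ae (Eventually.of_forall fun z => (Real.exp_pos _).le)
    (by fun_prop), setLIntegral_radial hu hE hw hn, hc, lintegral_smul_measure]
  have h1 : ∀ x, ∫⁻ t in Ioc (0 : ℝ) (r * (1 + u x)), ENNReal.ofReal (t ^ (n - 1)) *
      ENNReal.ofReal (Real.exp (-t ^ 2 / 2)) = ENNReal.ofReal (gaussPrim n (r * (1 + u x))) := by
    intro x
    rw [gaussPrim, intervalIntegral.integral_of_le (hpos x).le,
      ofReal_integral_eq_lintegral_ofReal]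
    · refine setLIntegral_congr_fun measurableSet_Ioc fun t ht => ?_
      exact (ENNReal.ofReal_mul (pow_nonneg ht.1.le _)).symm
    · exact ((continuous_gaussDensity n).intervalIntegrable 0 _).1
    · filter_upwards [ae_restrict_mem measurableSet_Ioc] with t ht
      exact mul_nonneg (pow_nonneg ht.1.le _) (Real.exp_pos _).le
  simp only [h1]
  have hcont : Continuous fun x => gaussPrim n (r * (1 + u x)) :=
    (continuous_gaussPrim hn).comp (continuous_const.mul (continuous_const.add hu))
  rw [← ofReal_integral_eq_lintegral_ofReal (integrable_of_continuous hcont)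
    (Eventually.of_forall fun x => gaussPrim_nonneg (hpos x).le), smul_eq_mul, ENNReal.toReal_mul,
    ENNReal.toReal_ofReal (integral_nonneg fun x => gaussPrim_nonneg (hpos x).le)]

theorem integral_gaussPrim_eq (hn : 2 ≤ n) {E E' : Set (Eu n)} {r : ℝ} (hr : 0 < r)
    {u : Sph n → ℝ} (hu : Continuous u) (hpos : ∀ x, 0 < r * (1 + u x))
    (hE : IsRadialRegion E r u) (hE' : IsRadialRegion E' r 0)
    (hvol : gaussianVolume E = gaussianVolume E') :
    ∫ x, (gaussPrim n (r * (1 + u x)) - gaussPrim n r) ∂(sphMeasure n) = 0 := by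
  obtain ⟨c, hc, h⟩ := exists_gaussianVolume_eq hn
  rw [h E r u hu hpos hE, h E' r 0 continuous_const (fun x => by simpa using hr) hE'] at hvol
  have h1 := mul_left_cancel₀ hc.ne' hvol
  have hint : Integrable (fun x => gaussPrim n (r * (1 + u x))) (sphMeasure n) :=
    integrable_of_continuous ((continuous_gaussPrim hn).comp
      (continuous_const.mul (continuous_const.add hu)))
  rw [integral_sub hint (integrable_const _), sub_eq_zero, h1]
  simp

/-! ### Taylor expansions of the radial weights -/

theorem exists_abs_sub_le {φ : ℝ → ℝ} (hφ : ContDiffOn ℝ 1 φ (Icc (-(1 / 2)) (1 / 2))) :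
    ∃ K : ℝ, 0 ≤ K ∧ ∀ v : ℝ, |v| ≤ 1 / 2 → |φ v - φ 0| ≤ K * |v| := by
  obtain ⟨K, hK⟩ := hφ.exists_lipschitzOnWith one_ne_zero (convex_Icc _ _) isCompact_Icc
  refine ⟨K, K.2, fun v hv => ?_⟩
  have := hK.dist_le_mul v (abs_le.1 hv) 0 (by constructor <;> norm_num)
  rwa [Real.dist_eq, Real.dist_eq, sub_zero] at this

theorem abs_le_of_abs_deriv_le {f f' : ℝ → ℝ} {K : ℝ} {k : ℕ} (hK : 0 ≤ K) (h0 : f 0 = 0)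
    (hf : ∀ v : ℝ, |v| ≤ 1 / 2 → HasDerivAt f (f' v) v)
    (hf' : ∀ v : ℝ, |v| ≤ 1 / 2 → |f' v| ≤ K * |v| ^ k) {v : ℝ} (hv : |v| ≤ 1 / 2) :
    |f v| ≤ K * |v| ^ (k + 1) := by
  have h1 : ∀ w ∈ Icc (-|v|) |v|, |w| ≤ 1 / 2 := fun w hw => (abs_le.2 hw).trans hv
  have h2 := Convex.norm_image_sub_le_of_norm_hasDerivWithin_le (f := f) (f' := f')
    (s := Icc (-|v|) |v|) (C := K * |v| ^ k) (x := 0) (y := v)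
    (fun w hw => (hf w (h1 w hw)).hasDerivWithinAt)
    (fun w hw => (hf' w (h1 w hw)).trans (by
      have := abs_le.2 hw
      gcongr)) (convex_Icc _ _) ⟨by simp, abs_nonneg _⟩ (abs_le.1 le_rfl)
  rw [h0, sub_zero, sub_zero, Real.norm_eq_abs, Real.norm_eq_abs, mul_assoc, ← pow_succ] at h2
  exact h2

theorem radius_pos_of_abs_le {r v : ℝ} (hr : 0 < r) (hv : |v| ≤ 1 / 2) : 0 < r * (1 + v) :=
  mul_pos hr (by linarith [(abs_le.1 hv).1])

theorem hasDerivAt_radius (r v : ℝ) : HasDerivAt (fun v : ℝ => r * (1 + v)) r v := by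
  simpa using ((hasDerivAt_id v).const_add 1).const_mul r

/-- Differentiating in `v` the weight minus this multiple of the primitive, all terms in `r²` cancel
and `-(n - 2) v (2 + v) (1 + v)⁻¹ w(r (1 + v))` remains. Hence there is no linear term, and the
quadratic term and the error both carry the factor `n - 2`. -/
theorem exists_gaussWeight_expansion (hn : 2 ≤ n) {r : ℝ} (hr : 0 < r) :
    ∃ K : ℝ, 0 ≤ K ∧ ∀ v : ℝ, |v| ≤ 1 / 2 →
      |gaussWeight n (r * (1 + v)) - gaussWeight n r -
        (n - 2 - r ^ 2) / r ^ 2 * (gaussPrim n (r * (1 + v)) - gaussPrim n r) +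
        (n - 2) * gaussWeight n r * v ^ 2| ≤ (n - 2) * K * |v| ^ 3 := by
  have hn2 : (0 : ℝ) ≤ n - 2 := by
    have : (2 : ℝ) ≤ n := by exact_mod_cast hn
    linarith
  obtain ⟨K, hK0, hK⟩ := exists_abs_sub_le
    (φ := fun v => (2 + v) * gaussWeight n (r * (1 + v)) * (1 + v)⁻¹) (by
      have h1 : ContDiff ℝ 1 fun v : ℝ => gaussWeight n (r * (1 + v)) :=
        (contDiff_gaussWeight n).comp (by fun_prop)
      refine (ContDiff.contDiffOn ((contDiff_const.add contDiff_id).mul h1)).mul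
        (ContDiffOn.inv (by fun_prop) fun v hv => ?_)
      have := hv.1
      linarith)
  refine ⟨K, hK0, fun v hv => ?_⟩
  refine abs_le_of_abs_deriv_le (k := 2) (f' := fun v => -(n - 2) * v *
    ((2 + v) * gaussWeight n (r * (1 + v)) * (1 + v)⁻¹ - 2 * gaussWeight n r)) (mul_nonneg hn2 hK0)
    (f := fun v => gaussWeight n (r * (1 + v)) - gaussWeight n r -
        (n - 2 - r ^ 2) / r ^ 2 * (gaussPrim n (r * (1 + v)) - gaussPrim n r) +
        (n - 2) * gaussWeight n r * v ^ 2) (by simp) ?_ ?_ hv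
  · intro v hv
    have hρ := radius_pos_of_abs_le hr hv
    have hv1 : 1 + v ≠ 0 := by linarith [(abs_le.1 hv).1]
    have h1 := (hasDerivAt_gaussWeight hn hρ).comp v (hasDerivAt_radius r v)
    have h2 := (hasDerivAt_gaussPrim hn (r * (1 + v))).comp v (hasDerivAt_radius r v)
    have h3 := ((h1.sub_const (gaussWeight n r)).sub ((h2.sub_const (gaussPrim n r)).const_mul
      ((n - 2 - r ^ 2 : ℝ) / r ^ 2))).add ((hasDerivAt_pow 2 v).const_mul
        ((n - 2 : ℝ) * gaussWeight n r))
    refine h3.congr_deriv ?_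
    field_simp
    ring
  · intro v hv
    have h1 := hK v hv
    simp only [add_zero, mul_one, inv_one] at h1
    rw [abs_mul, abs_mul, abs_neg, abs_of_nonneg hn2]
    calc (n - 2 : ℝ) * |v| * |(2 + v) * gaussWeight n (r * (1 + v)) * (1 + v)⁻¹ -
          2 * gaussWeight n r| ≤ (n - 2 : ℝ) * |v| * (K * |v|) := by gcongr
      _ = _ := by ring

/-- Integrated under the volume constraint, this controls the mean of `u` by `‖u‖²`. -/
theorem exists_gaussPrim_expansion (hn : 2 ≤ n) (r : ℝ) :
    ∃ K : ℝ, 0 ≤ K ∧ ∀ v : ℝ, |v| ≤ 1 / 2 →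
      |gaussPrim n (r * (1 + v)) - gaussPrim n r - r ^ 2 * gaussWeight n r * v| ≤ K * |v| ^ 2 := by
  obtain ⟨K, hK0, hK⟩ := exists_abs_sub_le
    (φ := fun v => r * (1 + v) * gaussWeight n (r * (1 + v)) * r) (by
      have h1 : ContDiff ℝ 1 fun v : ℝ => gaussWeight n (r * (1 + v)) :=
        (contDiff_gaussWeight n).comp (by fun_prop)
      fun_prop)
  refine ⟨K, hK0, fun v hv => ?_⟩
  refine abs_le_of_abs_deriv_le (k := 1) (f' := fun v =>
    r * (1 + v) * gaussWeight n (r * (1 + v)) * r - r ^ 2 * gaussWeight n r) hK0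
    (f := fun v => gaussPrim n (r * (1 + v)) - gaussPrim n r - r ^ 2 * gaussWeight n r * v)
    (by simp) ?_ ?_ hv
  · intro v _
    have h2 := (hasDerivAt_gaussPrim hn (r * (1 + v))).comp v (hasDerivAt_radius r v)
    have h3 := (h2.sub_const (gaussPrim n r)).sub
      ((hasDerivAt_id v).const_mul (r ^ 2 * gaussWeight n r))
    refine h3.congr_deriv ?_
    ring
  · intro v hv
    have h1 := hK v hv
    simp only [add_zero, mul_one] at h1
    rw [pow_one]
    refine le_of_eq_of_le ?_ h1
    congr 1
    ring

theorem exists_gradWeight_expansion (n : ℕ) {r : ℝ} (hr : 0 < r) :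
    ∃ K : ℝ, 0 ≤ K ∧ ∀ v : ℝ, |v| ≤ 1 / 2 →
      |(n - 2 - (r * (1 + v)) ^ 2) * gaussWeight n (r * (1 + v)) * ((1 + v)⁻¹) ^ 2 -
        (n - 2 - r ^ 2) * gaussWeight n r| ≤ K * |v| ∧
      gaussWeight n (r * (1 + v)) ≤ K := by
  have h1 : ContDiff ℝ 1 fun v : ℝ => gaussWeight n (r * (1 + v)) :=
    (contDiff_gaussWeight n).comp (by fun_prop)
  obtain ⟨K, hK0, hK⟩ := exists_abs_sub_le
    (φ := fun v => (n - 2 - (r * (1 + v)) ^ 2) * gaussWeight n (r * (1 + v)) * ((1 + v)⁻¹) ^ 2) (by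
      have h2 : ContDiff ℝ 1 fun v : ℝ => (n - 2 - (r * (1 + v)) ^ 2 : ℝ) := by fun_prop
      refine (h2.mul h1).contDiffOn.mul (ContDiffOn.pow (ContDiffOn.inv (by fun_prop)
        fun v hv => ?_) 2)
      have := hv.1
      linarith)
  obtain ⟨K', hK'0, hK'⟩ := exists_abs_sub_le (φ := fun v => gaussWeight n (r * (1 + v)))
    h1.contDiffOn
  have hg := gaussWeight_pos (n := n) hr
  refine ⟨K + K' + gaussWeight n r, by positivity, fun v hv => ⟨?_, ?_⟩⟩
  · have h2 := hK v hv
    simp only [add_zero, mul_one, inv_one, one_pow] at h2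
    refine h2.trans ?_
    gcongr
    linarith
  · have h2 := hK' v hv
    simp only [add_zero, mul_one] at h2
    have h3 := (abs_le.1 h2).2
    nlinarith

end

section

open scoped NNReal ENNReal

variable {n : ℕ}

/-! ### Second order expansion of the curvature integral -/

theorem abs_integral_le {f b : Sph n → ℝ} (hb : Integrable b (sphMeasure n))
    (h : ∀ x, |f x| ≤ b x) : |∫ x, f x ∂(sphMeasure n)| ≤ ∫ x, b x ∂(sphMeasure n) :=
  norm_integral_le_of_norm_le (f := f) hb (Eventually.of_forall h)

theorem isC11_zero : IsC11 (0 : Sph n → ℝ) 0 0 0 where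
  abs_le := by simp
  norm_le := by simp
  tangent := by simp
  lipschitz := by simp
  taylor := by simp

theorem curvatureIntegral_ball {E : Set (Eu n)} {r : ℝ} (hr : 0 < r) (hn : 2 ≤ n)
    (hE : IsRadialRegion E r 0) :
    curvatureIntegral E = (n - 1 : ℝ) * ∫ _ : Sph n, gaussWeight n r ∂(sphMeasure n) := by
  rw [curvatureIntegral_eq isC11_zero (by norm_num) le_rfl hr hn hE]
  have h1 : ∀ x : Sph n, slope (0 : Sph n → ℝ) 0 x = 0 := fun x => by simp [slope]
  have h2 : ∀ x : Sph n, slopeQuad (0 : Sph n → ℝ) 0 x = 0 := fun x => by simp [slopeQuad, h1]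
  simp [h1, h2]

/-- The zeroth order term of the integrated formula is expanded modulo the volume constraint, and
the gradient term by freezing the coefficient at `u = 0`. The remainder with second derivatives is
`O(ε)` times the squared gradient, because `Dp` is `O(ε)`. The `K` depends only on `n` and `r`. -/
theorem exists_curvatureIntegral_expansion (hn : 2 ≤ n) {r : ℝ} (hr : 0 < r) :
    ∃ K : ℝ, 0 ≤ K ∧ ∀ (E E' : Set (Eu n)) (u : Sph n → ℝ) (g : Sph n → Eu n) (ε : ℝ),
      IsC11 u g ε ((8 * n + 8) * ε) → 0 ≤ ε → ε ≤ 1 / 2 → IsRadialRegion E r u →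
      IsRadialRegion E' r 0 → gaussianVolume E = gaussianVolume E' →
      |curvatureIntegral E' - curvatureIntegral E - gaussWeight n r *
        ((n - 1) * (n - 2) * (∫ x, u x ^ 2 ∂(sphMeasure n)) +
          (r ^ 2 - n + 2) * ∫ x, ‖g x‖ ^ 2 ∂(sphMeasure n))| ≤
        K * ε * ((n - 2) * (∫ x, u x ^ 2 ∂(sphMeasure n)) + ∫ x, ‖g x‖ ^ 2 ∂(sphMeasure n)) := by
  obtain ⟨K₁, hK₁, h₁⟩ := exists_gaussWeight_expansion hn hr
  obtain ⟨K₂, hK₂, h₂⟩ := exists_gradWeight_expansion n hr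
  have hn2 : (0 : ℝ) ≤ n - 2 := by
    have : (2 : ℝ) ≤ n := by exact_mod_cast hn
    linarith
  set κ : ℝ := 4 * (2 + 6 * (8 * n + 8)) with hκ
  have hκ0 : 0 ≤ κ := by positivity
  refine ⟨(n - 1) * K₁ + K₂ + κ * 4 * K₂, by
    have : (0 : ℝ) ≤ n - 1 := by linarith
    positivity, fun E E' u g ε h hε0 hε hE hE' hvol => ?_⟩
  have hL : 0 ≤ (8 * n + 8) * ε := by positivity
  set A := ∫ x, u x ^ 2 ∂(sphMeasure n) with hA
  set D := ∫ x, ‖g x‖ ^ 2 ∂(sphMeasure n) with hD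
  have hu := h.continuous
  have hg := h.continuous_grad
  have hu2 : ∀ x, |u x| ≤ 1 / 2 := fun x => (h.abs_le x).trans hε
  have iA : Integrable (fun x => u x ^ 2) (sphMeasure n) := integrable_of_continuous (hu.pow 2)
  have iD : Integrable (fun x => ‖g x‖ ^ 2) (sphMeasure n) :=
    integrable_of_continuous (hg.norm.pow 2)
  have iG : Integrable (fun x => gaussWeight n (r * (1 + u x))) (sphMeasure n) :=
    integrable_of_continuous (continuous_gaussWeight_radius h)
  have hFc : Continuous fun x => gaussPrim n (r * (1 + u x)) - gaussPrim n r :=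
    ((continuous_gaussPrim hn).comp (continuous_const.mul (continuous_const.add hu))).sub
      continuous_const
  have iF : Integrable (fun x => gaussPrim n (r * (1 + u x)) - gaussPrim n r) (sphMeasure n) :=
    integrable_of_continuous hFc
  have iI : Integrable (fun x => (n - 2 - (r * (1 + u x)) ^ 2 : ℝ) *
      gaussWeight n (r * (1 + u x)) * ‖slope u g x‖ ^ 2) (sphMeasure n) := by
    refine integrable_of_continuous ?_
    exact ((continuous_const.sub ((continuous_const.mul
      (continuous_const.add hu)).pow 2)).mul (continuous_gaussWeight_radius h)).mul
      ((continuous_slope h hε).norm.pow 2)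
  have hvol' := integral_gaussPrim_eq hn hr hu (h.radius_pos hε hr) hE hE' hvol
  -- A multiple of the vanishing integral `hvol'` is subtracted, which puts the integrand into the
  -- form of `exists_gaussWeight_expansion`.
  have e1 : |(∫ x, gaussWeight n (r * (1 + u x)) ∂(sphMeasure n)) -
      (∫ _ : Sph n, gaussWeight n r ∂(sphMeasure n)) + (n - 2) * gaussWeight n r * A| ≤
      (n - 2) * K₁ * ε * A := by
    have e : (∫ x, gaussWeight n (r * (1 + u x)) ∂(sphMeasure n)) -
        (∫ _ : Sph n, gaussWeight n r ∂(sphMeasure n)) + (n - 2) * gaussWeight n r * A =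
        ∫ x, (gaussWeight n (r * (1 + u x)) - gaussWeight n r -
          (n - 2 - r ^ 2) / r ^ 2 * (gaussPrim n (r * (1 + u x)) - gaussPrim n r) +
          (n - 2) * gaussWeight n r * u x ^ 2) ∂(sphMeasure n) := by
      have i1 : Integrable (fun x => gaussWeight n (r * (1 + u x)) - gaussWeight n r)
        (sphMeasure n) := iG.sub (integrable_const _)
      have i2 : Integrable (fun x => gaussWeight n (r * (1 + u x)) - gaussWeight n r -
          (n - 2 - r ^ 2) / r ^ 2 * (gaussPrim n (r * (1 + u x)) - gaussPrim n r))
          (sphMeasure n) := i1.sub (iF.const_mul _)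
      rw [integral_add i2 (iA.const_mul _), integral_sub i1 (iF.const_mul _),
        integral_sub iG (integrable_const _), integral_const_mul, integral_const_mul, hvol']
      ring
    rw [e, hA, ← integral_const_mul]
    refine abs_integral_le (iA.const_mul _) fun x => ?_
    refine (h₁ (u x) (hu2 x)).trans ?_
    have := h.abs_le x
    calc (n - 2 : ℝ) * K₁ * |u x| ^ 3 = (n - 2 : ℝ) * K₁ * |u x| * |u x| ^ 2 := by ring
      _ ≤ (n - 2 : ℝ) * K₁ * ε * |u x| ^ 2 := by gcongr
      _ = _ := by rw [sq_abs]
  have e2 : |(∫ x, (n - 2 - (r * (1 + u x)) ^ 2 : ℝ) * gaussWeight n (r * (1 + u x)) *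
        ‖slope u g x‖ ^ 2 ∂(sphMeasure n)) - (n - 2 - r ^ 2) * gaussWeight n r * D| ≤
      K₂ * ε * D := by
    rw [hD, ← integral_const_mul, ← integral_const_mul, ← integral_sub iI (iD.const_mul _)]
    refine abs_integral_le (iD.const_mul _) fun x => ?_
    have hsl : ‖slope u g x‖ ^ 2 = ((1 + u x)⁻¹) ^ 2 * ‖g x‖ ^ 2 := by
      rw [slope, norm_smul, mul_pow, Real.norm_eq_abs, sq_abs]
    rw [hsl, ← mul_assoc, ← sub_mul, abs_mul, abs_of_nonneg (sq_nonneg ‖g x‖)]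
    refine mul_le_mul_of_nonneg_right ((h₂ (u x) (hu2 x)).1.trans ?_) (by positivity)
    gcongr
    exact h.abs_le x
  have e3 : |∫ x, slopeQuad u g x * gaussWeight n (r * (1 + u x)) ∂(sphMeasure n)| ≤
      κ * 4 * K₂ * ε * D := by
    rw [hD, ← integral_const_mul]
    refine abs_integral_le (iD.const_mul _) fun x => ?_
    have hw := (gaussWeight_pos (n := n) (h.radius_pos hε hr x)).le
    rw [abs_mul, abs_of_nonneg hw]
    have hs : ‖slope u g x‖ ^ 2 ≤ (2 * ‖g x‖) ^ 2 :=
      pow_le_pow_left₀ (norm_nonneg _) (norm_slope_le h hε x) 2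
    calc |slopeQuad u g x| * gaussWeight n (r * (1 + u x))
        ≤ (4 * (2 * ε + 6 * ((8 * n + 8) * ε)) * (2 * ‖g x‖) ^ 2) * K₂ := by
          refine mul_le_mul ((abs_slopeQuad_le h hε hL x).trans ?_) (h₂ (u x) (hu2 x)).2 hw
            (by positivity)
          gcongr
      _ = _ := by rw [hκ]; ring
  have hA0 : 0 ≤ A := integral_nonneg fun x => sq_nonneg _
  have hD0 : 0 ≤ D := integral_nonneg fun x => sq_nonneg _
  rw [curvatureIntegral_eq h hε hL hr hn hE, curvatureIntegral_ball hr hn hE']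
  set I₁ := ∫ x, gaussWeight n (r * (1 + u x)) ∂(sphMeasure n)
  set I₀ := ∫ _ : Sph n, gaussWeight n r ∂(sphMeasure n)
  set I₂ := ∫ x, (n - 2 - (r * (1 + u x)) ^ 2 : ℝ) * gaussWeight n (r * (1 + u x)) *
        ‖slope u g x‖ ^ 2 ∂(sphMeasure n)
  set I₃ := ∫ x, slopeQuad u g x * gaussWeight n (r * (1 + u x)) ∂(sphMeasure n)
  have e : (n - 1 : ℝ) * I₀ - ((n - 1 : ℝ) * I₁ + I₂ + I₃) - gaussWeight n r *
      ((n - 1) * (n - 2) * A + (r ^ 2 - n + 2) * D) =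
      -((n - 1 : ℝ) * (I₁ - I₀ + (n - 2) * gaussWeight n r * A)) +
      -(I₂ - (n - 2 - r ^ 2) * gaussWeight n r * D) + -I₃ := by ring
  have hn1 : (0 : ℝ) ≤ n - 1 := by linarith
  rw [e]
  refine (abs_add_three _ _ _).trans ?_
  rw [abs_neg, abs_neg, abs_neg, abs_mul, abs_of_nonneg hn1]
  have e4 := mul_le_mul_of_nonneg_left e1 hn1
  have e5 : 0 ≤ (K₂ + κ * 4 * K₂) * ε * ((n - 2) * A) := by positivity
  have e6 : 0 ≤ (n - 1) * K₁ * ε * D := by positivity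
  calc _ ≤ (n - 1) * ((n - 2) * K₁ * ε * A) + K₂ * ε * D + κ * 4 * K₂ * ε * D :=
        add_le_add (add_le_add e4 e2) e3
    _ ≤ _ := by linarith

/-- Under the volume constraint the mean of `u` is quadratically small. -/
theorem exists_abs_integral_le (hn : 2 ≤ n) {r : ℝ} (hr : 0 < r) :
    ∃ K : ℝ, 0 ≤ K ∧ ∀ (E E' : Set (Eu n)) (u : Sph n → ℝ), Continuous u →
      (∀ x, |u x| ≤ 1 / 2) → IsRadialRegion E r u →
      IsRadialRegion E' r 0 → gaussianVolume E = gaussianVolume E' →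
      |∫ x, u x ∂(sphMeasure n)| ≤ K * ∫ x, u x ^ 2 ∂(sphMeasure n) := by
  obtain ⟨K, hK, h⟩ := exists_gaussPrim_expansion hn r
  have hg : 0 < r ^ 2 * gaussWeight n r := mul_pos (by positivity) (gaussWeight_pos hr)
  refine ⟨K / (r ^ 2 * gaussWeight n r), by positivity, fun E E' u hu hu2 hE hE' hvol => ?_⟩
  have iF : Integrable (fun x => gaussPrim n (r * (1 + u x)) - gaussPrim n r) (sphMeasure n) :=
    integrable_of_continuous (((continuous_gaussPrim hn).comp (continuous_const.mul
      (continuous_const.add hu))).sub continuous_const)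
  have iu : Integrable u (sphMeasure n) := integrable_of_continuous hu
  have iA : Integrable (fun x => u x ^ 2) (sphMeasure n) := integrable_of_continuous (hu.pow 2)
  have hvol' := integral_gaussPrim_eq hn hr hu (fun x => radius_pos_of_abs_le hr (hu2 x)) hE hE' hvol
  have e : r ^ 2 * gaussWeight n r * ∫ x, u x ∂(sphMeasure n) =
      -∫ x, (gaussPrim n (r * (1 + u x)) - gaussPrim n r - r ^ 2 * gaussWeight n r * u x)
        ∂(sphMeasure n) := by
    rw [integral_sub iF (iu.const_mul _), hvol', integral_const_mul]
    ring
  have h1 : |r ^ 2 * gaussWeight n r * ∫ x, u x ∂(sphMeasure n)| ≤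
      K * ∫ x, u x ^ 2 ∂(sphMeasure n) := by
    rw [e, abs_neg, ← integral_const_mul]
    refine abs_integral_le (iA.const_mul _) fun x => ?_
    have := h (u x) (hu2 x)
    rwa [sq_abs] at this
  rw [abs_mul, abs_of_pos hg] at h1
  rw [div_mul_eq_mul_div, le_div_iff₀ hg]
  linarith

end

/-! ### The sharp Poincaré inequality for even functions. -/

section

open scoped NNReal ENNReal

variable {n : ℕ}

/-! ### The Laplacian on smooth functions on the sphere -/

theorem continuous_tangentialDiv {Y : Eu n → Eu n} (hY : ContDiff ℝ ∞ Y) :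
    Continuous fun x : Sph n => tangentialDiv (sphere (0 : Eu n) 1) (x : Eu n) Y x := by
  have hd : Continuous (fderiv ℝ Y) := hY.continuous_fderiv (by simp)
  have e : (fun x : Sph n => tangentialDiv (sphere (0 : Eu n) 1) (x : Eu n) Y x) = fun x : Sph n =>
      (∑ i, inner ℝ (EuclideanSpace.single i (1 : ℝ))
        (fderiv ℝ Y (x : Eu n) (EuclideanSpace.single i 1))) -
        inner ℝ (x : Eu n) (fderiv ℝ Y (x : Eu n) (x : Eu n)) := by
    funext x
    rw [tangentialDiv_sphere x ((hY.differentiable (by simp)).differentiableAt.hasFDerivAt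
      |>.hasFDerivWithinAt), trace_eq_sum]
    congr 1
    refine Finset.sum_congr rfl fun i _ => ?_
    simp [EuclideanSpace.inner_single_left]
  rw [e]
  have hc : Continuous fun x : Sph n => fderiv ℝ Y (x : Eu n) := hd.comp continuous_subtype_val
  refine Continuous.sub (continuous_finsetSum _ fun i _ => ?_) ?_
  · exact continuous_const.inner (hc.clm_apply continuous_const)
  · exact continuous_subtype_val.inner (hc.clm_apply continuous_subtype_val)

theorem integral_tangentialDiv_eq_zero (hn : 1 ≤ n) {Y : Eu n → Eu n} (hY : ContDiff ℝ ∞ Y)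
    (htan : ∀ x : Sph n, inner ℝ (Y x) (x : Eu n) = 0) :
    ∫ x : Sph n, tangentialDiv (sphere (0 : Eu n) 1) (x : Eu n) Y x ∂(sphMeasure n) = 0 := by
  have h1 : LipschitzWith 1 ((↑) : Sph n → Eu n) := LipschitzWith.subtype_val _
  obtain ⟨K, hK⟩ := LipschitzWith.exists_comp_contDiff h1 (hY.of_le (by simp) : ContDiff ℝ 1 Y)
  have h2 := integral_trace_fderiv_homExt hK hn fun x => by
    rw [real_inner_comm]; exact htan x
  rw [← h2]
  refine integral_congr_ae (Eventually.of_forall fun x => ?_)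
  have hYx : HasFDerivAt Y (fderiv ℝ Y (x : Eu n)) (x : Eu n) :=
    (hY.differentiable (by simp)).differentiableAt.hasFDerivAt
  have h3 : HasFDerivWithinAt (homExt (Y ∘ ((↑) : Sph n → Eu n))) (fderiv ℝ Y (x : Eu n))
      (sphere (0 : Eu n) 1) (x : Eu n) := by
    refine hYx.hasFDerivWithinAt.congr (fun y hy => ?_) ?_
    · exact homExt_coe (Y ∘ ((↑) : Sph n → Eu n)) ⟨y, hy⟩
    · exact homExt_coe (Y ∘ ((↑) : Sph n → Eu n)) x
  have h4 := hasFDerivAt_homExt h3 one_pos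
  rw [inv_one, one_smul, one_smul] at h4
  simp only
  rw [h4.fderiv, trace_comp_tangentProj (norm_coe_sph x),
    tangentialDiv_sphere x hYx.hasFDerivWithinAt]

/-- The divergence theorem for `φ Y`. The field `X` has to represent the derivative of `φ` on
tangent vectors only, so a tangential gradient is admissible. -/
theorem integral_mul_tangentialDiv (hn : 1 ≤ n) {φ : Eu n → ℝ} (hφ : ContDiff ℝ ∞ φ)
    {X Y : Eu n → Eu n} (hX : ∀ (x : Sph n) (v : Eu n), inner ℝ (x : Eu n) v = 0 →
      fderiv ℝ φ (x : Eu n) v = inner ℝ (X x) v)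
    (hXc : Continuous X) (hY : ContDiff ℝ ∞ Y)
    (htan : ∀ x : Sph n, inner ℝ (Y x) (x : Eu n) = 0) :
    ∫ x : Sph n, φ x * tangentialDiv (sphere (0 : Eu n) 1) (x : Eu n) Y x ∂(sphMeasure n) =
      -∫ x : Sph n, inner ℝ (X x) (Y x) ∂(sphMeasure n) := by
  have h0 := integral_tangentialDiv_eq_zero hn (hφ.smul hY) fun x => by
    simp only [Pi.smul_apply', real_inner_smul_left, htan, mul_zero]
  have e : ∀ x : Sph n, tangentialDiv (sphere (0 : Eu n) 1) (x : Eu n) (φ • Y) x =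
      φ x * tangentialDiv (sphere (0 : Eu n) 1) (x : Eu n) Y x + inner ℝ (X x) (Y x) := by
    intro x
    have hYx : HasFDerivAt Y (fderiv ℝ Y (x : Eu n)) (x : Eu n) :=
      (hY.differentiable (by simp)).differentiableAt.hasFDerivAt
    have hφx : HasFDerivAt φ (fderiv ℝ φ (x : Eu n)) (x : Eu n) :=
      (hφ.differentiable (by simp)).differentiableAt.hasFDerivAt
    have hx := htan x
    rw [real_inner_comm] at hx
    rw [tangentialDiv_sphere x (hφx.smul hYx).hasFDerivWithinAt,
      tangentialDiv_sphere x hYx.hasFDerivWithinAt, ← hX x _ hx]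
    have e2 : ((φ x • fderiv ℝ Y (x : Eu n) + (fderiv ℝ φ (x : Eu n)).smulRight (Y x) :
        Eu n →L[ℝ] Eu n) : Eu n →ₗ[ℝ] Eu n) = φ x • (fderiv ℝ Y (x : Eu n) : Eu n →ₗ[ℝ] Eu n) +
        (fderiv ℝ φ (x : Eu n) : Eu n →ₗ[ℝ] ℝ).smulRight (Y x) := rfl
    rw [e2, map_add, map_smul, LinearMap.trace_smulRight, _root_.add_apply, _root_.smul_apply,
      ContinuousLinearMap.smulRight_apply, inner_add_right, real_inner_smul_right,
      real_inner_smul_right, hx, ContinuousLinearMap.coe_coe, smul_eq_mul]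
    ring
  have i1 : Integrable (fun x : Sph n => φ x * tangentialDiv (sphere (0 : Eu n) 1) (x : Eu n) Y x)
      (sphMeasure n) := integrable_of_continuous
    ((hφ.continuous.comp continuous_subtype_val).mul (continuous_tangentialDiv hY))
  have i2 : Integrable (fun x : Sph n => inner ℝ (X x) (Y x)) (sphMeasure n) :=
    integrable_of_continuous ((hXc.comp continuous_subtype_val).inner
      (hY.continuous.comp continuous_subtype_val))
  have e3 : (∫ x : Sph n, tangentialDiv (sphere (0 : Eu n) 1) (x : Eu n) (φ • Y) x ∂(sphMeasure n)) =
      (∫ x : Sph n, φ x * tangentialDiv (sphere (0 : Eu n) 1) (x : Eu n) Y x ∂(sphMeasure n)) +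
      ∫ x : Sph n, inner ℝ (X x) (Y x) ∂(sphMeasure n) := by
    rw [← integral_add i1 i2]
    exact integral_congr_ae (Eventually.of_forall e)
  have h1 : (∫ x : Sph n, tangentialDiv (sphere (0 : Eu n) 1) (x : Eu n) (φ • Y) x
    ∂(sphMeasure n)) = 0 := h0
  linarith

/-- `X` is a smooth tangential field that represents the gradient of the continuous function `f`. -/
structure IsSmoothGradient (f : C(Sph n, ℝ)) (X : Eu n → Eu n) : Prop where
  contDiff : ContDiff ℝ ∞ X
  tangent : ∀ x : Sph n, inner ℝ (X x) (x : Eu n) = 0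
  integral_eq : ∀ Y : Eu n → Eu n, ContDiff ℝ ∞ Y → (∀ x : Sph n, inner ℝ (Y x) (x : Eu n) = 0) →
    ∫ x : Sph n, f x * tangentialDiv (sphere (0 : Eu n) 1) (x : Eu n) Y x ∂(sphMeasure n) =
      -∫ x : Sph n, inner ℝ (X x) (Y x) ∂(sphMeasure n)

theorem IsSmoothGradient.add {f f' : C(Sph n, ℝ)} {X X' : Eu n → Eu n}
    (h : IsSmoothGradient f X) (h' : IsSmoothGradient f' X') :
    IsSmoothGradient (f + f') (X + X') where
  contDiff := h.contDiff.add h'.contDiff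
  tangent x := by rw [Pi.add_apply, inner_add_left, h.tangent, h'.tangent, add_zero]
  integral_eq Y hY hYt := by
    have hd := continuous_tangentialDiv hY
    have hYc : Continuous fun x : Sph n => Y x := hY.continuous.comp continuous_subtype_val
    have hXc : Continuous fun x : Sph n => X x := h.contDiff.continuous.comp continuous_subtype_val
    have hXc' : Continuous fun x : Sph n => X' x :=
      h'.contDiff.continuous.comp continuous_subtype_val
    have i1 := integrable_of_continuous (f.continuous.mul hd)
    have i2 := integrable_of_continuous (f'.continuous.mul hd)
    have i3 := integrable_of_continuous (hXc.inner (𝕜 := ℝ) hYc)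
    have i4 := integrable_of_continuous (hXc'.inner (𝕜 := ℝ) hYc)
    have e1 := integral_add i1 i2
    have e2 := integral_add i3 i4
    simp only [ContinuousMap.add_apply, Pi.add_apply, add_mul, inner_add_left]
    refine e1.trans ?_
    refine Eq.trans ?_ (congrArg Neg.neg e2.symm)
    have a1 := h.integral_eq Y hY hYt
    have a2 := h'.integral_eq Y hY hYt
    simp only [Pi.mul_apply]
    rw [a1, a2]
    ring

theorem IsSmoothGradient.smul {f : C(Sph n, ℝ)} {X : Eu n → Eu n}
    (h : IsSmoothGradient f X) (c : ℝ) : IsSmoothGradient (c • f) (c • X) where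
  contDiff := h.contDiff.const_smul c
  tangent x := by rw [Pi.smul_apply, real_inner_smul_left, h.tangent, mul_zero]
  integral_eq Y hY hYt := by
    simp only [ContinuousMap.smul_apply, Pi.smul_apply, smul_eq_mul, mul_assoc,
      real_inner_smul_left]
    rw [integral_const_mul, integral_const_mul, h.integral_eq Y hY hYt]
    ring

theorem isSmoothGradient_const (hn : 1 ≤ n) (c : ℝ) :
    IsSmoothGradient (ContinuousMap.const (Sph n) c) 0 where
  contDiff := contDiff_const
  tangent x := by simp
  integral_eq Y hY hYt := by
    simp only [ContinuousMap.const_apply, Pi.zero_apply, inner_zero_left, integral_zero, neg_zero]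
    rw [integral_const_mul, integral_tangentialDiv_eq_zero hn hY hYt, mul_zero]

theorem tangentialDiv_zero (x : Sph n) :
    tangentialDiv (sphere (0 : Eu n) 1) (x : Eu n) 0 x = 0 := by
  refine (tangentialDiv_sphere (X := 0) x (hasFDerivWithinAt_const (0 : Eu n) _ _)).trans ?_
  simp

/-- The graph of the Laplacian: pairs `(f, Δf)`. -/
def sphLaplacian (hn : 1 ≤ n) : Submodule ℝ (C(Sph n, ℝ) × C(Sph n, ℝ)) where
  carrier := {q | ∃ X : Eu n → Eu n, IsSmoothGradient q.1 X ∧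
    ∀ x : Sph n, tangentialDiv (sphere (0 : Eu n) 1) (x : Eu n) X x = q.2 x}
  add_mem' := by
    rintro a b ⟨X, hX, hX'⟩ ⟨Y, hY, hY'⟩
    refine ⟨X + Y, hX.add hY, fun x => ?_⟩
    have h1 := ((hX.contDiff.differentiable (by simp)).differentiableAt (x := (x : Eu n))).hasFDerivAt
    have h2 := ((hY.contDiff.differentiable (by simp)).differentiableAt (x := (x : Eu n))).hasFDerivAt
    rw [Prod.snd_add, ContinuousMap.add_apply, ← hX', ← hY',
      tangentialDiv_sphere x h1.hasFDerivWithinAt, tangentialDiv_sphere x h2.hasFDerivWithinAt,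
      tangentialDiv_sphere x (h1.add h2).hasFDerivWithinAt, ContinuousLinearMap.toLinearMap_add,
      map_add, _root_.add_apply, inner_add_right]
    ring
  zero_mem' := by
    refine ⟨0, isSmoothGradient_const hn 0, fun x => ?_⟩
    exact tangentialDiv_zero x
  smul_mem' := by
    rintro c a ⟨X, hX, hX'⟩
    refine ⟨c • X, hX.smul c, fun x => ?_⟩
    have h1 := ((hX.contDiff.differentiable (by simp)).differentiableAt (x := (x : Eu n))).hasFDerivAt
    rw [Prod.smul_snd, ContinuousMap.smul_apply, ← hX',
      tangentialDiv_sphere x h1.hasFDerivWithinAt,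
      tangentialDiv_sphere x (h1.const_smul c).hasFDerivWithinAt,
      ContinuousLinearMap.toLinearMap_smul, map_smul, _root_.smul_apply, real_inner_smul_right,
      smul_eq_mul, smul_eq_mul]
    ring

theorem one_mem_sphLaplacian (hn : 1 ≤ n) : ((1 : C(Sph n, ℝ)), (0 : C(Sph n, ℝ))) ∈
    sphLaplacian hn := by
  refine ⟨0, isSmoothGradient_const hn 1, fun x => ?_⟩
  exact tangentialDiv_zero x

theorem integral_mul_sphLaplacian_comm {hn : 1 ≤ n} {f w f' w' : C(Sph n, ℝ)}
    (h : (f, w) ∈ sphLaplacian hn) (h' : (f', w') ∈ sphLaplacian hn) :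
    ∫ x, f x * w' x ∂(sphMeasure n) = ∫ x, f' x * w x ∂(sphMeasure n) := by
  obtain ⟨X, hX, hXw⟩ := h
  obtain ⟨X', hX', hXw'⟩ := h'
  have h1 := hX.integral_eq X' hX'.contDiff hX'.tangent
  have h2 := hX'.integral_eq X hX.contDiff hX.tangent
  simp only [hXw, hXw'] at h1 h2
  rw [h1, h2]
  congr 1
  exact integral_congr_ae (Eventually.of_forall fun x => real_inner_comm _ _)

/-- This is `0 ≤ ∫ |g - X|²` for the gradient `X` of `f`, with `∫ |X|² = -∫ f w` and `∫ ⟨g, X⟩ = -∫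
u w`. -/
theorem integral_sub_two_mul_le {hn : 1 ≤ n} {f w : C(Sph n, ℝ)}
    (h : (f, w) ∈ sphLaplacian hn) {u : Sph n → ℝ} {g : Sph n → Eu n} (hg : Continuous g)
    (hug : IsWeakGradient u g) :
    (∫ x, f x * w x ∂(sphMeasure n)) - 2 * (∫ x, u x * w x ∂(sphMeasure n)) ≤
      ∫ x, ‖g x‖ ^ 2 ∂(sphMeasure n) := by
  obtain ⟨X, hX, hXw⟩ := h
  have h1 := hX.integral_eq X hX.contDiff hX.tangent
  have h2 := hug.integral_eq X hX.contDiff hX.tangent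
  simp only [hXw] at h1 h2
  have hXc : Continuous fun x : Sph n => X x := hX.contDiff.continuous.comp continuous_subtype_val
  have i1 : Integrable (fun x => ‖g x‖ ^ 2) (sphMeasure n) :=
    integrable_of_continuous (hg.norm.pow 2)
  have i2 : Integrable (fun x : Sph n => inner ℝ (g x) (X x)) (sphMeasure n) :=
    integrable_of_continuous (hg.inner hXc)
  have i3 : Integrable (fun x : Sph n => inner ℝ (X x) (X x)) (sphMeasure n) :=
    integrable_of_continuous (hXc.inner hXc)
  have i4 : Integrable (fun x : Sph n => ‖g x‖ ^ 2 - 2 * inner ℝ (g x) (X x)) (sphMeasure n) :=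
    i1.sub (i2.const_mul 2)
  have h3 : 0 ≤ ∫ x : Sph n, (‖g x‖ ^ 2 - 2 * inner ℝ (g x) (X x) + inner ℝ (X x) (X x))
      ∂(sphMeasure n) := by
    refine integral_nonneg fun x => ?_
    have e : ‖g x‖ ^ 2 - 2 * inner ℝ (g x) (X x) + inner ℝ (X x) (X x) = ‖g x - X x‖ ^ 2 := by
      rw [norm_sub_sq_real, real_inner_self_eq_norm_sq]
    exact e ▸ sq_nonneg _
  rw [integral_add i4 i3, integral_sub i1 (i2.const_mul 2), integral_const_mul] at h3
  linarith

/-! ### Even spherical harmonics -/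

/-- The linear function `⟨a, ·⟩` on the sphere. -/
def linFun (a : Eu n) : C(Sph n, ℝ) :=
  ⟨fun x => inner ℝ a (x : Eu n), continuous_const.inner continuous_subtype_val⟩

/-- For `ℓ = ⟨a, x⟩` the tangential gradient of `ℓ^m` is `m ℓ^(m-1) a - m ℓ^m x`, with divergence `m
(m-1) |a|² ℓ^(m-2) - m (m+n-2) ℓ^m`; here `m = k + 2`. The Laplacian is thus triangular on powers of
the same parity. -/
theorem linFun_pow_mem (hn : 1 ≤ n) (a : Eu n) (k : ℕ) :
    (linFun a ^ (k + 2), (((k + 2 : ℝ) * (k + 1)) * ‖a‖ ^ 2) • linFun a ^ k -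
      ((k + 2 : ℝ) * (k + n)) • linFun a ^ (k + 2)) ∈ sphLaplacian hn := by
  set φ : Eu n → ℝ := fun z => inner ℝ a z ^ (k + 2) with hφ
  set X : Eu n → Eu n := fun z => ((k + 2 : ℝ) * inner ℝ a z ^ (k + 1)) • a -
    ((k + 2 : ℝ) * inner ℝ a z ^ (k + 2)) • z with hXdef
  have hlinC : ContDiff ℝ ∞ fun z : Eu n => (inner ℝ a z : ℝ) := (innerSL ℝ a).contDiff
  have hX : ContDiff ℝ ∞ X := ((contDiff_const.mul (hlinC.pow _)).smul contDiff_const).sub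
    ((contDiff_const.mul (hlinC.pow _)).smul contDiff_id)
  have hφs : ContDiff ℝ ∞ φ := hlinC.pow _
  have hlin : ∀ z : Eu n, HasFDerivAt (fun z : Eu n => inner ℝ a z) (innerSL ℝ a) z :=
    fun z => (innerSL ℝ a).hasFDerivAt
  have htan : ∀ x : Sph n, inner ℝ (X x) (x : Eu n) = 0 := by
    intro x
    simp only [hXdef, inner_sub_left, real_inner_smul_left, inner_self_sph]
    ring
  refine ⟨X, ⟨hX, htan, fun Y hY hYt => ?_⟩, fun x => ?_⟩
  · refine integral_mul_tangentialDiv hn hφs (fun x v hv => ?_) hX.continuous hY hYt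
    rw [((hlin (x : Eu n)).pow (k + 2)).fderiv]
    simp only [hXdef, inner_sub_left, real_inner_smul_left, hv, _root_.smul_apply,
      innerSL_apply_apply, smul_eq_mul, nsmul_eq_mul, mul_zero, sub_zero]
    push_cast
    rfl
  · have h1 := ((((hlin (x : Eu n)).pow (k + 1)).const_mul (k + 2 : ℝ)).smul_const a).sub
      ((((hlin (x : Eu n)).pow (k + 2)).const_mul (k + 2 : ℝ)).smul (hasFDerivAt_id (x : Eu n)))
    refine (tangentialDiv_sphere (X := X) x h1.hasFDerivWithinAt).trans ?_
    have e : ∀ (p q : Eu n →L[ℝ] ℝ) (c : ℝ) (b z : Eu n),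
        ((p.smulRight b - (c • ContinuousLinearMap.id ℝ (Eu n) + q.smulRight z) :
          Eu n →L[ℝ] Eu n) : Eu n →ₗ[ℝ] Eu n) =
        (p : Eu n →ₗ[ℝ] ℝ).smulRight b - (c • LinearMap.id + (q : Eu n →ₗ[ℝ] ℝ).smulRight z) :=
      fun _ _ _ _ _ => rfl
    rw [e, map_sub, map_add, map_smul, LinearMap.trace_smulRight, LinearMap.trace_smulRight,
      LinearMap.trace_id]
    have hfr : (Module.finrank ℝ (Eu n) : ℝ) = n := by simp
    rw [hfr]
    have hs : inner ℝ (x : Eu n) a = inner ℝ a (x : Eu n) := real_inner_comm _ _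
    simp only [ContinuousLinearMap.coe_coe, _root_.smul_apply, _root_.sub_apply, _root_.add_apply,
      ContinuousLinearMap.smulRight_apply, innerSL_apply_apply, smul_eq_mul, nsmul_eq_mul,
      inner_sub_right, inner_add_right, real_inner_smul_right,
      ContinuousLinearMap.id_apply, real_inner_self_eq_norm_sq, hs, norm_coe_sph,
      ContinuousMap.sub_apply, ContinuousMap.smul_apply, ContinuousMap.pow_apply, linFun,
      ContinuousMap.coe_mk, Nat.add_sub_cancel, id]
    push_cast
    ring

/-- The eigenvalue of the Laplacian on harmonics of degree `2 k`. -/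
def evenEigenvalue (n k : ℕ) : ℝ := 2 * k * (2 * k + n - 2)

theorem evenEigenvalue_lt (hn : 1 ≤ n) {j k : ℕ} (h : j < k) :
    evenEigenvalue n j < evenEigenvalue n k := by
  have h1 : (j : ℝ) + 1 ≤ k := by exact_mod_cast h
  have h2 : (1 : ℝ) ≤ n := by exact_mod_cast hn
  have h3 : (0 : ℝ) ≤ j := by positivity
  unfold evenEigenvalue
  nlinarith

/-- Even spherical harmonics of degree `2 k`. -/
def evenHarmonics (hn : 1 ≤ n) (k : ℕ) : Submodule ℝ C(Sph n, ℝ) :=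
  -- Degree zero consists of the constants by definition, so the kernel of the Laplacian need not be
  -- identified.
  if k = 0 then Submodule.span ℝ {1} else
    (sphLaplacian hn).comap ((LinearMap.id (R := ℝ) (M := C(Sph n, ℝ))).prod
      (-(evenEigenvalue n k) • LinearMap.id))

theorem mem_evenHarmonics_of_ne {hn : 1 ≤ n} {k : ℕ} (hk : k ≠ 0) {f : C(Sph n, ℝ)} :
    f ∈ evenHarmonics hn k ↔ (f, -(evenEigenvalue n k) • f) ∈ sphLaplacian hn := by
  rw [evenHarmonics, if_neg hk]
  rfl

theorem mem_sphLaplacian_of_evenHarmonics {hn : 1 ≤ n} {k : ℕ} {f : C(Sph n, ℝ)}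
    (hf : f ∈ evenHarmonics hn k) : (f, -(evenEigenvalue n k) • f) ∈ sphLaplacian hn := by
  by_cases hk : k = 0
  · rw [evenHarmonics, if_pos hk] at hf
    obtain ⟨c, rfl⟩ := Submodule.mem_span_singleton.1 hf
    have h := (sphLaplacian hn).smul_mem c (one_mem_sphLaplacian hn)
    have e : -(evenEigenvalue n k) • c • (1 : C(Sph n, ℝ)) = c • 0 := by
      simp [evenEigenvalue, hk]
    rw [e]
    exact h
  · exact (mem_evenHarmonics_of_ne hk).1 hf

theorem integral_evenHarmonics_mul {hn : 1 ≤ n} {j k : ℕ} (hjk : j ≠ k) {f f' : C(Sph n, ℝ)}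
    (hf : f ∈ evenHarmonics hn j) (hf' : f' ∈ evenHarmonics hn k) :
    ∫ x, f x * f' x ∂(sphMeasure n) = 0 := by
  have h := integral_mul_sphLaplacian_comm (mem_sphLaplacian_of_evenHarmonics hf)
    (mem_sphLaplacian_of_evenHarmonics hf')
  have e1 : ∀ x, f x * (-(evenEigenvalue n k) • f') x = -(evenEigenvalue n k) * (f x * f' x) := by
    intro x; rw [ContinuousMap.smul_apply, smul_eq_mul]; ring
  have e2 : ∀ x, f' x * (-(evenEigenvalue n j) • f) x = -(evenEigenvalue n j) * (f x * f' x) := by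
    intro x; rw [ContinuousMap.smul_apply, smul_eq_mul]; ring
  simp only [e1, e2] at h
  rw [integral_const_mul, integral_const_mul] at h
  have hne : evenEigenvalue n j ≠ evenEigenvalue n k := by
    rcases lt_or_gt_of_ne hjk with h1 | h1
    · exact (evenEigenvalue_lt hn h1).ne
    · exact (evenEigenvalue_lt hn h1).ne'
  have h2 : (evenEigenvalue n j - evenEigenvalue n k) * ∫ x, f x * f' x ∂(sphMeasure n) = 0 := by
    linarith
  exact (mul_eq_zero.1 h2).resolve_left (sub_ne_zero.2 hne)

/-- By induction, `ℓ^(2k+2)` is an eigenfunction up to a multiple of `ℓ^(2k)`, which is already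
decomposed. Correcting it by lower harmonics makes it an exact one, because the eigenvalues are
distinct. -/
theorem exists_sum_evenHarmonics (hn : 1 ≤ n) (a : Eu n) (k : ℕ) :
    ∃ h : ℕ → C(Sph n, ℝ), (∀ j, h j ∈ evenHarmonics hn j) ∧
      linFun a ^ (2 * k) = ∑ j ∈ Finset.range (k + 1), h j := by
  induction k with
  | zero =>
    refine ⟨fun j => if j = 0 then 1 else 0, fun j => ?_, by simp⟩
    by_cases hj : j = 0
    · simp only [hj, if_true, evenHarmonics]
      exact Submodule.mem_span_singleton_self 1
    · simp only [hj, if_false]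
      exact Submodule.zero_mem _
  | succ k ih =>
    obtain ⟨h, hh, hsum⟩ := ih
    set lam := evenEigenvalue n (k + 1) with hlam
    set β : ℝ := ((2 * k + 2 : ℝ) * (2 * k + 1)) * ‖a‖ ^ 2 with hβ
    -- The coefficient solves `-lam t = β - t λ`, where `λ` is the eigenvalue of index `j`: this is
    -- the eigenvalue equation for `ψ` in degree `2 j`.
    set t : ℕ → ℝ := fun j => β / (evenEigenvalue n j - lam) with ht
    set ψ : C(Sph n, ℝ) := linFun a ^ (2 * k + 2) + ∑ j ∈ Finset.range (k + 1), t j • h j with hψ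
    have hψmem : ψ ∈ evenHarmonics hn (k + 1) := by
      rw [mem_evenHarmonics_of_ne (Nat.succ_ne_zero k)]
      have h1 := linFun_pow_mem hn a (2 * k)
      have h2 : (∑ j ∈ Finset.range (k + 1), t j • (h j, -(evenEigenvalue n j) • h j)) ∈
          sphLaplacian hn := Submodule.sum_mem _ fun j _ =>
        Submodule.smul_mem _ _ (mem_sphLaplacian_of_evenHarmonics (hh j))
      have h3 := Submodule.add_mem _ h1 h2
      convert h3 using 1
      refine Prod.ext ?_ ?_
      · rw [Prod.fst_add, Prod.fst_sum]
        rfl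
      · rw [Prod.snd_add, Prod.snd_sum, hsum]
        simp only [Prod.smul_snd]
        have e1 : ((((2 * k : ℕ) : ℝ) + 2) * (((2 * k : ℕ) : ℝ) + 1)) * ‖a‖ ^ 2 = β := by
          rw [hβ]; push_cast; ring
        have e2 : (((2 * k : ℕ) : ℝ) + 2) * (((2 * k : ℕ) : ℝ) + n) = lam := by
          rw [hlam, evenEigenvalue]; push_cast; ring
        rw [e1, e2, hψ, smul_add, Finset.smul_sum, Finset.smul_sum]
        have e3 : ∀ j ∈ Finset.range (k + 1), -lam • t j • h j =
            β • h j + t j • -evenEigenvalue n j • h j := by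
          intro j hj
          have hne : evenEigenvalue n j - lam ≠ 0 :=
            sub_ne_zero.2 (evenEigenvalue_lt hn (Finset.mem_range.1 hj)).ne
          rw [smul_smul, smul_smul, ← add_smul]
          congr 1
          simp only [ht]
          field_simp
          ring
        rw [Finset.sum_congr rfl e3, Finset.sum_add_distrib]
        rw [neg_smul]
        abel
    refine ⟨fun j => if j = k + 1 then ψ else -t j • h j, fun j => ?_, ?_⟩
    · by_cases hj : j = k + 1
      · simp only [hj, if_true]; exact hψmem
      · simp only [hj, if_false]; exact Submodule.smul_mem _ _ (hh j)
    · rw [Finset.sum_range_succ, if_pos rfl]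
      have e : ∑ j ∈ Finset.range (k + 1), (if j = k + 1 then ψ else -t j • h j) =
          -∑ j ∈ Finset.range (k + 1), t j • h j := by
        rw [← Finset.sum_neg_distrib]
        refine Finset.sum_congr rfl fun j hj => ?_
        rw [if_neg (Finset.mem_range.1 hj).ne, neg_smul]
      rw [e, hψ, show 2 * (k + 1) = 2 * k + 2 by ring]
      abel

/-! ### Density of even harmonics -/

/-- The reflection `x ↦ -x` of the sphere. -/
def sphNeg : C(Sph n, Sph n) := ⟨fun x => -x, continuous_neg⟩

/-- The symmetrization `f ↦ f + f ∘ (-·)`. -/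
def symmetrize : C(Sph n, ℝ) →ₗ[ℝ] C(Sph n, ℝ) where
  toFun f := f + f.comp sphNeg
  map_add' f f' := by ext x; simp; ring
  map_smul' c f := by ext x; simp

theorem continuous_symmetrize : Continuous (symmetrize (n := n)) :=
  continuous_id.add (ContinuousMap.continuous_precomp _)

theorem symmetrize_linFun_pow_mem (hn : 1 ≤ n) (a : Eu n) (m : ℕ) :
    symmetrize (linFun a ^ m) ∈ ⨆ k, evenHarmonics hn k := by
  have hneg : (linFun a ^ m).comp sphNeg = (-1) ^ m * linFun a ^ m := by
    ext x
    simp [linFun, sphNeg, ← mul_pow]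
  change linFun a ^ m + (linFun a ^ m).comp sphNeg ∈ _
  rw [hneg]
  rcases Nat.even_or_odd' m with ⟨k, rfl | rfl⟩
  · rw [pow_mul (-1 : C(Sph n, ℝ)), neg_one_sq, one_pow, one_mul]
    obtain ⟨h, hh, hsum⟩ := exists_sum_evenHarmonics hn a k
    have : linFun a ^ (2 * k) ∈ ⨆ k, evenHarmonics hn k := by
      rw [hsum]
      exact Submodule.sum_mem _ fun j _ => Submodule.mem_iSup_of_mem j (hh j)
    exact Submodule.add_mem _ this this
  · rw [pow_succ (-1 : C(Sph n, ℝ)), pow_mul (-1 : C(Sph n, ℝ)), neg_one_sq, one_pow, one_mul,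
      neg_one_mul, add_neg_cancel]
    exact Submodule.zero_mem _

theorem exp_linFun_apply (a : Eu n) (x : Sph n) :
    NormedSpace.exp (linFun a) x = Real.exp (inner ℝ a (x : Eu n)) := by
  have h := NormedSpace.exp_series_hasSum_exp' (𝕂 := ℝ) (linFun a)
  have h1 := (ContinuousMap.evalCLM ℝ x).hasSum h
  have h2 := NormedSpace.exp_series_hasSum_exp' (𝕂 := ℝ) (inner ℝ a (x : Eu n))
  rw [← Real.exp_eq_exp_ℝ] at h2
  exact h1.unique h2

/-- The exponentials of linear functions are closed under products and separate points, so by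
Stone–Weierstrass their span is dense. By their power series they belong to the closed subspace of
functions whose symmetrization is a limit of even harmonics, because odd powers symmetrize to zero.
-/
theorem symmetrize_mem_closure (hn : 1 ≤ n) (f : C(Sph n, ℝ)) :
    symmetrize f ∈ (⨆ k, evenHarmonics hn k).topologicalClosure := by
  set W := (⨆ k, evenHarmonics hn k).topologicalClosure with hW
  have hclosed : IsClosed ((W.comap symmetrize : Submodule ℝ C(Sph n, ℝ)) : Set C(Sph n, ℝ)) :=
    (Submodule.isClosed_topologicalClosure _).preimage continuous_symmetrize
  have hexp : ∀ a : Eu n, NormedSpace.exp (linFun a) ∈ W.comap symmetrize := by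
    intro a
    refine hclosed.mem_of_tendsto (NormedSpace.exp_series_hasSum_exp' (𝕂 := ℝ) (linFun a))
      (Eventually.of_forall fun s => Submodule.sum_mem _ fun m _ => Submodule.smul_mem _ _ ?_)
    exact Submodule.le_topologicalClosure _ (symmetrize_linFun_pow_mem hn a m)
  set S : Set C(Sph n, ℝ) := range fun a : Eu n => NormedSpace.exp (linFun a) with hS
  have hle : Subalgebra.toSubmodule (Algebra.adjoin ℝ S) ≤ W.comap symmetrize := by
    rw [Algebra.adjoin_eq_span, Submodule.span_le]
    intro f hf
    have : f ∈ S := by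
      induction hf using Submonoid.closure_induction with
      | mem x hx => exact hx
      | one =>
        refine ⟨0, ?_⟩
        have : linFun (0 : Eu n) = 0 := by ext x; simp [linFun]
        simp only [this, NormedSpace.exp_zero]
      | mul x y _ _ hx hy =>
        obtain ⟨a, rfl⟩ := hx
        obtain ⟨b, rfl⟩ := hy
        refine ⟨a + b, ?_⟩
        ext x
        simp only [ContinuousMap.mul_apply, exp_linFun_apply, inner_add_left, Real.exp_add]
    obtain ⟨a, rfl⟩ := this
    exact hexp a
  have hsep : (Algebra.adjoin ℝ S).SeparatesPoints := by
    intro x y hxy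
    refine ⟨_, ⟨_, Algebra.subset_adjoin ⟨(x : Eu n) - y, rfl⟩, rfl⟩, ?_⟩
    simp only [exp_linFun_apply]
    intro h
    have h1 := Real.exp_injective h
    have h2 : inner ℝ ((x : Eu n) - y) ((x : Eu n) - y) = 0 := by
      rw [inner_sub_right, h1, sub_self]
    exact hxy (Subtype.ext (sub_eq_zero.1 (inner_self_eq_zero.1 h2)))
  have htop := ContinuousMap.subalgebra_topologicalClosure_eq_top_of_separatesPoints _ hsep
  have hf : f ∈ closure ((Algebra.adjoin ℝ S : Subalgebra ℝ C(Sph n, ℝ)) : Set C(Sph n, ℝ)) := by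
    rw [← Subalgebra.topologicalClosure_coe, htop]
    trivial
  exact (closure_minimal (fun f hf => hle hf) hclosed) hf

/-! ### The Poincaré inequality for even functions -/

theorem integral_sum_mul_sum {hn : 1 ≤ n} {h : ℕ → C(Sph n, ℝ)}
    (hh : ∀ k, h k ∈ evenHarmonics hn k) (s : Finset ℕ) (a b : ℕ → ℝ) :
    ∫ x, (∑ j ∈ s, a j * h j x) * (∑ k ∈ s, b k * h k x) ∂(sphMeasure n) =
      ∑ k ∈ s, a k * b k * ∫ x, h k x ^ 2 ∂(sphMeasure n) := by
  have hi : ∀ j k, Integrable (fun x => a j * h j x * (b k * h k x)) (sphMeasure n) := fun j k =>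
    integrable_of_continuous (by fun_prop)
  simp only [Finset.sum_mul_sum]
  rw [integral_finsetSum _ fun j _ => integrable_finsetSum _ fun k _ => hi j k]
  refine Finset.sum_congr rfl fun j hj => ?_
  rw [integral_finsetSum _ fun k _ => hi j k, Finset.sum_eq_single_of_mem j hj]
  · rw [← integral_const_mul]
    refine integral_congr_ae (Eventually.of_forall fun x => ?_)
    ring
  · intro k _ hkj
    have e : ∀ x, a j * h j x * (b k * h k x) = a j * b k * (h j x * h k x) := fun x => by ring
    simp only [e]
    rw [integral_const_mul, integral_evenHarmonics_mul hkj.symm (hh j) (hh k), mul_zero]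

theorem integral_mul_sum {u : Sph n → ℝ} (hu : Continuous u) (h : ℕ → C(Sph n, ℝ))
    (s : Finset ℕ) (b : ℕ → ℝ) :
    ∫ x, u x * (∑ k ∈ s, b k * h k x) ∂(sphMeasure n) =
      ∑ k ∈ s, b k * ∫ x, u x * h k x ∂(sphMeasure n) := by
  simp only [Finset.mul_sum]
  rw [integral_finsetSum _ fun k _ => integrable_of_continuous (by fun_prop)]
  refine Finset.sum_congr rfl fun k _ => ?_
  rw [← integral_const_mul]
  refine integral_congr_ae (Eventually.of_forall fun x => ?_)
  ring

/-- The test function is the orthogonal projection of `u` onto the span of the chosen harmonics. If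
`h k` has zero norm, the quotient is `0` by convention and the term disappears. -/
theorem sum_evenEigenvalue_mul_le {hn : 1 ≤ n} {h : ℕ → C(Sph n, ℝ)}
    (hh : ∀ k, h k ∈ evenHarmonics hn k) (s : Finset ℕ) {u : Sph n → ℝ} {g : Sph n → Eu n}
    (hu : Continuous u) (hg : Continuous g) (hug : IsWeakGradient u g) :
    ∑ k ∈ s, evenEigenvalue n k * ((∫ x, u x * h k x ∂(sphMeasure n)) ^ 2 /
      ∫ x, h k x ^ 2 ∂(sphMeasure n)) ≤ ∫ x, ‖g x‖ ^ 2 ∂(sphMeasure n) := by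
  set A : ℕ → ℝ := fun k => ∫ x, u x * h k x ∂(sphMeasure n) with hA
  set N : ℕ → ℝ := fun k => ∫ x, h k x ^ 2 ∂(sphMeasure n) with hN
  have hmem : (∑ k ∈ s, (A k / N k) • (h k, -(evenEigenvalue n k) • h k)) ∈ sphLaplacian hn :=
    Submodule.sum_mem _ fun k _ =>
      Submodule.smul_mem _ _ (mem_sphLaplacian_of_evenHarmonics (hh k))
  have hpair : (∑ k ∈ s, (A k / N k) • (h k, -(evenEigenvalue n k) • h k)) =
      (∑ k ∈ s, (A k / N k) • h k, ∑ k ∈ s, (A k / N k) • -(evenEigenvalue n k) • h k) := by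
    refine Prod.ext ?_ ?_
    · rw [Prod.fst_sum]; rfl
    · rw [Prod.snd_sum]; rfl
  rw [hpair] at hmem
  have key := integral_sub_two_mul_le hmem hg hug
  have ef : ∀ x, (∑ k ∈ s, (A k / N k) • h k) x = ∑ k ∈ s, A k / N k * h k x := fun x => by
    simp
  have ew : ∀ x, (∑ k ∈ s, (A k / N k) • -(evenEigenvalue n k) • h k) x =
      ∑ k ∈ s, (A k / N k * -(evenEigenvalue n k)) * h k x := fun x => by
    simp [mul_assoc]
  simp only [ef, ew] at key
  rw [integral_sum_mul_sum hh, integral_mul_sum hu, Finset.mul_sum, ← Finset.sum_sub_distrib] at key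
  refine le_of_eq_of_le (Finset.sum_congr rfl fun k _ => ?_) key
  change evenEigenvalue n k * (A k ^ 2 / N k) =
    A k / N k * (A k / N k * -evenEigenvalue n k) * N k -
      2 * (A k / N k * -evenEigenvalue n k * A k)
  rcases eq_or_ne (N k) 0 with h0 | h0
  · simp [h0]
  · field_simp
    ring

/-- By orthogonality the left side is `∑ (2 A - N)` with `A = ∫ u h k` and `N = ∫ (h k)²`, and `2 A
- N ≤ A² / N` is `(A - N)² ≥ 0`. If `N = 0`, then `h k` vanishes almost everywhere and `A = 0`. -/
theorem integral_sq_sub_le {hn : 1 ≤ n} {h : ℕ → C(Sph n, ℝ)}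
    (hh : ∀ k, h k ∈ evenHarmonics hn k) (s : Finset ℕ) {u : Sph n → ℝ} (hu : Continuous u) :
    (∫ x, u x ^ 2 ∂(sphMeasure n)) - ∫ x, (u x - ∑ k ∈ s, h k x) ^ 2 ∂(sphMeasure n) ≤
    ∑ k ∈ s, ((∫ x, u x * h k x ∂(sphMeasure n)) ^ 2 / ∫ x, h k x ^ 2 ∂(sphMeasure n)) := by
  have h1 := integral_sum_mul_sum hh s (fun _ => 1) (fun _ => 1)
  have h2 := integral_mul_sum hu h s (fun _ => 1)
  simp only [one_mul] at h1 h2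
  have i1 : Integrable (fun x => u x ^ 2) (sphMeasure n) := integrable_of_continuous (by fun_prop)
  have i2 : Integrable (fun x => u x * ∑ k ∈ s, h k x) (sphMeasure n) :=
    integrable_of_continuous (by fun_prop)
  have i3 : Integrable (fun x => (∑ k ∈ s, h k x) * ∑ k ∈ s, h k x) (sphMeasure n) :=
    integrable_of_continuous (by fun_prop)
  have i4 : Integrable (fun x => u x ^ 2 - 2 * (u x * ∑ k ∈ s, h k x)) (sphMeasure n) :=
    i1.sub (i2.const_mul 2)
  have e : ∀ x, (u x - ∑ k ∈ s, h k x) ^ 2 = u x ^ 2 - 2 * (u x * ∑ k ∈ s, h k x) +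
    (∑ k ∈ s, h k x) * ∑ k ∈ s, h k x := fun x => by ring
  simp only [e]
  rw [integral_add i4 i3, integral_sub i1 (i2.const_mul 2), integral_const_mul, h1, h2]
  have h3 : ∀ k ∈ s, 2 * (∫ x, u x * h k x ∂(sphMeasure n)) - (∫ x, h k x ^ 2 ∂(sphMeasure n)) ≤
      (∫ x, u x * h k x ∂(sphMeasure n)) ^ 2 / ∫ x, h k x ^ 2 ∂(sphMeasure n) := by
    intro k _
    have hN0 : 0 ≤ ∫ x, h k x ^ 2 ∂(sphMeasure n) := integral_nonneg fun x => sq_nonneg _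
    rcases hN0.eq_or_lt with h0 | h0
    · have h4 : (fun x => h k x ^ 2) =ᵐ[sphMeasure n] 0 :=
        (integral_eq_zero_iff_of_nonneg (fun x => sq_nonneg _)
          (integrable_of_continuous ((h k).continuous.pow 2))).1 h0.symm
      have h5 : ∫ x, u x * h k x ∂(sphMeasure n) = 0 := by
        refine integral_eq_zero_of_ae ?_
        filter_upwards [h4] with x hx
        have : h k x = 0 := pow_eq_zero_iff two_ne_zero |>.1 hx
        simp [this]
      rw [h5, ← h0]
      simp
    · rw [le_div_iff₀ h0]
      nlinarith [sq_nonneg ((∫ x, u x * h k x ∂(sphMeasure n)) - ∫ x, h k x ^ 2 ∂(sphMeasure n))]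
  have h4 := Finset.sum_le_sum h3
  rw [Finset.sum_sub_distrib, ← Finset.mul_sum] at h4
  linarith

theorem exists_sum_evenHarmonics_approx (hn : 1 ≤ n) {u : Sph n → ℝ} (hu : Continuous u)
    (heven : ∀ x, u (-x) = u x) {δ : ℝ} (hδ : 0 < δ) :
    ∃ (s : Finset ℕ) (h : ℕ → C(Sph n, ℝ)), (∀ k, h k ∈ evenHarmonics hn k) ∧
      ∀ x, |u x - ∑ k ∈ s, h k x| ≤ δ := by
  set f : C(Sph n, ℝ) := (1 / 2 : ℝ) • ⟨u, hu⟩ with hf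
  have h1 := symmetrize_mem_closure hn f
  have hfu : ∀ x, symmetrize f x = u x := by
    intro x
    change (1 / 2 : ℝ) * u x + (1 / 2 : ℝ) * u (-x) = u x
    rw [heven]; ring
  obtain ⟨q, hq, hd⟩ := Metric.mem_closure_iff.1
    (show symmetrize f ∈ closure ((⨆ k, evenHarmonics hn k : Submodule ℝ C(Sph n, ℝ)) :
      Set C(Sph n, ℝ)) from h1) δ hδ
  obtain ⟨h, hh, hsum⟩ := (Submodule.mem_iSup_iff_exists_finsupp _ _).1 hq
  refine ⟨h.support, h, hh, fun x => ?_⟩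
  have h2 := (ContinuousMap.dist_apply_le_dist (f := symmetrize f) (g := q) x).trans hd.le
  rw [Real.dist_eq, hfu, ← hsum, Finsupp.sum] at h2
  simpa using h2

/-- The Poincaré inequality for even functions on the sphere, with the optimal constant `2 n`. -/
theorem even_poincare (hn : 1 ≤ n) {u : Sph n → ℝ} {g : Sph n → Eu n} (hu : Continuous u)
    (heven : ∀ x, u (-x) = u x) (hg : Continuous g) (hug : IsWeakGradient u g) :
    2 * n * ((∫ x, u x ^ 2 ∂(sphMeasure n)) - (∫ x, u x ∂(sphMeasure n)) ^ 2 /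
      (sphMeasure n).real univ) ≤ ∫ x, ‖g x‖ ^ 2 ∂(sphMeasure n) := by
  set σ := (sphMeasure n).real univ with hσ
  have hσ0 : 0 ≤ σ := measureReal_nonneg
  set A := ∫ x, u x ^ 2 ∂(sphMeasure n)
  set m := ∫ x, u x ∂(sphMeasure n) with hm
  set D := ∫ x, ‖g x‖ ^ 2 ∂(sphMeasure n)
  have key : ∀ δ : ℝ, 0 < δ → 2 * n * (A - m ^ 2 / σ) ≤ D + 2 * n * σ * δ ^ 2 := by
    intro δ hδ
    obtain ⟨s, h, hh, hs⟩ := exists_sum_evenHarmonics_approx hn hu heven hδ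
    have h1 := sum_evenEigenvalue_mul_le hh s hu hg hug
    have h2 := integral_sq_sub_le hh s hu
    have h3 : ∫ x, (u x - ∑ k ∈ s, h k x) ^ 2 ∂(sphMeasure n) ≤ σ * δ ^ 2 := by
      have h4 : ∫ x, (u x - ∑ k ∈ s, h k x) ^ 2 ∂(sphMeasure n) ≤
          ∫ _ : Sph n, δ ^ 2 ∂(sphMeasure n) := by
        refine integral_mono (integrable_of_continuous (by fun_prop)) (integrable_const _)
          fun x => ?_
        exact sq_le_sq' (abs_le.1 (hs x)).1 (abs_le.1 (hs x)).2
      rwa [integral_const, smul_eq_mul] at h4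
    set q : ℕ → ℝ := fun k => (∫ x, u x * h k x ∂(sphMeasure n)) ^ 2 /
      ∫ x, h k x ^ 2 ∂(sphMeasure n) with hq
    have hq0 : ∀ k, 0 ≤ q k := fun k =>
      div_nonneg (sq_nonneg _) (integral_nonneg fun x => sq_nonneg _)
    -- The degree zero component is the squared mean. The inequality is strict only if the chosen
    -- constant is zero and the mean is not.
    have hqz : q 0 ≤ m ^ 2 / σ := by
      have h5 := hh 0
      rw [evenHarmonics, if_pos rfl] at h5
      obtain ⟨c, hc⟩ := Submodule.mem_span_singleton.1 h5
      have h6 : ∀ x, h 0 x = c := fun x => by rw [← hc]; simp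
      simp only [hq, h6]
      rw [integral_mul_const, integral_const, smul_eq_mul, ← hm, ← hσ]
      rcases eq_or_ne c 0 with hc0 | hc0
      · rw [hc0]
        simp only [mul_zero, ne_eq, OfNat.ofNat_ne_zero, not_false_eq_true, zero_pow, zero_div]
        positivity
      · refine le_of_eq ?_
        rw [mul_pow, mul_div_mul_right _ _ (pow_ne_zero 2 hc0)]
    -- For `k ≥ 1` the eigenvalue `2 k (2 k + n - 2)` is at least `2 n`; the degree zero term is
    -- paid for by the mean.
    have h7 : ∑ k ∈ s, 2 * n * q k ≤ (∑ k ∈ s, evenEigenvalue n k * q k) + 2 * n * (m ^ 2 / σ) := by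
      have h8 : ∀ k ∈ s, 2 * n * q k ≤ evenEigenvalue n k * q k +
          if k = 0 then 2 * n * q 0 else 0 := by
        intro k _
        by_cases hk : k = 0
        · subst hk
          simp [evenEigenvalue]
        · rw [if_neg hk, add_zero]
          refine mul_le_mul_of_nonneg_right ?_ (hq0 k)
          have hk1 : (1 : ℝ) ≤ k := by exact_mod_cast Nat.one_le_iff_ne_zero.2 hk
          have hn1 : (1 : ℝ) ≤ n := by exact_mod_cast hn
          unfold evenEigenvalue
          nlinarith
      refine (Finset.sum_le_sum h8).trans ?_
      rw [Finset.sum_add_distrib, Finset.sum_ite_eq']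
      have h9 : 2 * n * q 0 ≤ 2 * n * (m ^ 2 / σ) := by gcongr
      split_ifs
      · linarith
      · have : 0 ≤ 2 * n * (m ^ 2 / σ) := by positivity
        linarith
    rw [← Finset.mul_sum] at h7
    have h10 : 2 * n * (A - σ * δ ^ 2) ≤ 2 * n * ∑ k ∈ s, q k := by
      gcongr
      linarith
    have h11 : ∑ k ∈ s, evenEigenvalue n k * q k ≤ D := h1
    linarith
  have hlim : Tendsto (fun δ : ℝ => D + 2 * n * σ * δ ^ 2) (𝓝[>] 0) (𝓝 D) := by
    have : Continuous fun δ : ℝ => D + 2 * n * σ * δ ^ 2 := by fun_prop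
    have h0 := (this.tendsto 0).mono_left (nhdsWithin_le_nhds (s := Ioi 0))
    simpa using h0
  exact ge_of_tendsto hlim (by filter_upwards [self_mem_nhdsWithin] with δ hδ using key δ hδ)

end

/-! ### Radial sets, the equality case and the final algebra. -/

section

open scoped NNReal ENNReal

variable {n : ℕ} {u : Sph n → ℝ} {r : ℝ}

theorem IsWeakGradient.congr {g g' : Sph n → Eu n} (h : IsWeakGradient u g)
    (hg : g =ᵐ[sphMeasure n] g') : IsWeakGradient u g' where
  integrable_fun := h.integrable_fun
  integrable_grad := h.integrable_grad.congr hg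
  tangent := by
    filter_upwards [h.tangent, hg] with x hx hgx
    rwa [← hgx]
  integral_eq X hX hXt := by
    rw [h.integral_eq X hX hXt]
    congr 1
    refine integral_congr_ae ?_
    filter_upwards [hg] with x hx
    rw [hx]

theorem isRadialRegion_radialSet (hr : 0 < r) (hu : ∀ x, 0 < 1 + u x) :
    IsRadialRegion (radialSet r u) r u := by
  intro x t ht
  constructor
  · rintro ⟨y, s, hs, h⟩
    have hρ : 0 < r * (1 + u y) := mul_pos hr (hu y)
    have hsρ : 0 < s * r * (1 + u y) := by
      rw [mul_assoc]
      exact mul_pos hs.1 hρ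
    have h1 : t = s * r * (1 + u y) := by
      have := congrArg norm h
      rwa [norm_smul, norm_smul, norm_coe_sph, norm_coe_sph, mul_one, mul_one,
        Real.norm_of_nonneg ht.le, Real.norm_of_nonneg hsρ.le] at this
    rw [← h1] at h
    have h2 : x = y := Subtype.ext (smul_right_injective (Eu n) ht.ne' h)
    rw [h1, h2]
    nlinarith [hs.2]
  · intro h
    have hρ : 0 < r * (1 + u x) := mul_pos hr (hu x)
    refine ⟨x, t / (r * (1 + u x)), ⟨div_pos ht hρ, (div_lt_one hρ).2 h⟩, ?_⟩
    rw [mul_assoc, div_mul_cancel₀ _ hρ.ne']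

theorem isRadialRegion_ball (r : ℝ) : IsRadialRegion (ball (0 : Eu n) r) r 0 := by
  intro x t ht
  rw [mem_ball_zero_iff, norm_smul, norm_coe_sph, Real.norm_of_nonneg ht.le]
  simp

theorem IsRadialRegion.even {E : Set (Eu n)} (hE : IsRadialRegion E r u) (hr : 0 < r)
    (hu : ∀ x, 0 < 1 + u x) (hsymm : E = -E) (x : Sph n) : u (-x) = u x := by
  have key : ∀ (x : Sph n) (t : ℝ), 0 < t → (t < r * (1 + u (-x)) ↔ t < r * (1 + u x)) := by
    intro x t ht
    rw [← hE x t ht, ← hE (-x) t ht]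
    conv_rhs => rw [hsymm]
    simp
  have h1 : r * (1 + u (-x)) = r * (1 + u x) := by
    apply le_antisymm
    · by_contra! h
      exact lt_irrefl _ ((key x _ (mul_pos hr (hu x))).1 h)
    · by_contra! h
      exact lt_irrefl _ ((key x _ (mul_pos hr (hu (-x)))).2 h)
  have := mul_left_cancel₀ hr.ne' h1
  linarith

/-- The implication lets the threshold be fixed before the sign of `δ` is known, for instance that
of `r² - n + 2`. -/
theorem exists_pos_forall_mul_lt (K δ : ℝ) (hK : 0 ≤ K) : ∃ e : ℝ, 0 < e ∧ (0 < δ → K * e < δ) := by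
  by_cases hδ : 0 < δ
  · refine ⟨δ / (K + 1), by positivity, fun _ => ?_⟩
    rw [mul_div_assoc', div_lt_iff₀ (by positivity)]
    nlinarith
  · exact ⟨1, one_pos, fun h => absurd h hδ⟩

/-- The equality case: a volume preserving perturbation with constant profile is trivial. -/
theorem eq_zero_of_forall_eq (hn : 2 ≤ n) (hr : 0 < r) {E E' : Set (Eu n)} (hu : Continuous u)
    (hpos : ∀ x, 0 < 1 + u x) (hE : IsRadialRegion E r u) (hE' : IsRadialRegion E' r 0)
    (hvol : gaussianVolume E = gaussianVolume E') (hconst : ∀ x y, u x = u y) : u = 0 := by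
  funext x₀
  have h := integral_gaussPrim_eq hn hr hu (fun x => mul_pos hr (hpos x)) hE hE' hvol
  have h1 : ∀ x, gaussPrim n (r * (1 + u x)) - gaussPrim n r =
      gaussPrim n (r * (1 + u x₀)) - gaussPrim n r := fun x => by rw [hconst x x₀]
  simp only [h1, integral_const, smul_eq_mul, mul_eq_zero] at h
  have hσ : (sphMeasure n).real univ ≠ 0 :=
    ENNReal.toReal_ne_zero.2 ⟨isOpen_univ.measure_ne_zero _ ⟨x₀, mem_univ _⟩, measure_ne_top _ _⟩
  have h2 := sub_eq_zero.1 (h.resolve_left hσ)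
  rcases lt_trichotomy (u x₀) 0 with h0 | h0 | h0
  · exact absurd h2 (gaussPrim_lt hn (mul_pos hr (hpos x₀)).le (by nlinarith)).ne
  · simpa using h0
  · exact absurd h2 (gaussPrim_lt hn hr.le (by nlinarith)).ne'

/-- The elementary inequalities behind the stability estimates: `A = ‖u‖²`, `G = ‖∇u‖²`, and `D`
is the deficit of the curvature functional. -/
theorem deficit_bounds {N r c K D A G ε e : ℝ} (hN : 2 ≤ N) (hc : 0 < c) (hK : 0 ≤ K)
    (hA : 0 ≤ A) (hG : 0 ≤ G) (hε : 0 ≤ ε) (hεe : ε ≤ e) (he : 0 < e) (hKe : K * e ≤ c)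
    (hD : |D - c * ((N - 1) * (N - 2) * A + (r ^ 2 - N + 2) * G)| ≤ K * ε * ((N - 2) * A + G))
    {C : ℝ} (hC : C = K * (N - 1) / c + (|r ^ 2 - N + 2| + 1) / e) :
    c * (r ^ 2 - N + 2 - C * e) * (A + G) ≤ D ∧
    c * (r ^ 2 - N + 2 - C * ε) * G ≤ D ∧
    (r ^ 2 ≤ N * (N - 2) → c * (r ^ 2 - N + 2 - C * ε) * (A + G) ≤ D) ∧
    (c * (r ^ 2 - N + 2) - K * ε) * G ≤ D ∧
    ((N - 1) * (2 * N + 1) * A ≤ (N + 1) * G →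
      D ≤ c * (K * (N - 1) / c * ε + r ^ 2 - (N - 2) * ((N - 1) / (2 * N))) * (A + G) ∧
      D ≤ c * (C * ε + r ^ 2 - (N - 2) * ((N - 1) / (2 * N))) * (A + G)) := by
  obtain ⟨hD1, hD2⟩ := abs_le.1 hD
  set R := r ^ 2 - N + 2 with hR
  have hm : 0 ≤ N - 2 := by linarith
  have hmA : 0 ≤ (N - 2) * A := mul_nonneg hm hA
  have hKε : K * ε ≤ c := (mul_le_mul_of_nonneg_left hεe hK).trans hKe
  have hKε0 : 0 ≤ K * ε := mul_nonneg hK hε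
  have hAG : 0 ≤ A + G := add_nonneg hA hG
  -- As `K ε ≤ c ≤ c (N - 1)`, the error in `A` is absorbed by the main term `c (N-1)(N-2) A`.
  have hlow : (c * R - K * ε) * G ≤ D := by
    have h1 : K * ε * ((N - 2) * A) ≤ c * (N - 1) * ((N - 2) * A) :=
      mul_le_mul_of_nonneg_right (by nlinarith) hmA
    nlinarith
  have hC0 : K * (N - 1) / c ≤ C := by
    rw [hC]
    have : 0 ≤ (|R| + 1) / e := by positivity
    linarith
  have hcC : K * (N - 1) ≤ c * C := by
    have := mul_le_mul_of_nonneg_left hC0 hc.le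
    rwa [mul_div_cancel₀ _ hc.ne'] at this
  have hcCε : K * (N - 1) * ε ≤ c * C * ε := mul_le_mul_of_nonneg_right hcC hε
  have hKεN : K * ε ≤ K * (N - 1) * ε := by nlinarith
  -- This makes the coefficient `R - C e` of the first bound at most `-1`: its `A` part is
  -- nonpositive, and the remaining unit covers `K ε ≤ c` in the `G` part.
  have hC1 : |R| + 1 ≤ C * e := by
    rw [hC, add_mul, div_mul_cancel₀ _ he.ne']
    have : 0 ≤ K * (N - 1) / c * e := by
      have : 0 ≤ N - 1 := by linarith
      positivity
    linarith
  have herr : K * ε * ((N - 2) * A + G) ≤ K * (N - 1) * ε * (A + G) := by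
    have h1 : (N - 2) * A + G ≤ (N - 1) * (A + G) := by nlinarith
    nlinarith [mul_le_mul_of_nonneg_left h1 hKε0]
  have hR1 : R ≤ |R| := le_abs_self R
  refine ⟨?_, ?_, fun h => ?_, hlow, fun h => ?_⟩
  · refine le_trans ?_ hlow
    have h1 : c * (R - C * e) * A ≤ 0 :=
      mul_nonpos_of_nonpos_of_nonneg (mul_nonpos_of_nonneg_of_nonpos hc.le (by linarith)) hA
    have h2 : c * (R - C * e) ≤ c * R - K * ε := by
      have : c * 1 ≤ c * (C * e) :=
        mul_le_mul_of_nonneg_left (by linarith [abs_nonneg R]) hc.le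
      linarith
    have h3 := mul_le_mul_of_nonneg_right h2 hG
    linarith
  · refine le_trans (mul_le_mul_of_nonneg_right ?_ hG) hlow
    linarith
  · have h1 : R * A ≤ (N - 1) * (N - 2) * A := mul_le_mul_of_nonneg_right (by linarith) hA
    have h2 := mul_le_mul_of_nonneg_left h1 hc.le
    have h3 := mul_le_mul_of_nonneg_right hcCε hAG
    nlinarith
  · have hN0 : 0 < N := by linarith
    have hkey : (N - 1) * (N - 2) * A + R * G ≤
        (r ^ 2 - (N - 2) * ((N - 1) / (2 * N))) * (A + G) := by
      have h1 : (r ^ 2 - (N - 2) * ((N - 1) / (2 * N))) * (A + G) -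
          ((N - 1) * (N - 2) * A + R * G) =
          r ^ 2 * A + (N - 2) / (2 * N) * ((N + 1) * G - (N - 1) * (2 * N + 1) * A) := by
        rw [hR]
        field_simp
        ring
      have h2 : 0 ≤ r ^ 2 * A := by positivity
      have h3 : 0 ≤ (N - 2) / (2 * N) * ((N + 1) * G - (N - 1) * (2 * N + 1) * A) :=
        mul_nonneg (by positivity) (by linarith)
      linarith
    have h1 := mul_le_mul_of_nonneg_left hkey hc.le
    have h2 : D ≤ c * (K * (N - 1) / c * ε + r ^ 2 - (N - 2) * ((N - 1) / (2 * N))) * (A + G) := by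
      have : c * (K * (N - 1) / c * ε + r ^ 2 - (N - 2) * ((N - 1) / (2 * N))) * (A + G) =
          K * (N - 1) * ε * (A + G) +
            c * ((r ^ 2 - (N - 2) * ((N - 1) / (2 * N))) * (A + G)) := by
        field_simp
        ring
      rw [this]
      linarith
    refine ⟨h2, h2.trans (mul_le_mul_of_nonneg_right (mul_le_mul_of_nonneg_left ?_ hc.le) hAG)⟩
    have := mul_le_mul_of_nonneg_right hC0 hε
    linarith

/-- Even volume preserving perturbations have a spectral gap close to `2 n`. -/
theorem even_spectral_gap (hn : 2 ≤ n) {g : Sph n → Eu n} {ε K : ℝ} (hu : Continuous u)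
    (hg : Continuous g) (hug : IsWeakGradient u g) (heven : ∀ x, u (-x) = u x)
    (hε : 0 ≤ ε) (huε : ∀ x, |u x| ≤ ε) (hK : 0 ≤ K) (hKε : K * (n + 1) * ε ≤ 1)
    (hint : |∫ x, u x ∂(sphMeasure n)| ≤ K * ∫ x, u x ^ 2 ∂(sphMeasure n)) :
    ((n : ℝ) - 1) * (2 * n + 1) * (∫ x, u x ^ 2 ∂(sphMeasure n)) ≤
      (n + 1) * ∫ x, ‖g x‖ ^ 2 ∂(sphMeasure n) := by
  have h := even_poincare (by omega) hu heven hg hug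
  set A := ∫ x, u x ^ 2 ∂(sphMeasure n)
  set G := ∫ x, ‖g x‖ ^ 2 ∂(sphMeasure n)
  set s := ∫ x, u x ∂(sphMeasure n)
  set σ := (sphMeasure n).real univ
  have hA : 0 ≤ A := integral_nonneg fun x => sq_nonneg _
  have hAσ : A ≤ ε ^ 2 * σ := by
    have h1 : A ≤ ∫ _ : Sph n, ε ^ 2 ∂(sphMeasure n) :=
      integral_mono (integrable_of_continuous (hu.pow 2)) (integrable_const _) fun x => by
        have := huε x
        rw [← sq_abs]
        gcongr
    simpa [mul_comm, σ] using h1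
  have hN : (2 : ℝ) ≤ n := by exact_mod_cast hn
  -- The squared mean is of fourth order: one factor `A` is traded for `ε² σ`, so `s² / σ` is a
  -- small multiple of `A`.
  have hs : s ^ 2 ≤ (K * A) ^ 2 := by
    rw [← sq_abs s]
    gcongr
  have hs2 : s ^ 2 / σ ≤ (K * ε) ^ 2 * A := by
    rcases (measureReal_nonneg : 0 ≤ σ).eq_or_lt with h0 | h0
    · rw [show σ = 0 from h0.symm, div_zero]
      positivity
    · rw [div_le_iff₀ h0]
      have : K ^ 2 * A * A ≤ K ^ 2 * A * (ε ^ 2 * σ) :=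
        mul_le_mul_of_nonneg_left hAσ (by positivity)
      nlinarith
  have hKε2 : (n + 1) * (K * ε) ^ 2 ≤ 1 := by
    have h0 : 0 ≤ K * ε := mul_nonneg hK hε
    have h1 : (n + 1) * (K * ε) ≤ 1 := by linarith
    have h2 : K * ε ≤ 1 := by nlinarith
    nlinarith
  have h3 : 2 * (n : ℝ) * (n + 1) * (s ^ 2 / σ) ≤ 2 * n * A := by
    have h4 := mul_le_mul_of_nonneg_right hKε2 hA
    have h5 : (n + 1) * (s ^ 2 / σ) ≤ A := by nlinarith
    nlinarith
  -- The mean costs at most `2 n A`, so `(n + 1) G ≥ 2 n² A`, and `2 n²` exceeds `(n - 1)(2 n + 1)`.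
  have h6 : (n + 1) * (2 * n * (A - s ^ 2 / σ)) ≤ (n + 1) * G := by gcongr
  nlinarith

theorem integral_sq_pos (hu : Continuous u) (hu0 : u ≠ 0) :
    0 < ∫ x, u x ^ 2 ∂(sphMeasure n) := by
  obtain ⟨x, hx⟩ := Function.ne_iff.1 hu0
  exact (hu.pow 2).integral_pos_of_hasCompactSupport_nonneg_nonzero
    (HasCompactSupport.of_compactSpace _) (fun x => sq_nonneg _) (x := x)
    (pow_ne_zero 2 (by simpa using hx))

end

end GaussCurv

end

/-! ### Choice of the constants and assembly of the estimates. -/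

theorem theorem4p3 (n : ℕ) (hn : 2 ≤ n) (r : ℝ) (hr : 0 < r) :
    ∃ ε₀ : ℝ, 0 < ε₀ ∧ ∃ C : ℝ, 0 < C ∧
      ∀ (u : GaussCurv.Sph n → ℝ) (ε : ℝ), GaussCurv.MemW2Inf u →
        GaussCurv.w2InfNorm u ≤ ε → ε < ε₀ →
        GaussCurv.gaussianVolume (GaussCurv.radialSet r u) =
          GaussCurv.gaussianVolume (Metric.ball (0 : GaussCurv.Eu n) r) →
        -- the integral defining the functional converges
        MeasureTheory.IntegrableOn (GaussCurv.weightedCurvature (GaussCurv.radialSet r u))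
          (frontier (GaussCurv.radialSet r u))
          (MeasureTheory.Measure.euclideanHausdorffMeasure (n - 1)) ∧
        -- lower bound
        r ^ (n - 2) * Real.exp (-r ^ 2 / 2) * (r ^ 2 - n + 2 - C * ε₀) * GaussCurv.w12Norm u ^ 2 ≤
          GaussCurv.curvatureIntegral (Metric.ball (0 : GaussCurv.Eu n) r) -
            GaussCurv.curvatureIntegral (GaussCurv.radialSet r u) ∧
        -- lower bound by the gradient, with error proportional to `ε`
        r ^ (n - 2) * Real.exp (-r ^ 2 / 2) * (r ^ 2 - n + 2 - C * ε) * GaussCurv.gradNormSq u ≤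
          GaussCurv.curvatureIntegral (Metric.ball (0 : GaussCurv.Eu n) r) -
            GaussCurv.curvatureIntegral (GaussCurv.radialSet r u) ∧
        -- lower bound by the full norm, with error proportional to `ε`
        (r ^ 2 ≤ n * ((n : ℝ) - 2) →
          r ^ (n - 2) * Real.exp (-r ^ 2 / 2) * (r ^ 2 - n + 2 - C * ε) *
              GaussCurv.w12Norm u ^ 2 ≤
            GaussCurv.curvatureIntegral (Metric.ball (0 : GaussCurv.Eu n) r) -
              GaussCurv.curvatureIntegral (GaussCurv.radialSet r u)) ∧
        -- local maximality of the ball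
        ((n : ℝ) - 2 < r ^ 2 → u ≠ 0 →
          GaussCurv.curvatureIntegral (GaussCurv.radialSet r u) <
            GaussCurv.curvatureIntegral (Metric.ball (0 : GaussCurv.Eu n) r)) ∧
        -- symmetric sets: upper bound, and failure of local maximality
        (GaussCurv.radialSet r u = -GaussCurv.radialSet r u →
          GaussCurv.curvatureIntegral (Metric.ball (0 : GaussCurv.Eu n) r) -
              GaussCurv.curvatureIntegral (GaussCurv.radialSet r u) ≤
            r ^ (n - 2) * Real.exp (-r ^ 2 / 2) *
              (C * ε + r ^ 2 - ((n : ℝ) - 2) * (((n : ℝ) - 1) / (2 * n))) *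
                GaussCurv.w12Norm u ^ 2 ∧
          (r ^ 2 < ((n : ℝ) - 2) * ((n : ℝ) - 1) / (2 * n) → u ≠ 0 →
            GaussCurv.curvatureIntegral (Metric.ball (0 : GaussCurv.Eu n) r) <
              GaussCurv.curvatureIntegral (GaussCurv.radialSet r u))) := by
  have hN : (2 : ℝ) ≤ n := by exact_mod_cast hn
  obtain ⟨K, hK, hexp⟩ := GaussCurv.exists_curvatureIntegral_expansion hn hr
  obtain ⟨K', hK', hmean⟩ := GaussCurv.exists_abs_integral_le hn hr
  have hc : 0 < GaussCurv.gaussWeight n r := GaussCurv.gaussWeight_pos hr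
  set c := GaussCurv.gaussWeight n r
  have hC₁ : 0 ≤ K * ((n : ℝ) - 1) / c := by
    have : (0 : ℝ) ≤ n - 1 := by linarith
    positivity
  obtain ⟨e₁, he₁, h₁⟩ := GaussCurv.exists_pos_forall_mul_lt K c hK
  obtain ⟨e₂, he₂, h₂⟩ :=
    GaussCurv.exists_pos_forall_mul_lt K (c * (r ^ 2 - n + 2)) hK
  obtain ⟨e₃, he₃, h₃⟩ :=
    GaussCurv.exists_pos_forall_mul_lt (K' * ((n : ℝ) + 1)) 1 (by positivity)
  -- The threshold uses `K (n - 1) / c` instead of the final `C`: the latter grows as the threshold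
  -- shrinks, and `C e ≥ 1` always holds.
  obtain ⟨e₄, he₄, h₄⟩ := GaussCurv.exists_pos_forall_mul_lt (K * ((n : ℝ) - 1) / c)
    (((n : ℝ) - 2) * ((n : ℝ) - 1) / (2 * n) - r ^ 2) hC₁
  obtain ⟨e, he, hehalf, hee₁, hee₂, hee₃, hee₄⟩ : ∃ e : ℝ, 0 < e ∧ e ≤ 1 / 2 ∧ e ≤ e₁ ∧ e ≤ e₂ ∧
      e ≤ e₃ ∧ e ≤ e₄ :=
    ⟨min (1 / 2) (min e₁ (min e₂ (min e₃ e₄))), by positivity, by simp, by simp, by simp,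
      by simp, by simp⟩
  refine ⟨e, he, K * (n - 1) / c + (|r ^ 2 - n + 2| + 1) / e, by positivity, ?_⟩
  intro u ε hu huε hεe hvol
  obtain ⟨g, hgae, hC11⟩ := hu.exists_isC11 hn huε
  have hε : 0 ≤ ε := le_trans (by unfold GaussCurv.w2InfNorm; positivity) huε
  have hε2 : ε ≤ 1 / 2 := hεe.le.trans hehalf
  have hpos : ∀ x, 0 < 1 + u x := fun x => by linarith [hC11.one_add_pos hε2 x]
  have hE := GaussCurv.isRadialRegion_radialSet hr hpos
  have hB := GaussCurv.isRadialRegion_ball (n := n) r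
  have hgrad : GaussCurv.gradNormSq u = ∫ x, ‖g x‖ ^ 2 ∂(GaussCurv.sphMeasure n) := by
    refine MeasureTheory.integral_congr_ae ?_
    filter_upwards [hgae] with x hx
    rw [hx]
  have hD := hexp _ _ u g ε hC11 hε hε2 hE hB hvol
  have hA : 0 ≤ ∫ x, u x ^ 2 ∂(GaussCurv.sphMeasure n) :=
    MeasureTheory.integral_nonneg fun x => sq_nonneg _
  have hG : 0 ≤ ∫ x, ‖g x‖ ^ 2 ∂(GaussCurv.sphMeasure n) :=
    MeasureTheory.integral_nonneg fun x => sq_nonneg _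
  have hw : GaussCurv.w12Norm u ^ 2 = (∫ x, u x ^ 2 ∂(GaussCurv.sphMeasure n)) +
      ∫ x, ‖g x‖ ^ 2 ∂(GaussCurv.sphMeasure n) := by
    rw [GaussCurv.w12Norm, hgrad, Real.sq_sqrt (add_nonneg hA hG)]
  have hApos : u ≠ 0 → 0 < ∫ x, u x ^ 2 ∂(GaussCurv.sphMeasure n) := fun hu0 =>
    GaussCurv.integral_sq_pos hu.continuous hu0
  have hcontg := hC11.continuous_grad
  have hug : GaussCurv.IsWeakGradient u g := hu.isWeakGradient.congr hgae
  have hGpos : u ≠ 0 → 0 < ∫ x, ‖g x‖ ^ 2 ∂(GaussCurv.sphMeasure n) := by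
    intro hu0
    -- A zero Dirichlet integral makes `u` constant, and the volume constraint leaves only the
    -- constant zero.
    refine hG.lt_of_ne fun h0 => hu0 ?_
    refine GaussCurv.eq_zero_of_forall_eq hn hr hu.continuous hpos hE hB hvol
      (GaussCurv.eq_of_weakGradient_ae_eq_zero hn hu.continuous hug ?_)
    have h5 := (MeasureTheory.integral_eq_zero_iff_of_nonneg (fun x => sq_nonneg ‖g x‖)
      (GaussCurv.integrable_of_continuous (hcontg.norm.pow 2))).1 h0.symm
    filter_upwards [h5] with x hx
    simpa using hx
  have hcr : r ^ (n - 2) * Real.exp (-r ^ 2 / 2) = c := rfl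
  rw [hcr, hw, hgrad]
  set A := ∫ x, u x ^ 2 ∂(GaussCurv.sphMeasure n)
  set G := ∫ x, ‖g x‖ ^ 2 ∂(GaussCurv.sphMeasure n)
  obtain ⟨b₁, b₂, b₃, b₄, b₅⟩ := GaussCurv.deficit_bounds hN hc hK hA hG hε hεe.le he
    ((mul_le_mul_of_nonneg_left hee₁ hK).trans (h₁ hc).le) hD rfl
  refine ⟨(GaussCurv.integrableOn_weightedCurvature hC11 hε2 (by positivity) hr hn hE).1, b₁, b₂,
    b₃, fun hrn hu0 => ?_, fun hsymm => ?_⟩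
  · have h5 : K * ε < c * (r ^ 2 - n + 2) :=
      (mul_le_mul_of_nonneg_left (hεe.le.trans hee₂) hK).trans_lt
        (h₂ (mul_pos hc (by linarith)))
    have h6 := mul_pos (sub_pos.2 h5) (hGpos hu0)
    linarith
  · have hgap := GaussCurv.even_spectral_gap hn hu.continuous hcontg hug
      (hE.even hr hpos hsymm) hε hC11.abs_le hK'
      ((mul_le_mul_of_nonneg_left (hεe.le.trans hee₃) (by positivity)).trans (h₃ one_pos).le)
      (hmean _ _ u hu.continuous (fun x => (hC11.abs_le x).trans hε2) hE hB hvol)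
    obtain ⟨b₆, b₇⟩ := b₅ hgap
    refine ⟨b₇, fun hrn hu0 => ?_⟩
    have h5 := (mul_le_mul_of_nonneg_left (hεe.le.trans hee₄) hC₁).trans_lt
      (h₄ (sub_pos.2 hrn))
    rw [mul_div_assoc ((n : ℝ) - 2)] at h5
    have h6 : c * (K * (n - 1) / c * ε + r ^ 2 - ((n : ℝ) - 2) * ((n - 1) / (2 * n))) * (A + G) <
        0 :=
      mul_neg_of_neg_of_pos (mul_neg_of_pos_of_neg hc (by linarith))
        (add_pos_of_pos_of_nonneg (hApos hu0) hG)
    linarith
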